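/- Let $(\mathcal V,\mathcal E)$ be a finite directed graph (multiple edges and loops allowed), where each edge $e$ has an initial vertex $i(e)$ and a terminal vertex $t(e)$. Assume that its adjacency matrix $M(\xi,\eta)=\#\{e\in\mathcal E : i(e)=\xi,\ t(e)=\eta\}$ is irreducible (for all $\xi,\eta$ there is $n\geq 1$ with $M^n(\xi,\eta)>0$) and is not a permutation matrix. Let $$X=\{(x_k)_{k}\in\mathcal E^{\mathbb N} : t(x_k)=i(x_{k+1})\ \text{for all } k\}$$ with the product topology, let $\sigma:X\to X$ be the shift $\sigma(x)_k=x_{k+1}$, and let $$G=\{(x,n,y)\in X\times\mathbb Z\times X : \exists\, k,l,\ n=k-l,\ \sigma^k(x)=\sigma^l(y)\}$$ be the associated étale groupoid, with product $(x,n,y)(y,n',y')=(x,n+n',y')$, inverse $(x,n,y)^{-1}=(y,-n,x)$, range $r(x,n,y)=x$, source $s(x,n,y)=y$, and the topology generated by the sets $\{(x,k-l,y) : x\in A,\ y\in B,\ \sigma^k(x)=\sigma^l(y)\}$ with $A,B\subset X$ open and $k,l\in\mathbb N$. Let $Y\subset X$ be a non-empty clopen set and let $G|Y=r^{-1}(Y)\cap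 s^{-1}(Y)$ be the reduction of $G$ to $Y$. A $G|Y$-set is a subset of $G|Y$ on which $r$ and $s$ are injective; for such a compact open set $U$ with $r(U)=s(U)=Y$ put $\pi_U=r\circ(s|_U)^{-1}$, a homeomorphism of $Y$. Let $[[G|Y]]$ be the group of all homeomorphisms of $Y$ of the form $\pi_U$, let $H_1(G|Y)=\operatorname{Ker}\delta_1/\operatorname{Im}\delta_2$ be the first homology group of the étale groupoid $G|Y$ with integer coefficients, where $$\delta_1=s_*-r_*: C_c(G|Y,\mathbb Z)\to C(Y,\mathbb Z),\qquad \delta_2=d_{0*}-d_{1*}+d_{2*}: C_c((G|Y)^{(2)},\mathbb Z)\to C_c(G|Y,\mathbb Z),$$ $(G|Y)^{(2)}$ is the space of composable pairs, $d_0(g,h)=h$, $d_1(g,h)=gh$, $d_2(g,h)=g$, and $(\pi_*f)(w)=\sum_{\pi(z)=w}f(z)$. Let $I:[[G|Y]]\to H_1(G|Y)$, $I(\pi_U)=[1_U]$, be the index map and let $[[G|Y]]_0=\operatorname{Ker} I$. An element $\alpha\in[[G|Y]]$ is called a transposition if there is a clopen set $A\subset Y$ such that $A\cap\alpha(A)=\emptyset$,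 $\operatorname{supp}(\alpha)=A\cup\alpha(A)$ and $\alpha^2=1$, where $\operatorname{supp}(\alpha)$ is the closure of $\{y\in Y : \alpha(y)\neq y\}$. **Theorem.** The group $[[G|Y]]_0$ is generated by finitely many transpositions; that is, there is a finite set of transpositions in $[[G|Y]]$ such that the subgroup generated by it is equal to $[[G|Y]]_0$. -/

import Mathlib

open Set Topology TopologicalSpace
open scoped CompactlySupported

/-! ### Pushforward of compactly supported integer valued functions -/

theorem isLocalHomeomorph_of_injOn {Z W : Type*} [TopologicalSpace Z] [TopologicalSpace W]
    {f : Z → W} (hc : Continuous f) (ho : IsOpenMap f)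
    (hi : ∀ x, ∃ U, IsOpen U ∧ x ∈ U ∧ InjOn f U) : IsLocalHomeomorph f := by
  rw [isLocalHomeomorph_iff_isOpenEmbedding_restrict]
  intro x
  obtain ⟨U, hU, hx, hinj⟩ := hi x
  refine ⟨U, hU.mem_nhds hx, .of_continuous_injective_isOpenMap
    (hc.comp continuous_subtype_val) (injOn_iff_injective.1 hinj) ?_⟩
  exact ho.comp hU.isOpenMap_subtype_val

section Pushforward

/-- The value of `π_* f` at `w`: the sum of `f` over the fibre `π ⁻¹ {w}`. -/
noncomputable def pushforwardFun {Z W : Type*} (π : Z → W) (f : Z → ℤ) (w : W) : ℤ :=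
  ∑ᶠ z ∈ π ⁻¹' {w}, f z

theorem pushforwardFun_eq_sum {Z W : Type*} {π : Z → W} {f : Z → ℤ} {w : W} (t : Finset Z)
    (ht : ∀ z ∈ t, π z = w) (hf : ∀ z, π z = w → f z ≠ 0 → z ∈ t) :
    pushforwardFun π f w = ∑ z ∈ t, f z := by
  unfold pushforwardFun
  apply finsum_mem_eq_sum_of_inter_support_eq
  ext z
  simp only [mem_inter_iff, mem_preimage, mem_singleton_iff, Function.mem_support,
    Finset.mem_coe]
  exact ⟨fun h => ⟨hf z h.1 h.2, h.2⟩, fun h => ⟨ht z h.1, h.2⟩⟩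

variable {Z W : Type*} [TopologicalSpace Z] [TopologicalSpace W]

theorem finite_fibre {π : Z → W} (hπ : IsLocalHomeomorph π) (f : C_c(Z, ℤ)) (w : W) :
    {z | π z = w ∧ f z ≠ 0}.Finite := by
  have hK := f.hasCompactSupport.isCompact
  choose U hUo hxU hinj using hπ.isLocallyInjective
  obtain ⟨t, -, ht⟩ := hK.elim_nhds_subcover U (fun x _ => (hUo x).mem_nhds (hxU x))
  have hsub : {z | π z = w ∧ f z ≠ 0} ⊆ ⋃ x ∈ t, {z | z ∈ U x ∧ π z = w} := by
    rintro z ⟨hz, hfz⟩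
    have := ht (subset_tsupport f hfz)
    simp only [mem_iUnion] at this ⊢
    obtain ⟨x, hx, hzx⟩ := this
    exact ⟨x, hx, hzx, hz⟩
  refine (t.finite_toSet.biUnion fun x _ => ?_).subset hsub
  exact Set.Subsingleton.finite fun a ha b hb => hinj x ha.1 hb.1 (ha.2.trans hb.2.symm)

theorem support_pushforwardFun_subset {Z W : Type*} [TopologicalSpace Z] (π : Z → W)
    (f : C_c(Z, ℤ)) :
    Function.support (pushforwardFun π f) ⊆ π '' tsupport f := by
  intro w hw
  by_contra h
  refine hw ?_
  rw [pushforwardFun_eq_sum (∅ : Finset Z) (by simp), Finset.sum_empty]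
  intro z hz hfz
  exact absurd ⟨z, subset_tsupport f hfz, hz⟩ h

theorem continuous_pushforwardFun [T2Space Z] [T2Space W] {π : Z → W}
    (hπ : IsLocalHomeomorph π) (f : C_c(Z, ℤ)) : Continuous (pushforwardFun π f) := by
  classical
  have hK := f.hasCompactSupport.isCompact
  refine IsLocallyConstant.continuous ((IsLocallyConstant.iff_eventually_eq _).2 fun w => ?_)
  have hfin := finite_fibre hπ f w
  set t : Finset Z := hfin.toFinset with ht
  have hmem : ∀ z, z ∈ t ↔ π z = w ∧ f z ≠ 0 := fun z => by simp [ht]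
  obtain ⟨V, hV, hdisj⟩ := t.finite_toSet.t2_separation
  have hloc : ∀ z : Z, ∃ U, IsOpen U ∧ z ∈ U ∧ InjOn π U ∧ U ⊆ V z ∧ ∀ y ∈ U, f y = f z := by
    intro z
    obtain ⟨U, hUo, hzU, hinj⟩ := hπ.isLocallyInjective z
    have hcst : IsOpen {y | f y = f z} :=
      (isOpen_discrete {f z}).preimage f.continuous
    exact ⟨U ∩ V z ∩ {y | f y = f z}, (hUo.inter (hV z).2).inter hcst,
      ⟨⟨hzU, (hV z).1⟩, rfl⟩, hinj.mono fun y hy => hy.1.1, fun y hy => hy.1.2, fun y hy => hy.2⟩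
  choose U hUo hzU hinj hUV hUf using hloc
  have hC : IsCompact (tsupport f \ ⋃ z ∈ t, U z) :=
    hK.diff (isOpen_biUnion fun z _ => hUo z)
  -- outside of the `U z` the function `f` has no support over `w`
  have hC' : IsCompact ((tsupport f \ ⋃ z ∈ t, U z) ∩ Function.support f) := by
    refine hC.inter_right ?_
    have : Function.support f = f ⁻¹' {0}ᶜ := rfl
    rw [this]
    exact (isClosed_discrete _).preimage f.continuous
  have hw : w ∉ π '' ((tsupport f \ ⋃ z ∈ t, U z) ∩ Function.support f) := by
    rintro ⟨z, ⟨⟨-, hz⟩, hfz⟩, hzw⟩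
    exact hz (mem_biUnion (show z ∈ (t : Set Z) from (hmem z).2 ⟨hzw, hfz⟩) (hzU z))
  have h1 : ∀ᶠ w' in 𝓝 w, w' ∉ π '' ((tsupport f \ ⋃ z ∈ t, U z) ∩ Function.support f) :=
    (hC'.image hπ.continuous).isClosed.isOpen_compl.mem_nhds hw
  have h2 : ∀ᶠ w' in 𝓝 w, ∀ z ∈ t, w' ∈ π '' U z := by
    rw [Filter.eventually_all_finset]
    intro z hz
    exact (hπ.isOpenMap _ (hUo z)).mem_nhds ⟨z, hzU z, ((hmem z).1 hz).1⟩
  filter_upwards [h1, h2] with w' hw1 hw2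
  choose g hgU hgw using hw2
  rw [pushforwardFun_eq_sum (w := w) t (fun z hz => ((hmem z).1 hz).1)
    (fun z hz hfz => (hmem z).2 ⟨hz, hfz⟩)]
  rw [pushforwardFun_eq_sum (w := w') (t.attach.image fun z => g z.1 z.2)]
  · rw [Finset.sum_image]
    · rw [← Finset.sum_attach t]
      exact Finset.sum_congr rfl fun z _ => hUf z.1 _ (hgU z.1 z.2)
    · intro a _ b _ hab
      by_contra hne
      have hne' : a.1 ≠ b.1 := fun h => hne (Subtype.ext h)
      refine (disjoint_left.1 (hdisj (Finset.mem_coe.2 a.2) (Finset.mem_coe.2 b.2) hne'))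
        (hUV _ (hgU a.1 a.2)) ?_
      have hab' : g a.1 a.2 = g b.1 b.2 := hab
      rw [hab']
      exact hUV _ (hgU b.1 b.2)
  · intro z hz
    obtain ⟨a, -, rfl⟩ := Finset.mem_image.1 hz
    exact hgw _ _
  · intro z hz hfz
    by_cases hzU' : z ∈ ⋃ z ∈ t, U z
    · simp only [mem_iUnion] at hzU'
      obtain ⟨a, ha, hza⟩ := hzU'
      have : g a ha = z := hinj a (hgU a ha) hza ((hgw a ha).trans hz.symm)
      exact Finset.mem_image.2 ⟨⟨a, ha⟩, Finset.mem_attach _ _, this⟩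
    · exact absurd ⟨z, ⟨⟨subset_tsupport f hfz, hzU'⟩, hfz⟩, hz⟩ hw1

/-- The homomorphism `π_* : C_c(Z, ℤ) → C_c(W, ℤ)` induced by a local homeomorphism `π`,
`(π_* f)(w) = ∑_{π z = w} f z`. -/
noncomputable def pushforward [T2Space Z] [T2Space W] (π : Z → W) (hπ : IsLocalHomeomorph π) :
    C_c(Z, ℤ) →+ C_c(W, ℤ) where
  toFun f :=
    { toFun := pushforwardFun π f
      continuous_toFun := continuous_pushforwardFun hπ f
      hasCompactSupport' :=
        HasCompactSupport.intro' (f.hasCompactSupport.isCompact.image hπ.continuous)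
          (f.hasCompactSupport.isCompact.image hπ.continuous).isClosed fun w hw =>
            Function.notMem_support.1 fun h => hw (support_pushforwardFun_subset π f h) }
  map_zero' := by
    ext w
    simp [pushforwardFun]
  map_add' f g := by
    ext w
    simp only [CompactlySupportedContinuousMap.coe_mk, ContinuousMap.coe_mk,
      CompactlySupportedContinuousMap.coe_add, Pi.add_apply]
    exact finsum_mem_add_distrib' (finite_fibre hπ f w) (finite_fibre hπ g w)

/-- The characteristic function `1_U` of a compact open set. -/
noncomputable def charFun [T2Space Z] (U : Set Z) (hc : IsCompact U) (ho : IsOpen U) :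
    C_c(Z, ℤ) where
  toFun := U.indicator 1
  continuous_toFun := by
    have h : IsClopen U := ⟨hc.isClosed, ho⟩
    exact continuous_one.indicator (by simp [h.frontier_eq])
  hasCompactSupport' := HasCompactSupport.intro hc fun x hx => indicator_of_notMem hx _

theorem pushforward_charFun [T2Space Z] [T2Space W] (π : Z → W) (hπ : IsLocalHomeomorph π)
    (U : Set Z) (hc : IsCompact U) (ho : IsOpen U) (hinj : InjOn π U)
    (U' : Set W) (hc' : IsCompact U') (ho' : IsOpen U') (hU' : π '' U = U') :
    pushforward π hπ (charFun U hc ho) = charFun U' hc' ho' := by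
  subst hU'
  ext w
  change pushforwardFun π (U.indicator 1) w = (π '' U).indicator 1 w
  by_cases hw : w ∈ π '' U
  · obtain ⟨z, hz, rfl⟩ := hw
    rw [pushforwardFun_eq_sum {z} (by simp)]
    · simp [hz, mem_image_of_mem π hz]
    · intro y hy hfy
      have hyU : y ∈ U := by
        by_contra h
        exact hfy (indicator_of_notMem h _)
      simpa using hinj hyU hz hy
  · rw [pushforwardFun_eq_sum ∅ (by simp)]
    · simp [hw]
    · intro y hy hfy
      have hyU : y ∈ U := by
        by_contra h
        exact hfy (indicator_of_notMem h _)
      exact absurd ⟨y, hyU, hy⟩ hw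

end Pushforward

/-! ### Étale groupoids -/

/-- An étale groupoid with unit space `X` and space of arrows `G`: a second countable locally
compact Hausdorff topological groupoid whose range map is a local homeomorphism.
The product `mul g h _` is defined when `s g = r h`; the unit space is identified with `X` via
`unit`, which is a homeomorphism onto its image, with inverse `r`. -/
structure EtaleGroupoid (X G : Type*) [TopologicalSpace X] [TopologicalSpace G] where
  r : G → X
  s : G → X
  unit : X → G
  inv : G → G
  mul : (g h : G) → s g = r h → G
  r_unit : ∀ x, r (unit x) = x
  s_unit : ∀ x, s (unit x) = x
  r_inv : ∀ g, r (inv g) = s g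
  s_inv : ∀ g, s (inv g) = r g
  r_mul : ∀ g h e, r (mul g h e) = r g
  s_mul : ∀ g h e, s (mul g h e) = s h
  mul_assoc : ∀ g h k (e₁ : s g = r h) (e₂ : s h = r k),
    mul (mul g h e₁) k ((s_mul g h e₁).trans e₂) = mul g (mul h k e₂) (e₁.trans (r_mul h k e₂).symm)
  unit_mul : ∀ g, mul (unit (r g)) g (s_unit _) = g
  mul_unit : ∀ g, mul g (unit (s g)) (r_unit _).symm = g
  mul_inv : ∀ g, mul g (inv g) (r_inv g).symm = unit (r g)
  inv_mul : ∀ g, mul (inv g) g (s_inv g) = unit (s g)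
  inv_inv : ∀ g, inv (inv g) = g
  t2Space : T2Space G
  locallyCompactSpace : LocallyCompactSpace G
  secondCountable : SecondCountableTopology G
  continuous_unit : Continuous unit
  continuous_inv : Continuous inv
  continuous_mul : Continuous fun p : {p : G × G // s p.1 = r p.2} => mul p.1.1 p.1.2 p.2
  isLocalHomeomorph_r : IsLocalHomeomorph r

namespace EtaleGroupoid

variable {X G : Type*} [TopologicalSpace X] [TopologicalSpace G] (𝒢 : EtaleGroupoid X G)

theorem isLocalHomeomorph_s : IsLocalHomeomorph 𝒢.s := by
  let e : G ≃ₜ G :=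
    { toFun := 𝒢.inv, invFun := 𝒢.inv, left_inv := 𝒢.inv_inv, right_inv := 𝒢.inv_inv,
      continuous_toFun := 𝒢.continuous_inv, continuous_invFun := 𝒢.continuous_inv }
  have h : 𝒢.s = 𝒢.r ∘ e := funext fun g => (𝒢.r_inv g).symm
  rw [h]
  exact 𝒢.isLocalHomeomorph_r.comp e.isLocalHomeomorph

theorem t2Space_units {X G : Type*} [TopologicalSpace X] [TopologicalSpace G]
    (𝒢 : EtaleGroupoid X G) : T2Space X := by
  have := 𝒢.t2Space
  exact T2Space.of_injective_continuous
    (Function.LeftInverse.injective 𝒢.r_unit) 𝒢.continuous_unit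

/-- The space of composable pairs. -/
abbrev Composable : Type _ := {p : G × G // 𝒢.s p.1 = 𝒢.r p.2}

/-- The face map `d₀ (g, h) = h`. -/
def d₀ (p : 𝒢.Composable) : G := p.1.2

/-- The face map `d₁ (g, h) = g h`. -/
def d₁ (p : 𝒢.Composable) : G := 𝒢.mul p.1.1 p.1.2 p.2

/-- The face map `d₂ (g, h) = g`. -/
def d₂ (p : 𝒢.Composable) : G := p.1.1

theorem isLocalHomeomorph_d₂ : IsLocalHomeomorph 𝒢.d₂ := by
  have hs := 𝒢.isLocalHomeomorph_s.continuous
  refine isLocalHomeomorph_of_injOn (continuous_fst.comp continuous_subtype_val) ?_ ?_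
  · rw [isOpenMap_iff_nhds_le]
    rintro ⟨⟨g, h⟩, e⟩ S hS
    rw [Filter.mem_map, nhds_subtype_eq_comap, Filter.mem_comap] at hS
    obtain ⟨T, hT, hTS⟩ := hS
    obtain ⟨A, hA, B, hB, hAB⟩ := mem_nhds_prod_iff.1 hT
    have hrB : 𝒢.r '' B ∈ 𝓝 (𝒢.s g) := by
      have e' : 𝒢.s g = 𝒢.r h := e
      rw [e']
      exact 𝒢.isLocalHomeomorph_r.isOpenMap.image_mem_nhds hB
    filter_upwards [hA, hs.continuousAt hrB] with g' hg' hg''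
    obtain ⟨h', hh', e'⟩ := hg''
    exact hTS (a := (⟨(g', h'), e'.symm⟩ : 𝒢.Composable)) (hAB ⟨hg', hh'⟩)
  · rintro ⟨⟨g, h⟩, e⟩
    obtain ⟨U, hU, hhU, hinj⟩ := 𝒢.isLocalHomeomorph_r.isLocallyInjective h
    refine ⟨{p | p.1.2 ∈ U}, hU.preimage (continuous_snd.comp continuous_subtype_val), hhU, ?_⟩
    rintro ⟨⟨g₁, h₁⟩, e₁⟩ hp₁ ⟨⟨g₂, h₂⟩, e₂⟩ hp₂ (rfl : g₁ = g₂)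
    have := hinj hp₁ hp₂ (e₁.symm.trans e₂)
    dsimp only at this
    subst this
    rfl

theorem isLocalHomeomorph_d₁ : IsLocalHomeomorph 𝒢.d₁ := by
  have h : 𝒢.r ∘ 𝒢.d₁ = 𝒢.r ∘ 𝒢.d₂ := funext fun p => 𝒢.r_mul _ _ _
  refine IsLocalHomeomorph.of_comp (g := 𝒢.r) ?_ 𝒢.isLocalHomeomorph_r 𝒢.continuous_mul
  rw [h]
  exact 𝒢.isLocalHomeomorph_r.comp 𝒢.isLocalHomeomorph_d₂

theorem isLocalHomeomorph_d₀ : IsLocalHomeomorph 𝒢.d₀ := by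
  have h : 𝒢.s ∘ 𝒢.d₀ = 𝒢.s ∘ 𝒢.d₁ := funext fun p => (𝒢.s_mul _ _ _).symm
  refine IsLocalHomeomorph.of_comp (g := 𝒢.s) ?_ 𝒢.isLocalHomeomorph_s
    (continuous_snd.comp continuous_subtype_val)
  rw [h]
  exact 𝒢.isLocalHomeomorph_s.comp 𝒢.isLocalHomeomorph_d₁

/-! ### The first homology group -/

/-- `δ₁ = s_* - r_* : C_c(G, ℤ) → C_c(X, ℤ)`. -/
noncomputable def δ₁ : C_c(G, ℤ) →+ C_c(X, ℤ) :=
  haveI := 𝒢.t2Space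
  haveI := 𝒢.t2Space_units
  pushforward 𝒢.s 𝒢.isLocalHomeomorph_s - pushforward 𝒢.r 𝒢.isLocalHomeomorph_r

/-- `δ₂ = d₀_* - d₁_* + d₂_* : C_c(G⁽²⁾, ℤ) → C_c(G, ℤ)`. -/
noncomputable def δ₂ : C_c(𝒢.Composable, ℤ) →+ C_c(G, ℤ) :=
  haveI := 𝒢.t2Space
  pushforward 𝒢.d₀ 𝒢.isLocalHomeomorph_d₀ - pushforward 𝒢.d₁ 𝒢.isLocalHomeomorph_d₁
    + pushforward 𝒢.d₂ 𝒢.isLocalHomeomorph_d₂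

/-- The homology group `H₁(G) = Ker δ₁ / Im δ₂`. -/
abbrev H₁ : Type _ := 𝒢.δ₁.ker ⧸ 𝒢.δ₂.range.addSubgroupOf 𝒢.δ₁.ker

/-! ### Full compact open bisections and the topological full group -/

/-- A `G`-set: a set of arrows on which both the range and the source map are injective. -/
def IsGSet (U : Set G) : Prop := InjOn 𝒢.r U ∧ InjOn 𝒢.s U

/-- A compact open `G`-set `U` with `r(U) = s(U) = X`. -/
structure IsFullBisection (U : Set G) : Prop where
  isCompact : IsCompact U
  isOpen : IsOpen U
  isGSet : 𝒢.IsGSet U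
  image_r : 𝒢.r '' U = univ
  image_s : 𝒢.s '' U = univ

/-- `U` is a compact open `G`-set with `α = π_U = r ∘ (s|U)⁻¹`. -/
def Represents (U : Set G) (α : X ≃ₜ X) : Prop :=
  𝒢.IsFullBisection U ∧ ∀ g ∈ U, α (𝒢.s g) = 𝒢.r g

/-- The pairs in `U × V` that are composable. -/
def pairs (U V : Set G) : Set 𝒢.Composable := {p | p.1.1 ∈ U ∧ p.1.2 ∈ V}

/-- The product `UV = {g h | g ∈ U, h ∈ V, s g = r h}`. -/
def setMul (U V : Set G) : Set G := 𝒢.d₁ '' 𝒢.pairs U V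

variable {𝒢}

theorem isOpen_pairs {U V : Set G} (hU : IsOpen U) (hV : IsOpen V) : IsOpen (𝒢.pairs U V) :=
  (hU.prod hV).preimage continuous_subtype_val

theorem isCompact_pairs {U V : Set G} (hU : IsCompact U) (hV : IsCompact V) :
    IsCompact (𝒢.pairs U V) := by
  have := 𝒢.t2Space_units
  have hcl : IsClosed {p : G × G | 𝒢.s p.1 = 𝒢.r p.2} :=
    isClosed_eq (𝒢.isLocalHomeomorph_s.continuous.comp continuous_fst)
      (𝒢.isLocalHomeomorph_r.continuous.comp continuous_snd)
  exact hcl.isClosedEmbedding_subtypeVal.isCompact_preimage (hU.prod hV)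

theorem injOn_d₀ {U V : Set G} (hU : InjOn 𝒢.s U) : InjOn 𝒢.d₀ (𝒢.pairs U V) := by
  rintro ⟨⟨g, h⟩, e⟩ ⟨hg, -⟩ ⟨⟨g', h'⟩, e'⟩ ⟨hg', -⟩ (rfl : h = h')
  have : g = g' := hU hg hg' (e.trans e'.symm)
  subst this
  rfl

theorem injOn_d₂ {U V : Set G} (hV : InjOn 𝒢.r V) : InjOn 𝒢.d₂ (𝒢.pairs U V) := by
  rintro ⟨⟨g, h⟩, e⟩ ⟨-, hh⟩ ⟨⟨g', h'⟩, e'⟩ ⟨-, hh'⟩ (rfl : g = g')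
  have : h = h' := hV hh hh' (e.symm.trans e')
  subst this
  rfl

theorem injOn_r_d₁ {U V : Set G} (hU : InjOn 𝒢.r U) (hV : InjOn 𝒢.r V) :
    InjOn (𝒢.r ∘ 𝒢.d₁) (𝒢.pairs U V) := by
  rintro p hp q hq h
  have h' : 𝒢.r p.1.1 = 𝒢.r q.1.1 := by
    simpa only [Function.comp, d₁, 𝒢.r_mul] using h
  exact injOn_d₂ hV hp hq (hU hp.1 hq.1 h')

theorem injOn_s_d₁ {U V : Set G} (hU : InjOn 𝒢.s U) (hV : InjOn 𝒢.s V) :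
    InjOn (𝒢.s ∘ 𝒢.d₁) (𝒢.pairs U V) := by
  rintro p hp q hq h
  have h' : 𝒢.s p.1.2 = 𝒢.s q.1.2 := by
    simpa only [Function.comp, d₁, 𝒢.s_mul] using h
  exact injOn_d₀ hU hp hq (hV hp.2 hq.2 h')

theorem image_d₀ {U V : Set G} (hU : 𝒢.s '' U = univ) : 𝒢.d₀ '' 𝒢.pairs U V = V := by
  ext h
  constructor
  · rintro ⟨p, hp, rfl⟩
    exact hp.2
  · intro hh
    obtain ⟨g, hg, e⟩ := hU.symm ▸ mem_univ (𝒢.r h)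
    exact ⟨⟨(g, h), e⟩, ⟨hg, hh⟩, rfl⟩

theorem image_d₂ {U V : Set G} (hV : 𝒢.r '' V = univ) : 𝒢.d₂ '' 𝒢.pairs U V = U := by
  ext g
  constructor
  · rintro ⟨p, hp, rfl⟩
    exact hp.1
  · intro hg
    obtain ⟨h, hh, e⟩ := hV.symm ▸ mem_univ (𝒢.s g)
    exact ⟨⟨(g, h), e.symm⟩, ⟨hg, hh⟩, rfl⟩

namespace IsFullBisection

theorem mul {U V : Set G} (hU : 𝒢.IsFullBisection U) (hV : 𝒢.IsFullBisection V) :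
    𝒢.IsFullBisection (𝒢.setMul U V) where
  isCompact := (isCompact_pairs hU.isCompact hV.isCompact).image 𝒢.isLocalHomeomorph_d₁.continuous
  isOpen := 𝒢.isLocalHomeomorph_d₁.isOpenMap _ (isOpen_pairs hU.isOpen hV.isOpen)
  isGSet := ⟨(injOn_r_d₁ hU.isGSet.1 hV.isGSet.1).image_of_comp,
    (injOn_s_d₁ hU.isGSet.2 hV.isGSet.2).image_of_comp⟩
  image_r := by
    have h : 𝒢.r ∘ 𝒢.d₁ = 𝒢.r ∘ 𝒢.d₂ := funext fun p => 𝒢.r_mul _ _ _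
    rw [setMul, ← image_comp, h, image_comp, image_d₂ hV.image_r, hU.image_r]
  image_s := by
    have h : 𝒢.s ∘ 𝒢.d₁ = 𝒢.s ∘ 𝒢.d₀ := funext fun p => 𝒢.s_mul _ _ _
    rw [setMul, ← image_comp, h, image_comp, image_d₀ hU.image_s, hV.image_s]

theorem inv {U : Set G} (hU : 𝒢.IsFullBisection U) : 𝒢.IsFullBisection (𝒢.inv ⁻¹' U) := by
  have himg : 𝒢.inv ⁻¹' U = 𝒢.inv '' U := by
    ext g
    exact ⟨fun h => ⟨_, h, 𝒢.inv_inv g⟩, by rintro ⟨k, hk, rfl⟩; simpa [𝒢.inv_inv] using hk⟩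
  have hr : 𝒢.r ∘ 𝒢.inv = 𝒢.s := funext 𝒢.r_inv
  have hs : 𝒢.s ∘ 𝒢.inv = 𝒢.r := funext 𝒢.s_inv
  refine ⟨?_, hU.isOpen.preimage 𝒢.continuous_inv, ⟨?_, ?_⟩, ?_, ?_⟩
  · rw [himg]
    exact hU.isCompact.image 𝒢.continuous_inv
  · rw [himg]
    exact InjOn.image_of_comp (by rw [hr]; exact hU.isGSet.2)
  · rw [himg]
    exact InjOn.image_of_comp (by rw [hs]; exact hU.isGSet.1)
  · rw [himg, ← image_comp, hr, hU.image_s]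
  · rw [himg, ← image_comp, hs, hU.image_r]

theorem one [CompactSpace X] : 𝒢.IsFullBisection (range 𝒢.unit) where
  isCompact := isCompact_range 𝒢.continuous_unit
  isOpen := by
    rw [isOpen_iff_mem_nhds]
    rintro _ ⟨x, rfl⟩
    obtain ⟨W, hW, hxW, hinj⟩ := 𝒢.isLocalHomeomorph_r.isLocallyInjective (𝒢.unit x)
    have h1 : ∀ᶠ g in 𝓝 (𝒢.unit x), 𝒢.unit (𝒢.r g) ∈ W :=
      (𝒢.continuous_unit.comp 𝒢.isLocalHomeomorph_r.continuous).continuousAt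
        (hW.mem_nhds (by simpa [𝒢.r_unit] using hxW))
    filter_upwards [h1, hW.mem_nhds hxW] with g hg hgW
    exact ⟨𝒢.r g, hinj hg hgW (𝒢.r_unit _)⟩
  isGSet := by
    constructor
    · rintro _ ⟨x, rfl⟩ _ ⟨y, rfl⟩ h
      rw [𝒢.r_unit, 𝒢.r_unit] at h
      rw [h]
    · rintro _ ⟨x, rfl⟩ _ ⟨y, rfl⟩ h
      rw [𝒢.s_unit, 𝒢.s_unit] at h
      rw [h]
  image_r := eq_univ_of_forall fun x => ⟨_, ⟨x, rfl⟩, 𝒢.r_unit x⟩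
  image_s := eq_univ_of_forall fun x => ⟨_, ⟨x, rfl⟩, 𝒢.s_unit x⟩

/-- The characteristic function `1_U ∈ C_c(G, ℤ)`. -/
noncomputable def char {U : Set G} (hU : 𝒢.IsFullBisection U) : C_c(G, ℤ) :=
  haveI := 𝒢.t2Space
  charFun U hU.isCompact hU.isOpen

theorem char_mem_ker {U : Set G} (hU : 𝒢.IsFullBisection U) : hU.char ∈ 𝒢.δ₁.ker := by
  have := 𝒢.t2Space
  have := 𝒢.t2Space_units
  have hX : IsCompact (univ : Set X) :=
    hU.image_r ▸ hU.isCompact.image 𝒢.isLocalHomeomorph_r.continuous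
  rw [AddMonoidHom.mem_ker, δ₁, AddMonoidHom.sub_apply, char,
    pushforward_charFun _ _ U _ _ hU.isGSet.2 univ hX isOpen_univ hU.image_s,
    pushforward_charFun _ _ U _ _ hU.isGSet.1 univ hX isOpen_univ hU.image_r, sub_self]

/-- The class of `1_U` in `H₁(G)`. -/
noncomputable def homologyClass {U : Set G} (hU : 𝒢.IsFullBisection U) : 𝒢.H₁ :=
  QuotientAddGroup.mk ⟨hU.char, hU.char_mem_ker⟩

theorem homologyClass_mul {U V : Set G} (hU : 𝒢.IsFullBisection U) (hV : 𝒢.IsFullBisection V) :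
    (hU.mul hV).homologyClass = hU.homologyClass + hV.homologyClass := by
  have := 𝒢.t2Space
  unfold homologyClass
  rw [← QuotientAddGroup.mk_add, QuotientAddGroup.eq, AddSubgroup.mem_addSubgroupOf]
  refine ⟨charFun (𝒢.pairs U V) (isCompact_pairs hU.isCompact hV.isCompact)
    (isOpen_pairs hU.isOpen hV.isOpen), ?_⟩
  rw [δ₂, AddMonoidHom.add_apply, AddMonoidHom.sub_apply,
    pushforward_charFun _ _ _ _ _ (injOn_d₀ hU.isGSet.2) V hV.isCompact hV.isOpen
      (image_d₀ hU.image_s),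
    pushforward_charFun _ _ _ _ _ (injOn_d₂ hV.isGSet.1) U hU.isCompact hU.isOpen
      (image_d₂ hV.image_r),
    pushforward_charFun _ _ _ _ _ (injOn_r_d₁ hU.isGSet.1 hV.isGSet.1).of_comp _
      (hU.mul hV).isCompact (hU.mul hV).isOpen rfl]
  change hV.char - (hU.mul hV).char + hU.char = -(hU.mul hV).char + (hU.char + hV.char)
  abel

theorem homologyClass_congr {U V : Set G} (hU : 𝒢.IsFullBisection U) (hV : 𝒢.IsFullBisection V)
    (h : U = V) : hU.homologyClass = hV.homologyClass := by
  subst h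
  rfl

theorem homologyClass_one [CompactSpace X] : (one : 𝒢.IsFullBisection _).homologyClass = 0 := by
  have h : 𝒢.setMul (range 𝒢.unit) (range 𝒢.unit) = range 𝒢.unit := by
    ext g
    constructor
    · rintro ⟨⟨⟨_, _⟩, e⟩, ⟨⟨x, rfl⟩, ⟨y, rfl⟩⟩, rfl⟩
      have e' : x = y := by simpa [𝒢.s_unit, 𝒢.r_unit] using e
      subst e'
      refine ⟨x, ?_⟩
      have := 𝒢.unit_mul (𝒢.unit x)
      simp only [𝒢.r_unit] at this
      exact this.symm
    · rintro ⟨x, rfl⟩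
      refine ⟨⟨(𝒢.unit x, 𝒢.unit x), by simp [𝒢.s_unit, 𝒢.r_unit]⟩, ⟨⟨x, rfl⟩, ⟨x, rfl⟩⟩, ?_⟩
      have := 𝒢.unit_mul (𝒢.unit x)
      simp only [𝒢.r_unit] at this
      exact this
  have h2 := homologyClass_mul (one : 𝒢.IsFullBisection _) one
  rw [homologyClass_congr _ one h] at h2
  exact left_eq_add.1 h2

theorem setMul_inv {U : Set G} (hU : 𝒢.IsFullBisection U) :
    𝒢.setMul U (𝒢.inv ⁻¹' U) = range 𝒢.unit := by
  have key : ∀ g k (e : 𝒢.s g = 𝒢.r k), k = 𝒢.inv g → 𝒢.mul g k e = 𝒢.unit (𝒢.r g) := by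
    rintro g _ e rfl
    exact 𝒢.mul_inv g
  ext k
  constructor
  · rintro ⟨⟨⟨g, h⟩, e⟩, ⟨hg, hh⟩, rfl⟩
    have hgh : g = 𝒢.inv h := hU.isGSet.2 hg hh (e.trans (𝒢.s_inv h).symm)
    exact ⟨𝒢.r g, (key g h e (by rw [hgh, 𝒢.inv_inv])).symm⟩
  · rintro ⟨x, rfl⟩
    obtain ⟨g, hg, rfl⟩ := hU.image_r.symm ▸ mem_univ x
    exact ⟨⟨(g, 𝒢.inv g), (𝒢.r_inv g).symm⟩, ⟨hg, by simpa [𝒢.inv_inv] using hg⟩, 𝒢.mul_inv g⟩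

theorem homologyClass_inv [CompactSpace X] {U : Set G} (hU : 𝒢.IsFullBisection U) :
    hU.inv.homologyClass = -hU.homologyClass := by
  have h := homologyClass_mul hU hU.inv
  rw [homologyClass_congr _ one hU.setMul_inv, homologyClass_one] at h
  exact (neg_eq_of_add_eq_zero_right h.symm).symm

end IsFullBisection

namespace Represents

theorem mul {U V : Set G} {α β : X ≃ₜ X} (hU : 𝒢.Represents U α) (hV : 𝒢.Represents V β) :
    𝒢.Represents (𝒢.setMul U V) (α * β) := by
  refine ⟨hU.1.mul hV.1, ?_⟩
  rintro _ ⟨⟨⟨g, h⟩, e⟩, ⟨hg, hh⟩, rfl⟩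
  change α (β (𝒢.s (𝒢.mul g h e))) = 𝒢.r (𝒢.mul g h e)
  rw [𝒢.s_mul, 𝒢.r_mul, hV.2 h hh, ← hU.2 g hg]
  exact congrArg α e.symm

theorem inv {U : Set G} {α : X ≃ₜ X} (hU : 𝒢.Represents U α) :
    𝒢.Represents (𝒢.inv ⁻¹' U) α⁻¹ := by
  refine ⟨hU.1.inv, fun g hg => ?_⟩
  have h := hU.2 _ hg
  rw [𝒢.s_inv, 𝒢.r_inv] at h
  change α.symm (𝒢.s g) = 𝒢.r g
  rw [← h, α.symm_apply_apply]

theorem one [CompactSpace X] : 𝒢.Represents (range 𝒢.unit) 1 := by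
  refine ⟨IsFullBisection.one, ?_⟩
  rintro _ ⟨x, rfl⟩
  rw [𝒢.s_unit, 𝒢.r_unit]
  rfl

end Represents

variable (𝒢) [CompactSpace X]

/-- The topological full group `[[G]]`: the homeomorphisms of the unit space that are of the form
`π_U` for a compact open `G`-set `U`. -/
def topologicalFullGroup : Subgroup (X ≃ₜ X) where
  carrier := {α | ∃ U, 𝒢.Represents U α}
  mul_mem' := fun ⟨_, hU⟩ ⟨_, hV⟩ => ⟨_, hU.mul hV⟩
  one_mem' := ⟨_, Represents.one⟩
  inv_mem' := fun ⟨_, hU⟩ => ⟨_, hU.inv⟩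

/-- The index `I(α) ∈ H₁(G)` equals `c`: there is a compact open `G`-set `U` with `α = π_U` and
`[1_U] = c`. When `G` is essentially principal, `U` is determined by `α`, so that this is the
graph of the index map `I : [[G]] → H₁(G)`. -/
def HasIndex (α : X ≃ₜ X) (c : 𝒢.H₁) : Prop :=
  ∃ (U : Set G) (hU : 𝒢.Represents U α), hU.1.homologyClass = c

/-- The kernel `[[G]]₀` of the index map. -/
def indexKernel : Subgroup 𝒢.topologicalFullGroup where
  carrier := {α | 𝒢.HasIndex α 0}
  mul_mem' := by
    rintro α β ⟨U, hU, hU0⟩ ⟨V, hV, hV0⟩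
    exact ⟨_, hU.mul hV, by
      rw [IsFullBisection.homologyClass_mul hU.1 hV.1, hU0, hV0, add_zero]⟩
  one_mem' := ⟨_, Represents.one, IsFullBisection.homologyClass_one⟩
  inv_mem' := by
    rintro α ⟨U, hU, hU0⟩
    exact ⟨_, hU.inv, by
      rw [IsFullBisection.homologyClass_inv hU.1, hU0, neg_zero]⟩

variable {𝒢}

/-- A transposition: an element `α` of `[[G]]` such that, for some clopen set `A`, one has
`A ∩ α(A) = ∅`, `supp α = A ∪ α(A)` and `α² = 1`. Here `supp α` is the closure of
`{x | α x ≠ x}`. -/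
def IsTransposition (α : 𝒢.topologicalFullGroup) : Prop :=
  ∃ A : Set X, IsClopen A ∧ A ∩ α.1 '' A = ∅ ∧ closure {x | α.1 x ≠ x} = A ∪ α.1 '' A ∧ α ^ 2 = 1

/-! ### Reductions -/

/-- The arrows of the reduction `G|Y = r⁻¹(Y) ∩ s⁻¹(Y)`. -/
abbrev ReductionArrow {X G : Type*} [TopologicalSpace X] [TopologicalSpace G]
    (𝒢 : EtaleGroupoid X G) (Y : Clopens X) : Type _ :=
  {g : G // 𝒢.r g ∈ Y ∧ 𝒢.s g ∈ Y}

/-- The reduction `G|Y` of an étale groupoid to a clopen subset `Y` of the unit space. -/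
def reduction {X G : Type*} [TopologicalSpace X] [TopologicalSpace G]
    (𝒢 : EtaleGroupoid X G) (Y : Clopens X) : EtaleGroupoid Y (𝒢.ReductionArrow Y) where
  r g := ⟨𝒢.r g, g.2.1⟩
  s g := ⟨𝒢.s g, g.2.2⟩
  unit y := ⟨𝒢.unit y, by simp [𝒢.r_unit], by simp [𝒢.s_unit]⟩
  inv g := ⟨𝒢.inv g, by simpa [𝒢.r_inv] using g.2.2, by simpa [𝒢.s_inv] using g.2.1⟩
  mul g h e := ⟨𝒢.mul g h (congrArg Subtype.val e), by simpa [𝒢.r_mul] using g.2.1,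
    by simpa [𝒢.s_mul] using h.2.2⟩
  r_unit y := Subtype.ext (𝒢.r_unit _)
  s_unit y := Subtype.ext (𝒢.s_unit _)
  r_inv g := Subtype.ext (𝒢.r_inv _)
  s_inv g := Subtype.ext (𝒢.s_inv _)
  r_mul g h e := Subtype.ext (𝒢.r_mul _ _ _)
  s_mul g h e := Subtype.ext (𝒢.s_mul _ _ _)
  mul_assoc g h k e₁ e₂ := Subtype.ext (𝒢.mul_assoc _ _ _ _ _)
  unit_mul g := Subtype.ext (𝒢.unit_mul _)
  mul_unit g := Subtype.ext (𝒢.mul_unit _)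
  mul_inv g := Subtype.ext (𝒢.mul_inv _)
  inv_mul g := Subtype.ext (𝒢.inv_mul _)
  inv_inv g := Subtype.ext (𝒢.inv_inv _)
  t2Space := by
    have := 𝒢.t2Space
    infer_instance
  locallyCompactSpace := by
    have := 𝒢.locallyCompactSpace
    exact IsOpen.locallyCompactSpace
      ((Y.isClopen.isOpen.preimage 𝒢.isLocalHomeomorph_r.continuous).inter
        (Y.isClopen.isOpen.preimage 𝒢.isLocalHomeomorph_s.continuous))
  secondCountable := by
    have := 𝒢.secondCountable
    exact Subtype.secondCountableTopology {g : G | 𝒢.r g ∈ Y ∧ 𝒢.s g ∈ Y}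
  continuous_unit := (𝒢.continuous_unit.comp continuous_subtype_val).subtype_mk _
  continuous_inv := (𝒢.continuous_inv.comp continuous_subtype_val).subtype_mk _
  continuous_mul := by
    refine Continuous.subtype_mk ?_ _
    refine 𝒢.continuous_mul.comp (g := fun p : 𝒢.Composable => 𝒢.mul p.1.1 p.1.2 p.2)
      (f := fun p : {p : 𝒢.ReductionArrow Y × 𝒢.ReductionArrow Y //
        (⟨𝒢.s p.1, p.1.2.2⟩ : Y) = ⟨𝒢.r p.2, p.2.2.1⟩} =>
          ⟨(p.1.1.1, p.1.2.1), congrArg Subtype.val p.2⟩) ?_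
    refine Continuous.subtype_mk ?_ _
    exact (continuous_subtype_val.comp (continuous_fst.comp continuous_subtype_val)).prodMk
      (continuous_subtype_val.comp (continuous_snd.comp continuous_subtype_val))
  isLocalHomeomorph_r := by
    have hG : IsOpen {g : G | 𝒢.r g ∈ Y ∧ 𝒢.s g ∈ Y} :=
      (Y.isClopen.isOpen.preimage 𝒢.isLocalHomeomorph_r.continuous).inter
        (Y.isClopen.isOpen.preimage 𝒢.isLocalHomeomorph_s.continuous)
    have hY : IsLocalHomeomorph (Subtype.val : Y → X) :=
      Y.isClopen.isOpen.isOpenEmbedding_subtypeVal.isLocalHomeomorph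
    refine IsLocalHomeomorph.of_comp (g := (Subtype.val : Y → X)) ?_ hY ?_
    · exact 𝒢.isLocalHomeomorph_r.comp hG.isOpenEmbedding_subtypeVal.isLocalHomeomorph
    · exact (𝒢.isLocalHomeomorph_r.continuous.comp continuous_subtype_val).subtype_mk _

end EtaleGroupoid

instance clopensCompactSpace {X : Type*} [TopologicalSpace X] [CompactSpace X] (Y : Clopens X) :
    CompactSpace Y :=
  isCompact_iff_compactSpace.1 Y.isClopen.isClosed.isCompact

/-! ### One-sided shifts of finite type -/

/-- A directed graph with vertex set `V` and edge set `E`: every edge `e` has an initial vertex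
`i e` and a terminal vertex `t e`. -/
structure EdgeGraph (V E : Type*) where
  i : E → V
  t : E → V

namespace EdgeGraph

variable {V E : Type*} (Γ : EdgeGraph V E)

/-- The adjacency matrix `M(ξ, η) = #{e | i(e) = ξ, t(e) = η}`. -/
noncomputable def adjMatrix : Matrix V V ℤ :=
  fun ξ η => Nat.card {e : E // Γ.i e = ξ ∧ Γ.t e = η}

/-- The space `X` of one-sided infinite paths. -/
def PathSpace : Type _ := {x : ℕ → E // ∀ k, Γ.t (x k) = Γ.i (x (k + 1))}

/-- The topology induced from the product topology on `ℕ → E`, with `E` discrete. -/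
instance : TopologicalSpace Γ.PathSpace :=
  TopologicalSpace.induced Subtype.val (@Pi.topologicalSpace ℕ (fun _ => E) fun _ => ⊥)

/-- The shift `σ(x)_k = x_{k+1}`. -/
def shift (x : Γ.PathSpace) : Γ.PathSpace := ⟨fun k => x.1 (k + 1), fun k => x.2 (k + 1)⟩

variable {Γ}

theorem shift_iterate_apply (n : ℕ) (x : Γ.PathSpace) (j : ℕ) :
    (Γ.shift^[n] x).1 j = x.1 (n + j) := by
  induction n generalizing x with
  | zero => simp
  | succ n ih =>
    rw [Function.iterate_succ_apply, ih]
    change x.1 (n + j + 1) = x.1 (n + 1 + j)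
    rw [show n + j + 1 = n + 1 + j by omega]

/-- The paths that agree with `x` in the first `n` coordinates. -/
def agree (x : Γ.PathSpace) (n : ℕ) : Set Γ.PathSpace := {y | ∀ j < n, y.1 j = x.1 j}

theorem self_mem_agree (x : Γ.PathSpace) (n : ℕ) : x ∈ agree x n := fun _ _ => rfl

theorem isOpen_agree (x : Γ.PathSpace) (n : ℕ) : IsOpen (agree x n) := by
  let _ : TopologicalSpace E := ⊥
  have : DiscreteTopology E := ⟨rfl⟩
  exact (PiNat.isOpen_cylinder (fun _ => E) x.1 n).preimage continuous_induced_dom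

theorem exists_agree_subset {x : Γ.PathSpace} {A : Set Γ.PathSpace} (hA : IsOpen A) (hx : x ∈ A) :
    ∃ n, agree x n ⊆ A := by
  let _ : TopologicalSpace E := ⊥
  have : DiscreteTopology E := ⟨rfl⟩
  obtain ⟨B, hB, rfl⟩ := isOpen_induced_iff.1 hA
  obtain ⟨_, ⟨y, n, rfl⟩, hxy, hsub⟩ :=
    (PiNat.isTopologicalBasis_cylinders fun _ : ℕ => E).exists_subset_of_mem_open hx hB
  refine ⟨n, fun z hz => hsub ?_⟩
  rw [PiNat.mem_cylinder_iff] at hxy ⊢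
  exact fun j hj => (hz j hj).trans (hxy j hj)

theorem continuous_shift : Continuous Γ.shift := by
  rw [continuous_iff_continuousAt]
  intro x S hS
  obtain ⟨A, hAS, hA, hxA⟩ := mem_nhds_iff.1 hS
  obtain ⟨n, hn⟩ := exists_agree_subset hA hxA
  rw [Filter.mem_map]
  refine Filter.mem_of_superset ((isOpen_agree x (n + 1)).mem_nhds (self_mem_agree _ _)) ?_
  exact fun y hy => hAS (hn fun j hj => hy (j + 1) (by omega))

theorem isOpenMap_shift : IsOpenMap Γ.shift := by
  rw [isOpenMap_iff_nhds_le]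
  intro x S hS
  obtain ⟨A, hAS, hA, hxA⟩ := mem_nhds_iff.1 hS
  obtain ⟨n, hn⟩ := exists_agree_subset hA hxA
  refine Filter.mem_of_superset
    ((isOpen_agree (Γ.shift x) (n + 1)).mem_nhds (self_mem_agree _ _)) ?_
  intro y hy
  let z : Γ.PathSpace := ⟨fun k => Nat.casesOn k (x.1 0) y.1, fun k => by
    cases k with
    | zero =>
      have h0 : y.1 0 = x.1 1 := hy 0 (by omega)
      change Γ.t (x.1 0) = Γ.i (y.1 0)
      rw [h0]
      exact x.2 0
    | succ k => exact y.2 k⟩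
  have hz : z ∈ A := hn fun j hj => by
    cases j with
    | zero => rfl
    | succ j => exact hy j (by omega)
  exact hAS hz

theorem continuous_shift_iterate (n : ℕ) : Continuous Γ.shift^[n] := continuous_shift.iterate n

theorem isOpenMap_shift_iterate (n : ℕ) : IsOpenMap Γ.shift^[n] := by
  induction n with
  | zero => exact IsOpenMap.id
  | succ n ih => exact ih.comp isOpenMap_shift

instance : T2Space Γ.PathSpace := by
  let _ : TopologicalSpace E := ⊥
  have : DiscreteTopology E := ⟨rfl⟩
  exact T2Space.of_injective_continuous (f := (Subtype.val : Γ.PathSpace → ℕ → E))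
    Subtype.val_injective continuous_induced_dom

instance [Finite E] : SecondCountableTopology Γ.PathSpace := by
  let _ : TopologicalSpace E := ⊥
  have : DiscreteTopology E := ⟨rfl⟩
  exact secondCountableTopology_induced _ (ℕ → E) _

instance [Finite E] : CompactSpace Γ.PathSpace := by
  let _ : TopologicalSpace E := ⊥
  have : DiscreteTopology E := ⟨rfl⟩
  have h : IsClosed {x : ℕ → E | ∀ k, Γ.t (x k) = Γ.i (x (k + 1))} := by
    rw [ofPred_forall]
    refine isClosed_iInter fun k => ?_
    have : IsClosed {p : E × E | Γ.t p.1 = Γ.i p.2} := isClosed_discrete _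
    exact this.preimage (f := fun x : ℕ → E => (x k, x (k + 1))) ((continuous_apply k).prodMk (continuous_apply (k + 1)))
  exact isCompact_iff_compactSpace.1 h.isCompact

/-! ### The étale groupoid of a one-sided shift of finite type -/

variable (Γ)

/-- The arrows `(x, n, y)` with `n = k - l` and `σ^k(x) = σ^l(y)` for some `k, l`. -/
@[ext]
structure Arrow where
  x : Γ.PathSpace
  n : ℤ
  y : Γ.PathSpace
  exists_shift : ∃ k l : ℕ, n = k - l ∧ Γ.shift^[k] x = Γ.shift^[l] y

variable {Γ}

/-- The set `{(x, k - l, y) | x ∈ A, y ∈ B, σ^k(x) = σ^l(y)}`. -/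
def basicSet (A B : Set Γ.PathSpace) (k l : ℕ) : Set Γ.Arrow :=
  {g | g.n = k - l ∧ g.x ∈ A ∧ g.y ∈ B ∧ Γ.shift^[k] g.x = Γ.shift^[l] g.y}

/-- The topology on arrows generated by the sets `basicSet A B k l` with `A` and `B` open. -/
instance : TopologicalSpace Γ.Arrow :=
  generateFrom {S | ∃ A B k l, IsOpen A ∧ IsOpen B ∧ S = basicSet A B k l}

namespace Arrow

theorem isOpen_basicSet {A B : Set Γ.PathSpace} (hA : IsOpen A) (hB : IsOpen B) (k l : ℕ) :
    IsOpen (basicSet A B k l) :=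
  isOpen_generateFrom_of_mem ⟨A, B, k, l, hA, hB, rfl⟩

theorem shift_add {x y : Γ.PathSpace} {k l : ℕ} (h : Γ.shift^[k] x = Γ.shift^[l] y) (m : ℕ) :
    Γ.shift^[m + k] x = Γ.shift^[m + l] y := by
  rw [Function.iterate_add_apply, h, ← Function.iterate_add_apply]

theorem basicSet_inter_subset (A B A' B' : Set Γ.PathSpace) {k l k' l' : ℕ} (hk : k ≤ k')
    (hn : (k : ℤ) - l = k' - l') :
    basicSet (A ∩ A') (B ∩ B') k l ⊆ basicSet A B k l ∩ basicSet A' B' k' l' := by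
  rintro g ⟨h1, h2, h3, h4⟩
  refine ⟨⟨h1, h2.1, h3.1, h4⟩, h1.trans hn, h2.2, h3.2, ?_⟩
  have h := shift_add h4 (k' - k)
  rwa [show k' - k + k = k' by omega, show k' - k + l = l' by omega] at h

theorem isTopologicalBasis : IsTopologicalBasis
    {S : Set Γ.Arrow | ∃ A B k l, IsOpen A ∧ IsOpen B ∧ S = basicSet A B k l} where
  exists_subset_inter := by
    rintro _ ⟨A, B, k, l, hA, hB, rfl⟩ _ ⟨A', B', k', l', hA', hB', rfl⟩ g ⟨hg, hg'⟩
    have hn : (k : ℤ) - l = k' - l' := hg.1.symm.trans hg'.1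
    rcases le_total k k' with hk | hk
    · exact ⟨_, ⟨_, _, k, l, hA.inter hA', hB.inter hB', rfl⟩,
        ⟨hg.1, ⟨hg.2.1, hg'.2.1⟩, ⟨hg.2.2.1, hg'.2.2.1⟩, hg.2.2.2⟩,
        basicSet_inter_subset A B A' B' hk hn⟩
    · refine ⟨_, ⟨_, _, k', l', hA'.inter hA, hB'.inter hB, rfl⟩,
        ⟨hg'.1, ⟨hg'.2.1, hg.2.1⟩, ⟨hg'.2.2.1, hg.2.2.1⟩, hg'.2.2.2⟩, ?_⟩
      rw [inter_comm (basicSet A B k l)]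
      exact basicSet_inter_subset A' B' A B hk hn.symm
  sUnion_eq := by
    refine eq_univ_of_forall fun g => ?_
    obtain ⟨k, l, hn, h⟩ := g.exists_shift
    exact ⟨_, ⟨univ, univ, k, l, isOpen_univ, isOpen_univ, rfl⟩, hn, trivial, trivial, h⟩
  eq_generateFrom := rfl

theorem continuous_x : Continuous (Arrow.x : Γ.Arrow → Γ.PathSpace) := by
  refine ⟨fun A hA => isTopologicalBasis.isOpen_iff.2 fun g hg => ?_⟩
  obtain ⟨k, l, hn, h⟩ := g.exists_shift
  exact ⟨_, ⟨A, univ, k, l, hA, isOpen_univ, rfl⟩, ⟨hn, hg, trivial, h⟩, fun g' hg' => hg'.2.1⟩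

theorem continuous_y : Continuous (Arrow.y : Γ.Arrow → Γ.PathSpace) := by
  refine ⟨fun A hA => isTopologicalBasis.isOpen_iff.2 fun g hg => ?_⟩
  obtain ⟨k, l, hn, h⟩ := g.exists_shift
  exact ⟨_, ⟨univ, A, k, l, isOpen_univ, hA, rfl⟩, ⟨hn, trivial, hg, h⟩, fun g' hg' => hg'.2.2.1⟩

theorem continuous_n : Continuous (Arrow.n : Γ.Arrow → ℤ) := by
  refine ⟨fun A _ => isTopologicalBasis.isOpen_iff.2 fun g hg => ?_⟩
  obtain ⟨k, l, hn, h⟩ := g.exists_shift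
  refine ⟨_, ⟨univ, univ, k, l, isOpen_univ, isOpen_univ, rfl⟩, ⟨hn, trivial, trivial, h⟩, ?_⟩
  rintro g' hg'
  rw [mem_preimage, hg'.1, ← hn]
  exact hg

instance : T2Space Γ.Arrow :=
  T2Space.of_injective_continuous (f := fun g : Γ.Arrow => (g.x, g.n, g.y))
    (fun g h e => by
      simp only [Prod.mk.injEq] at e
      exact Arrow.ext e.1 e.2.1 e.2.2)
    (continuous_x.prodMk (continuous_n.prodMk continuous_y))

theorem eq_of_agree {x y z : Γ.PathSpace} {l : ℕ} (hx : x ∈ agree z l) (hy : y ∈ agree z l)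
    (h : Γ.shift^[l] x = Γ.shift^[l] y) : x = y := by
  refine Subtype.ext (funext fun j => ?_)
  rcases lt_or_ge j l with hj | hj
  · rw [hx j hj, hy j hj]
  · have h' := congrArg (fun w : Γ.PathSpace => w.1 (j - l)) h
    simp only [shift_iterate_apply] at h'
    rwa [show l + (j - l) = j by omega] at h'

theorem isLocalHomeomorph_x : IsLocalHomeomorph (Arrow.x : Γ.Arrow → Γ.PathSpace) := by
  refine isLocalHomeomorph_of_injOn continuous_x ?_ ?_
  · refine isTopologicalBasis.isOpenMap_iff.2 ?_
    rintro _ ⟨A, B, k, l, hA, hB, rfl⟩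
    have : Arrow.x '' basicSet A B k l = A ∩ Γ.shift^[k] ⁻¹' (Γ.shift^[l] '' B) := by
      ext x
      constructor
      · rintro ⟨g, ⟨-, hgA, hgB, hg⟩, rfl⟩
        exact ⟨hgA, g.y, hgB, hg.symm⟩
      · rintro ⟨hxA, y, hyB, h⟩
        exact ⟨⟨x, k - l, y, k, l, rfl, h.symm⟩, ⟨rfl, hxA, hyB, h.symm⟩, rfl⟩
    rw [this]
    exact hA.inter ((isOpenMap_shift_iterate l B hB).preimage (continuous_shift_iterate k))
  · intro g
    obtain ⟨k, l, hn, h⟩ := g.exists_shift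
    refine ⟨basicSet univ (agree g.y l) k l, isOpen_basicSet isOpen_univ (isOpen_agree _ _) _ _,
      ⟨hn, trivial, self_mem_agree _ _, h⟩, ?_⟩
    rintro a ⟨ha1, -, ha3, ha4⟩ b ⟨hb1, -, hb3, hb4⟩ hab
    refine Arrow.ext hab (ha1.trans hb1.symm) (eq_of_agree ha3 hb3 ?_)
    rw [← ha4, ← hb4, hab]

instance [Finite E] : LocallyCompactSpace Γ.Arrow :=
  letI : ChartedSpace Γ.PathSpace Γ.Arrow :=
    { atlas := univ
      chartAt := fun g => (isLocalHomeomorph_x g).choose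
      mem_chart_source := fun g => (isLocalHomeomorph_x g).choose_spec.1
      chart_mem_atlas := fun _ => trivial }
  ChartedSpace.locallyCompactSpace Γ.PathSpace Γ.Arrow

instance [Finite E] : SecondCountableTopology Γ.Arrow := by
  have hb := isBasis_countableBasis Γ.PathSpace
  have hbasis : IsTopologicalBasis (range fun p :
      (countableBasis Γ.PathSpace × countableBasis Γ.PathSpace) × ℕ × ℕ =>
        basicSet p.1.1.1 p.1.2.1 p.2.1 p.2.2) := by
    refine isTopologicalBasis_of_isOpen_of_nhds ?_ ?_
    · rintro _ ⟨p, rfl⟩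
      exact isOpen_basicSet (hb.isOpen p.1.1.2) (hb.isOpen p.1.2.2) _ _
    · intro g S hg hS
      obtain ⟨_, ⟨A, B, k, l, hA, hB, rfl⟩, hg', hsub⟩ :=
        isTopologicalBasis.exists_subset_of_mem_open hg hS
      obtain ⟨A', hA', hgA, hAA⟩ := hb.exists_subset_of_mem_open hg'.2.1 hA
      obtain ⟨B', hB', hgB, hBB⟩ := hb.exists_subset_of_mem_open hg'.2.2.1 hB
      exact ⟨_, ⟨((⟨A', hA'⟩, ⟨B', hB'⟩), k, l), rfl⟩, ⟨hg'.1, hgA, hgB, hg'.2.2.2⟩,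
        fun a ha => hsub ⟨ha.1, hAA ha.2.1, hBB ha.2.2.1, ha.2.2.2⟩⟩
  exact hbasis.secondCountableTopology (countable_range _)

/-- The unit `(x, 0, x)`. -/
def unit (x : Γ.PathSpace) : Γ.Arrow := ⟨x, 0, x, 0, 0, by simp, rfl⟩

/-- The inverse `(x, n, y)⁻¹ = (y, -n, x)`. -/
def inv (g : Γ.Arrow) : Γ.Arrow :=
  ⟨g.y, -g.n, g.x, by
    obtain ⟨k, l, hn, h⟩ := g.exists_shift
    exact ⟨l, k, by omega, h.symm⟩⟩

/-- The product `(x, n, y) (y, n', y') = (x, n + n', y')`. -/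
def mul (g h : Γ.Arrow) (e : g.y = h.x) : Γ.Arrow :=
  ⟨g.x, g.n + h.n, h.y, by
    obtain ⟨a, b, hn, h1⟩ := g.exists_shift
    obtain ⟨c, d, hm, h2⟩ := h.exists_shift
    refine ⟨c + a, b + d, by push_cast; omega, ?_⟩
    rw [shift_add h1 c, ← shift_add h2 b, e, add_comm]⟩

theorem continuous_unit : Continuous (unit : Γ.PathSpace → Γ.Arrow) := by
  refine isTopologicalBasis.continuous_iff.2 ?_
  rintro _ ⟨A, B, k, l, hA, hB, rfl⟩
  by_cases hkl : k = l
  · have : unit ⁻¹' basicSet A B k l = A ∩ B := by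
      ext x
      simp [unit, basicSet, hkl]
    rw [this]
    exact hA.inter hB
  · have : unit ⁻¹' basicSet A B k l = ∅ := by
      ext x
      simp only [unit, basicSet, mem_preimage, mem_ofPred_eq, mem_empty_iff_false, iff_false]
      rintro ⟨h, -⟩
      omega
    rw [this]
    exact isOpen_empty

theorem continuous_inv : Continuous (inv : Γ.Arrow → Γ.Arrow) := by
  refine isTopologicalBasis.continuous_iff.2 ?_
  rintro _ ⟨A, B, k, l, hA, hB, rfl⟩
  have : inv ⁻¹' basicSet A B k l = basicSet B A l k := by
    ext g
    simp only [inv, basicSet, mem_preimage, mem_ofPred_eq]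
    constructor
    · rintro ⟨h1, h2, h3, h4⟩
      exact ⟨by omega, h3, h2, h4.symm⟩
    · rintro ⟨h1, h2, h3, h4⟩
      exact ⟨by omega, h3, h2, h4.symm⟩
  rw [this]
  exact isOpen_basicSet hB hA _ _

theorem continuous_mul :
    Continuous fun p : {p : Γ.Arrow × Γ.Arrow // p.1.y = p.2.x} => mul p.1.1 p.1.2 p.2 := by
  refine isTopologicalBasis.continuous_iff.2 ?_
  rintro _ ⟨A, B, k, l, hA, hB, rfl⟩
  rw [isOpen_iff_mem_nhds]
  rintro ⟨⟨g, h⟩, e⟩ ⟨hn, hgA, hhB, hkl⟩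
  obtain ⟨a, b, hgn, hg⟩ := g.exists_shift
  obtain ⟨c, d, hhn, hh⟩ := h.exists_shift
  dsimp only [mul] at hn hgA hhB hkl
  have hg' := shift_add hg (c + k)
  have hh' := shift_add hh (b + k)
  set P := c + k + a with hP
  set Q := c + k + b with hQ
  set R := b + k + d with hR
  rw [show b + k + c = Q by omega] at hh'
  have hPR : (P : ℤ) - R = k - l := by
    rw [← hn, hgn, hhn, hP, hR]
    push_cast
    ring
  have hU1 := isOpen_basicSet (hA.inter (isOpen_agree g.x P)) isOpen_univ P Q
  have hU2 := isOpen_basicSet isOpen_univ (hB.inter (isOpen_agree h.y R)) Q R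
  have hopen := (hU1.prod hU2).preimage
    (continuous_subtype_val (p := fun p : Γ.Arrow × Γ.Arrow => p.1.y = p.2.x))
  refine Filter.mem_of_superset (hopen.mem_nhds ?_) ?_
  · have hn1 : g.n = P - Q := by omega
    have hn2 : h.n = Q - R := by omega
    exact ⟨⟨hn1, ⟨hgA, self_mem_agree _ _⟩, trivial, hg'⟩,
      ⟨hn2, trivial, ⟨hhB, self_mem_agree _ _⟩, hh'⟩⟩
  · rintro ⟨⟨g', h'⟩, e'⟩ ⟨⟨hn1, hx1, -, hs1⟩, ⟨hn2, -, hy2, hs2⟩⟩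
    dsimp only at e' hn1 hx1 hs1 hn2 hy2 hs2
    refine ⟨?_, hx1.1, hy2.1, ?_⟩
    · change g'.n + h'.n = k - l
      omega
    · change Γ.shift^[k] g'.x = Γ.shift^[l] h'.y
      refine Subtype.ext (funext fun j => ?_)
      rw [shift_iterate_apply, shift_iterate_apply]
      rcases lt_or_ge (k + j) P with hj | hj
      · rw [hx1.2 _ hj, hy2.2 _ (by omega)]
        have := congrArg (fun w : Γ.PathSpace => w.1 j) hkl
        simpa only [shift_iterate_apply] using this
      · have h3 : Γ.shift^[P] g'.x = Γ.shift^[R] h'.y := by rw [hs1, e', hs2]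
        have := congrArg (fun w : Γ.PathSpace => w.1 (k + j - P)) h3
        simp only [shift_iterate_apply] at this
        rwa [show P + (k + j - P) = k + j by omega,
          show R + (k + j - P) = l + j by omega] at this

end Arrow

variable (Γ)

/-- The étale groupoid `G` of the one-sided shift of finite type of the graph `Γ`, with range map
`(x, n, y) ↦ x`, source map `(x, n, y) ↦ y` and unit space the path space. -/
def groupoid [Finite E] : EtaleGroupoid Γ.PathSpace Γ.Arrow where
  r := Arrow.x
  s := Arrow.y
  unit := Arrow.unit
  inv := Arrow.inv
  mul := Arrow.mul
  r_unit _ := rfl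
  s_unit _ := rfl
  r_inv _ := rfl
  s_inv _ := rfl
  r_mul _ _ _ := rfl
  s_mul _ _ _ := rfl
  mul_assoc _ _ _ _ _ := Arrow.ext rfl (add_assoc _ _ _) rfl
  unit_mul _ := Arrow.ext rfl (zero_add _) rfl
  mul_unit _ := Arrow.ext rfl (add_zero _) rfl
  mul_inv g := Arrow.ext rfl (add_neg_cancel g.n) rfl
  inv_mul g := Arrow.ext rfl (neg_add_cancel g.n) rfl
  inv_inv g := Arrow.ext rfl (neg_neg g.n) rfl
  t2Space := inferInstance
  locallyCompactSpace := inferInstance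
  secondCountable := inferInstance
  continuous_unit := Arrow.continuous_unit
  continuous_inv := Arrow.continuous_inv
  continuous_mul := Arrow.continuous_mul
  isLocalHomeomorph_r := Arrow.isLocalHomeomorph_x

end EdgeGraph

/-! A compact open bisection is a finite table of prefix replacements `μw ↦ νw` between words that
end at the same vertex, that is, words of the same type. If two words of the same type have disjoint
cylinders, exchanging them is a transposition, here called a swap. Its index is zero: if `V` is the
bisection of the arrows from `νw` to `μw`, then `1_V + 1_{V⁻¹}` is, up to a boundary, the indicator
of the units over `r(V)`, and indicators of clopen sets of units are boundaries
(`homologyClass_swapSet`). It remains to see that finitely many swaps generate all of them, and that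
the swaps generate the kernel of the index map.

Finitely many suffice (`containsSwaps_of_bounded`). Irreducibility and the existence of a branching
vertex make `Y` so rich that, for some `k` and `L`, any two words of length `k` can be avoided by an
admissible word `ρ'` of any prescribed type and of length less than `L` (`exists_detour`). If `μ` is
longer than `L`, let `ρ` be its prefix of length `L`. Conjugating the swap of `μ` and `ν` by the
short swap of `ρ` and a suitable `ρ'` gives a swap of smaller total length, and induction applies.

Swaps generate the kernel (`indexKernel_le`). An element `α` maps a partition `P` of `Y` into
cylinders to a partition `Q`, preserving types. Both arise from the words of length `k` by
repeatedly splitting a word into its one-edge extensions. If the splits use each type equally often,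
the two partitions are matched, type by type, by a product `β` of swaps (`Derives.rel_of_perm`);
then `β * α` permutes the words of `P` and is itself a product of swaps (`Maps.mem`).

The number of splits of each type is where the index enters. For a path `b`, let the weight of a
word be the number of its extensions of length below `N` that end where `b` starts. Splitting a word
lowers the total weight by one if the word has that type, and leaves it unchanged otherwise. The
difference of the total weights of `P` and `Q` is the sum over the bisection of `visitCocycle`, a
function on arrows that counts visits to `b` between times `N` and `N + n`. On any compact set of
composable pairs this function is additive once `N` is large, so it pairs to zero with a boundary;
hence trivial index forces equal split counts. -/

namespace EdgeGraph

/-! ### Words, cylinders, types and exchange of prefixes. -/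

section Words

variable {V E : Type*} {Γ : EdgeGraph V E}

/-- The word formed by the first `n` edges of a path. -/
def pre (x : Γ.PathSpace) (n : ℕ) : List E := (List.range n).map x.1

/-- The cylinder set of the paths that begin with the word `μ`. -/
def cyl (Γ : EdgeGraph V E) (μ : List E) : Set Γ.PathSpace := {x | pre x μ.length = μ}

/-- The type of a word: the terminal vertex of its last edge. -/
def ty (Γ : EdgeGraph V E) (μ : List E) : Option V := μ.getLast?.map Γ.t

@[simp] theorem length_pre (x : Γ.PathSpace) (n : ℕ) : (pre x n).length = n := by simp [pre]

theorem mem_cyl_pre (x : Γ.PathSpace) (n : ℕ) : x ∈ Γ.cyl (pre x n) := by simp [cyl]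

theorem pre_add (x : Γ.PathSpace) (m n : ℕ) :
    pre x (m + n) = pre x m ++ pre (Γ.shift^[m] x) n := by
  simp only [pre, List.range_add, List.map_append, List.map_map]
  congr 1
  exact List.map_congr_left fun j _ => (shift_iterate_apply m x j).symm

theorem pre_succ (x : Γ.PathSpace) (n : ℕ) : pre x (n + 1) = pre x n ++ [x.1 n] := by
  simp [pre, List.range_succ]

theorem mem_cyl_append {x : Γ.PathSpace} {μ κ : List E} :
    x ∈ Γ.cyl (μ ++ κ) ↔ x ∈ Γ.cyl μ ∧ Γ.shift^[μ.length] x ∈ Γ.cyl κ := by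
  simp only [cyl, mem_ofPred_eq, List.length_append, pre_add]
  constructor
  · intro h
    exact List.append_inj h (by simp)
  · rintro ⟨h1, h2⟩
    rw [h1, h2]

theorem cyl_append_subset (μ κ : List E) : Γ.cyl (μ ++ κ) ⊆ Γ.cyl μ :=
  fun _ h => (mem_cyl_append.1 h).1

theorem pre_eq_iff {x y : Γ.PathSpace} {n : ℕ} : pre x n = pre y n ↔ ∀ j < n, x.1 j = y.1 j := by
  simp [pre]

theorem agree_eq_cyl (x : Γ.PathSpace) (n : ℕ) : agree x n = Γ.cyl (pre x n) := by
  ext y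
  simp [agree, cyl, pre_eq_iff]

theorem isClopen_cyl (μ : List E) : IsClopen (Γ.cyl μ) := by
  have h : ∀ {x} {S : Set Γ.PathSpace}, (∀ y ∈ agree x μ.length, y ∈ S) → S ∈ 𝓝 x :=
    fun {x} {S} h => Filter.mem_of_superset ((isOpen_agree x μ.length).mem_nhds
      (self_mem_agree _ _)) h
  refine ⟨⟨isOpen_iff_mem_nhds.2 fun x hx => h fun y hy => ?_⟩,
    isOpen_iff_mem_nhds.2 fun x hx => h fun y hy => ?_⟩
  · exact fun hyc => hx ((pre_eq_iff.2 fun j hj => hy j hj).symm.trans hyc)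
  · exact (pre_eq_iff.2 fun j hj => hy j hj).trans hx

theorem isOpen_cyl (μ : List E) : IsOpen (Γ.cyl μ) := (isClopen_cyl μ).isOpen

/-- A path is determined by a prefix and the corresponding tail. -/
theorem eq_of_mem_cyl {x y : Γ.PathSpace} {μ : List E} (hx : x ∈ Γ.cyl μ) (hy : y ∈ Γ.cyl μ)
    (h : Γ.shift^[μ.length] x = Γ.shift^[μ.length] y) : x = y := by
  refine Arrow.eq_of_agree (self_mem_agree x μ.length) ?_ h
  rw [agree_eq_cyl, show pre x μ.length = μ from hx]
  exact hy

theorem pre_prefix_pre (x : Γ.PathSpace) {m n : ℕ} (h : m ≤ n) : ∃ κ, pre x n = pre x m ++ κ := by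
  obtain ⟨k, rfl⟩ := Nat.exists_eq_add_of_le h
  exact ⟨_, pre_add x m k⟩

theorem exists_append_of_mem {x : Γ.PathSpace} {μ ν : List E} (hμ : x ∈ Γ.cyl μ)
    (hν : x ∈ Γ.cyl ν) (h : μ.length ≤ ν.length) : ∃ κ, ν = μ ++ κ := by
  obtain ⟨κ, hκ⟩ := pre_prefix_pre x h
  exact ⟨κ, by rwa [show pre x _ = ν from hν, show pre x _ = μ from hμ] at hκ⟩

theorem eq_of_mem_cyl_of_length {x : Γ.PathSpace} {μ ν : List E} (hμ : x ∈ Γ.cyl μ)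
    (hν : x ∈ Γ.cyl ν) (h : μ.length = ν.length) : μ = ν := by
  rw [← show pre x _ = ν from hν, ← h]
  exact hμ.symm

/-- The last edge of `μ` ends where the next edge of `x` starts. The empty word has type `none`,
which is why positive lengths are required throughout. -/
theorem ty_eq {x : Γ.PathSpace} {μ : List E} (hx : x ∈ Γ.cyl μ) (h : 1 ≤ μ.length) :
    Γ.ty μ = some (Γ.i (x.1 μ.length)) := by
  obtain ⟨n, hn⟩ := Nat.exists_eq_add_of_le' h
  have h1 : pre x (n + 1) = μ := hn ▸ hx
  rw [hn, ← h1, pre_succ, ty, List.getLast?_append]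
  simp [x.2 n]

theorem ty_append_of_ne_nil (μ : List E) {κ : List E} (hκ : κ ≠ []) :
    Γ.ty (μ ++ κ) = Γ.ty κ := by
  simp [ty, List.getLast?_append_of_ne_nil _ hκ]

theorem ty_append_congr {μ ν : List E} (h : Γ.ty μ = Γ.ty ν) (κ : List E) :
    Γ.ty (μ ++ κ) = Γ.ty (ν ++ κ) := by
  rcases eq_or_ne κ [] with rfl | hκ
  · simpa using h
  · rw [ty_append_of_ne_nil _ hκ, ty_append_of_ne_nil _ hκ]

/-- Prefixes may be exchanged for prefixes of the same type. -/
theorem exists_graft {x : Γ.PathSpace} {ν : List E} {m : ℕ}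
    (hν : (Γ.cyl ν).Nonempty) (h1 : 1 ≤ ν.length) (h : Γ.ty ν = some (Γ.i (x.1 m))) :
    ∃ z ∈ Γ.cyl ν, Γ.shift^[ν.length] z = Γ.shift^[m] x := by
  obtain ⟨y, hy⟩ := hν
  have hi : Γ.i (x.1 m) = Γ.i (y.1 ν.length) := by
    rw [ty_eq hy h1] at h
    exact (Option.some.inj h).symm
  let z : Γ.PathSpace := ⟨fun j => if j < ν.length then y.1 j else x.1 (m + (j - ν.length)), by
    intro j
    dsimp only
    rcases lt_trichotomy (j + 1) ν.length with hj | hj | hj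
    · rw [if_pos (by omega), if_pos hj]
      exact y.2 j
    · rw [if_pos (by omega), if_neg (by omega), show m + (j + 1 - ν.length) = m by omega, hi, ← hj]
      exact y.2 j
    · rw [if_neg (by omega), if_neg (by omega),
        show m + (j + 1 - ν.length) = m + (j - ν.length) + 1 by omega]
      exact x.2 _⟩
  refine ⟨z, ?_, Subtype.ext (funext fun j => ?_)⟩
  · refine Eq.trans (pre_eq_iff.2 fun j hj => ?_) hy
    exact if_pos hj
  · rw [shift_iterate_apply, shift_iterate_apply]
    change (if ν.length + j < ν.length then _ else _) = _
    rw [if_neg (by omega), show m + (ν.length + j - ν.length) = m + j by omega]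

theorem exists_graft_of_ty_eq {x : Γ.PathSpace} {μ ν : List E} (hx : x ∈ Γ.cyl μ)
    (hμ : 1 ≤ μ.length) (hν : (Γ.cyl ν).Nonempty) (h1 : 1 ≤ ν.length) (h : Γ.ty μ = Γ.ty ν) :
    ∃ z ∈ Γ.cyl ν, Γ.shift^[ν.length] z = Γ.shift^[μ.length] x :=
  exists_graft hν h1 (by rw [← h, ty_eq hx hμ])

theorem cyl_append_nonempty {μ ν κ : List E} (hμ : 1 ≤ μ.length) (hν : (Γ.cyl ν).Nonempty)
    (h1 : 1 ≤ ν.length) (h : Γ.ty μ = Γ.ty ν) (hκ : (Γ.cyl (μ ++ κ)).Nonempty) :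
    (Γ.cyl (ν ++ κ)).Nonempty := by
  obtain ⟨x, hx⟩ := hκ
  obtain ⟨hx1, hx2⟩ := mem_cyl_append.1 hx
  obtain ⟨z, hz, hzs⟩ := exists_graft_of_ty_eq hx1 hμ hν h1 h
  exact ⟨z, mem_cyl_append.2 ⟨hz, hzs ▸ hx2⟩⟩

theorem disjoint_cyl_of_length {μ ν : List E} (h : μ.length = ν.length) (hne : μ ≠ ν) :
    Disjoint (Γ.cyl μ) (Γ.cyl ν) :=
  disjoint_left.2 fun _ h1 h2 => hne (eq_of_mem_cyl_of_length h1 h2 h)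

/-- Behind a common prefix only the tails matter; this lets disjointness be transported from one
prefix to another of the same type. -/
theorem disjoint_cyl_append_iff {μ κ κ' : List E} :
    Disjoint (Γ.cyl (μ ++ κ)) (Γ.cyl (μ ++ κ')) ↔
      ∀ x ∈ Γ.cyl μ, Γ.shift^[μ.length] x ∈ Γ.cyl κ → Γ.shift^[μ.length] x ∉ Γ.cyl κ' := by
  simp only [disjoint_left, mem_cyl_append]
  exact ⟨fun h x a b c => h ⟨a, b⟩ ⟨a, c⟩, fun h x a b => h x a.1 a.2 b.2⟩

theorem exists_cyl_subset {x : Γ.PathSpace} {A : Set Γ.PathSpace} (hA : IsOpen A) (hx : x ∈ A)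
    (m : ℕ) : ∃ n ≥ m, Γ.cyl (pre x n) ⊆ A := by
  obtain ⟨n, hn⟩ := exists_agree_subset hA hx
  refine ⟨max m n, le_max_left _ _, ?_⟩
  rw [← agree_eq_cyl]
  exact fun y hy => hn fun j hj => hy j (hj.trans_le (le_max_right _ _))

/-- A clopen set is a union of cylinders of a fixed length. -/
theorem exists_level [Finite E] (Y : Clopens Γ.PathSpace) :
    ∃ k, ∀ x ∈ Y, ∀ n ≥ k, Γ.cyl (pre x n) ⊆ Y := by
  have h : ∀ x ∈ (Y : Set Γ.PathSpace), ∃ n, Γ.cyl (pre x n) ⊆ Y := fun x hx => by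
    obtain ⟨n, -, hn⟩ := exists_cyl_subset Y.isClopen.isOpen hx 0
    exact ⟨n, hn⟩
  choose! n hn using h
  obtain ⟨t, ht, hcov⟩ := Y.isClopen.isClosed.isCompact.elim_nhds_subcover
    (fun x => Γ.cyl (pre x (n x))) fun x _ => (isOpen_cyl _).mem_nhds (mem_cyl_pre x _)
  refine ⟨t.sup n, fun x hx m hm => ?_⟩
  have := hcov hx
  simp only [mem_iUnion] at this
  obtain ⟨y, hy, hxy⟩ := this
  have hle : n y ≤ m := (Finset.le_sup hy).trans hm
  obtain ⟨κ, hκ⟩ := exists_append_of_mem hxy (mem_cyl_pre x m) (by simpa using hle)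
  rw [hκ]
  exact (cyl_append_subset _ _).trans (hn y (ht y hy))

end Words

end EdgeGraph

theorem isCompact_of_isCompact_image {Z W : Type*} [TopologicalSpace Z] [TopologicalSpace W]
    {π : Z → W} (hπ : IsLocalHomeomorph π) {U : Set Z} (hU : IsOpen U) (hinj : InjOn π U)
    (hc : IsCompact (π '' U)) : IsCompact U := by
  have he : IsOpenEmbedding (U.domRestrict π) := .of_continuous_injective_isOpenMap
    (hπ.continuous.comp continuous_subtype_val) (injOn_iff_injective.1 hinj)
    (hπ.isOpenMap.comp hU.isOpenMap_subtype_val)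
  rw [isCompact_iff_isCompact_univ, he.isEmbedding.isCompact_iff, image_univ, range_domRestrict]
  exact hc

/-! ### Pairing compactly supported functions with integer valued functions. -/

section Pairing

variable {Z W : Type*} [TopologicalSpace Z] [TopologicalSpace W]

/-- The pairing of compactly supported functions with a function whose support meets every compact
set in a finite set. -/
noncomputable def pairing (c : Z → ℤ) (hc : ∀ K, IsCompact K → {z ∈ K | c z ≠ 0}.Finite) :
    C_c(Z, ℤ) →+ ℤ where
  toFun f := ∑ᶠ z, f z * c z
  map_zero' := by simp
  map_add' f g := by
    have hfin : ∀ f : C_c(Z, ℤ), (Function.support fun z => f z * c z).Finite := fun f =>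
      (hc _ f.hasCompactSupport.isCompact).subset fun z hz =>
        ⟨subset_tsupport f (left_ne_zero_of_mul hz), right_ne_zero_of_mul hz⟩
    rw [← finsum_add_distrib (hfin f) (hfin g)]
    simp [add_mul]

theorem finite_support_comp {π : Z → W} (hπ : IsLocalHomeomorph π) (f : C_c(Z, ℤ)) {c : W → ℤ}
    (hc : ∀ K, IsCompact K → {w ∈ K | c w ≠ 0}.Finite) : {z | f z ≠ 0 ∧ c (π z) ≠ 0}.Finite := by
  refine ((hc _ (f.hasCompactSupport.isCompact.image hπ.continuous)).biUnion
    fun w _ => finite_fibre hπ f w).subset ?_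
  rintro z ⟨h1, h2⟩
  exact mem_biUnion (show π z ∈ {w ∈ π '' tsupport f | c w ≠ 0} from
    ⟨⟨z, subset_tsupport f h1, rfl⟩, h2⟩) ⟨rfl, h1⟩

/-- Pushforward is adjoint to composition with `π`: sum over the base after summing over the fibres.
Only finitely many points contribute, so the sum may be regrouped. -/
theorem pairing_pushforward [T2Space Z] [T2Space W] {π : Z → W} (hπ : IsLocalHomeomorph π)
    (f : C_c(Z, ℤ)) {c : W → ℤ} (hc : ∀ K, IsCompact K → {w ∈ K | c w ≠ 0}.Finite) :
    pairing c hc (pushforward π hπ f) = ∑ᶠ z, f z * c (π z) := by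
  classical
  have hfin := finite_support_comp hπ f hc
  set S := hfin.toFinset with hS
  have hmem : ∀ z, z ∈ S ↔ f z ≠ 0 ∧ c (π z) ≠ 0 := fun z => by simp [hS]
  have h1 : ∀ w, pushforwardFun π f w * c w = ∑ z ∈ S with π z = w, f z * c (π z) := by
    intro w
    rcases eq_or_ne (c w) 0 with hw | hw
    · rw [hw, mul_zero]
      refine (Finset.sum_eq_zero fun z hz => ?_).symm
      rw [(Finset.mem_filter.1 hz).2, hw, mul_zero]
    · rw [pushforwardFun_eq_sum (S.filter fun z => π z = w), Finset.sum_mul]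
      · exact Finset.sum_congr rfl fun z hz => by rw [(Finset.mem_filter.1 hz).2]
      · exact fun z hz => (Finset.mem_filter.1 hz).2
      · exact fun z hz hfz => Finset.mem_filter.2 ⟨(hmem z).2 ⟨hfz, hz ▸ hw⟩, hz⟩
  change ∑ᶠ w, pushforwardFun π f w * c w = _
  rw [finsum_congr h1, finsum_eq_sum_of_support_subset (s := S.image π),
    finsum_eq_sum_of_support_subset (s := S)]
  · exact Finset.sum_fiberwise_of_maps_to (fun z hz => Finset.mem_image_of_mem π hz) _
  · exact fun z hz => (hmem z).2 ⟨left_ne_zero_of_mul hz, right_ne_zero_of_mul hz⟩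
  · intro w hw
    obtain ⟨z, hz, -⟩ := Finset.exists_ne_zero_of_sum_ne_zero hw
    rw [Finset.mem_filter] at hz
    exact Finset.mem_coe.2 (Finset.mem_image.2 ⟨z, hz⟩)

end Pairing

/-! ### Boundaries of bisections, and transpositions of trivial index. -/

namespace EtaleGroupoid

variable {X G : Type*} [TopologicalSpace X] [TopologicalSpace G] {𝒢 : EtaleGroupoid X G}

/-- A bisection with trivial homology class pairs trivially with asymptotic cocycles. -/
theorem IsFullBisection.eventually_finsum_eq_zero {U : Set G} (hU : 𝒢.IsFullBisection U)
    (h : hU.homologyClass = 0) (c : ℕ → G → ℤ)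
    (hfin : ∀ N K, IsCompact K → {g ∈ K | c N g ≠ 0}.Finite)
    (hc : ∀ K : Set 𝒢.Composable, IsCompact K →
      ∀ᶠ N in Filter.atTop, ∀ p ∈ K, c N (𝒢.d₁ p) = c N (𝒢.d₂ p) + c N (𝒢.d₀ p)) :
    ∀ᶠ N in Filter.atTop, ∑ᶠ g ∈ U, c N g = 0 := by
  have := 𝒢.t2Space
  unfold homologyClass at h
  rw [QuotientAddGroup.eq_zero_iff, AddSubgroup.mem_addSubgroupOf] at h
  obtain ⟨F, hF⟩ := h
  filter_upwards [hc _ F.hasCompactSupport.isCompact] with N hN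
  have h1 : pairing (c N) (hfin N) hU.char = ∑ᶠ g ∈ U, c N g := by
    rw [finsum_mem_def]
    refine finsum_congr fun g => ?_
    change U.indicator 1 g * c N g = _
    by_cases hg : g ∈ U <;> simp [hg]
  -- With `1_U = δ₂ F`, the pairing becomes the sum of `F p` times the defect of additivity of `c N`
  -- at `p`. The defect vanishes on the support of `F` once `N` is large; the threshold depends on
  -- `F`, hence the eventual statement.
  rw [← h1, ← show 𝒢.δ₂ F = hU.char from hF, δ₂, AddMonoidHom.add_apply, AddMonoidHom.sub_apply,
    map_add, map_sub, pairing_pushforward, pairing_pushforward, pairing_pushforward]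
  have hs : ∀ {d : 𝒢.Composable → G} (_ : IsLocalHomeomorph d),
      (Function.support fun p => F p * c N (d p)).Finite := fun {d} hd =>
    (finite_support_comp hd F (hfin N)).subset fun p hp =>
      ⟨left_ne_zero_of_mul hp, right_ne_zero_of_mul hp⟩
  rw [← finsum_sub_distrib (hs 𝒢.isLocalHomeomorph_d₀) (hs 𝒢.isLocalHomeomorph_d₁),
    ← finsum_add_distrib _ (hs 𝒢.isLocalHomeomorph_d₂)]
  · rw [← finsum_zero (α := 𝒢.Composable)]
    refine finsum_congr fun p => ?_
    rcases eq_or_ne (F p) 0 with hp | hp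
    · simp [hp]
    · rw [hN p (subset_tsupport F hp)]
      ring
  · exact ((hs 𝒢.isLocalHomeomorph_d₀).union (hs 𝒢.isLocalHomeomorph_d₁)).subset
      (Function.support_sub _ _)

/-- On the compact set `U` both `r` and `s` are continuous bijections onto a Hausdorff space, hence
homeomorphisms. -/
theorem IsFullBisection.exists_represents [CompactSpace X] {U : Set G}
    (hU : 𝒢.IsFullBisection U) : ∃ α : X ≃ₜ X, 𝒢.Represents U α := by
  have := 𝒢.t2Space_units
  have : CompactSpace U := isCompact_iff_compactSpace.1 hU.isCompact
  have key : ∀ f : G → X, Continuous f → InjOn f U → f '' U = univ →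
      ∃ e : U ≃ₜ X, ∀ g, e g = f g := fun f hf hi hs =>
    ⟨Continuous.homeoOfEquivCompactToT2 (f := Equiv.ofBijective (U.domRestrict f)
      ⟨injOn_iff_injective.1 hi, range_eq_univ.1 (by rw [range_domRestrict, hs])⟩)
      (hf.comp continuous_subtype_val), fun g => rfl⟩
  obtain ⟨er, her⟩ := key 𝒢.r 𝒢.isLocalHomeomorph_r.continuous hU.isGSet.1 hU.image_r
  obtain ⟨es, hes⟩ := key 𝒢.s 𝒢.isLocalHomeomorph_s.continuous hU.isGSet.2 hU.image_s
  refine ⟨es.symm.trans er, hU, fun g hg => ?_⟩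
  rw [← hes ⟨g, hg⟩, Homeomorph.trans_apply, Homeomorph.symm_apply_apply, her]

/-- The condition `s(A) = r(B)` makes every element of `A` and of `B` occur in exactly one
composable pair, so the outer faces return the full indicators. -/
theorem δ₂_charFun_pairs [T2Space G] {A B C : Set G} (hAc : IsCompact A) (hAo : IsOpen A)
    (hBc : IsCompact B) (hBo : IsOpen B) (hCc : IsCompact C) (hCo : IsOpen C)
    (hA : 𝒢.IsGSet A) (hB : 𝒢.IsGSet B) (hAB : 𝒢.s '' A = 𝒢.r '' B)
    (hC : 𝒢.d₁ '' 𝒢.pairs A B = C) :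
    𝒢.δ₂ (charFun (𝒢.pairs A B) (isCompact_pairs hAc hBc) (isOpen_pairs hAo hBo)) =
      charFun B hBc hBo - charFun C hCc hCo + charFun A hAc hAo := by
  have h0 : 𝒢.d₀ '' 𝒢.pairs A B = B := by
    refine Subset.antisymm (by rintro _ ⟨p, hp, rfl⟩; exact hp.2) fun h hh => ?_
    obtain ⟨g, hg, e⟩ := hAB.symm ▸ mem_image_of_mem 𝒢.r hh
    exact ⟨⟨(g, h), e⟩, ⟨hg, hh⟩, rfl⟩
  have h2 : 𝒢.d₂ '' 𝒢.pairs A B = A := by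
    refine Subset.antisymm (by rintro _ ⟨p, hp, rfl⟩; exact hp.1) fun g hg => ?_
    obtain ⟨h, hh, e⟩ := hAB ▸ mem_image_of_mem 𝒢.s hg
    exact ⟨⟨(g, h), e.symm⟩, ⟨hg, hh⟩, rfl⟩
  rw [δ₂, AddMonoidHom.add_apply, AddMonoidHom.sub_apply,
    pushforward_charFun _ _ _ _ _ (injOn_d₀ hA.2) B hBc hBo h0,
    pushforward_charFun _ _ _ _ _ (injOn_d₂ hB.1) A hAc hAo h2,
    pushforward_charFun _ _ _ _ _ (injOn_r_d₁ hA.1 hB.1).of_comp C hCc hCo hC]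

theorem isOpen_range_unit [CompactSpace X] : IsOpen (range 𝒢.unit) := IsFullBisection.one.isOpen

/-- Units are idempotent, so for a clopen `S` the boundary of the pairs is `1 - 1 + 1` times the
indicator of `S`: sets of units have trivial class. -/
theorem image_d₁_pairs_units {S : Set X} :
    𝒢.d₁ '' 𝒢.pairs (𝒢.unit '' S) (𝒢.unit '' S) = 𝒢.unit '' S := by
  have key : ∀ x (e : 𝒢.s (𝒢.unit x) = 𝒢.r (𝒢.unit x)),
      𝒢.mul (𝒢.unit x) (𝒢.unit x) e = 𝒢.unit x := fun x e => by
    have := 𝒢.unit_mul (𝒢.unit x)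
    simp only [𝒢.r_unit] at this
    exact this
  ext g
  constructor
  · rintro ⟨⟨⟨_, _⟩, e⟩, ⟨⟨x, hx, rfl⟩, ⟨y, -, rfl⟩⟩, rfl⟩
    have e' : x = y := by simpa [𝒢.s_unit, 𝒢.r_unit] using e
    subst e'
    exact ⟨x, hx, (key x e).symm⟩
  · rintro ⟨x, hx, rfl⟩
    exact ⟨⟨(𝒢.unit x, 𝒢.unit x), by simp [𝒢.s_unit, 𝒢.r_unit]⟩, ⟨⟨x, hx, rfl⟩, ⟨x, hx, rfl⟩⟩,
      key x _⟩

theorem isGSet_unit_image (S : Set X) : 𝒢.IsGSet (𝒢.unit '' S) := by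
  constructor
  · rintro _ ⟨x, -, rfl⟩ _ ⟨y, -, rfl⟩ h
    rw [𝒢.r_unit, 𝒢.r_unit] at h
    rw [h]
  · rintro _ ⟨x, -, rfl⟩ _ ⟨y, -, rfl⟩ h
    rw [𝒢.s_unit, 𝒢.s_unit] at h
    rw [h]

theorem image_r_unit (S : Set X) : 𝒢.r '' (𝒢.unit '' S) = S := by
  simp [image_image, 𝒢.r_unit]

theorem image_s_unit (S : Set X) : 𝒢.s '' (𝒢.unit '' S) = S := by
  simp [image_image, 𝒢.s_unit]

theorem preimage_inv_eq_image (V : Set G) : 𝒢.inv ⁻¹' V = 𝒢.inv '' V := by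
  ext g
  exact ⟨fun h => ⟨_, h, 𝒢.inv_inv g⟩, by rintro ⟨k, hk, rfl⟩; simpa [𝒢.inv_inv] using hk⟩

theorem image_r_inv (V : Set G) : 𝒢.r '' (𝒢.inv ⁻¹' V) = 𝒢.s '' V := by
  simp [preimage_inv_eq_image, image_image, 𝒢.r_inv]

theorem image_s_inv (V : Set G) : 𝒢.s '' (𝒢.inv ⁻¹' V) = 𝒢.r '' V := by
  simp [preimage_inv_eq_image, image_image, 𝒢.s_inv]

theorem IsGSet.inv {V : Set G} (hV : 𝒢.IsGSet V) : 𝒢.IsGSet (𝒢.inv ⁻¹' V) := by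
  have key : ∀ {f f' : G → X} (_ : ∀ g, f (𝒢.inv g) = f' g), InjOn f V →
      InjOn f' (𝒢.inv ⁻¹' V) := fun {f f'} hff h a ha b hb e => by
    have := h ha hb (by rw [hff, hff, e])
    rw [← 𝒢.inv_inv a, this, 𝒢.inv_inv]
  exact ⟨key 𝒢.s_inv hV.2, key 𝒢.r_inv hV.1⟩

theorem image_d₁_pairs_inv {V : Set G} (hV : 𝒢.IsGSet V) :
    𝒢.d₁ '' 𝒢.pairs V (𝒢.inv ⁻¹' V) = 𝒢.unit '' (𝒢.r '' V) := by
  have key : ∀ g k (e : 𝒢.s g = 𝒢.r k), k = 𝒢.inv g → 𝒢.mul g k e = 𝒢.unit (𝒢.r g) := by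
    rintro g _ e rfl
    exact 𝒢.mul_inv g
  ext k
  constructor
  · rintro ⟨⟨⟨g, h⟩, e⟩, ⟨hg, hh⟩, rfl⟩
    have hgh : g = 𝒢.inv h := hV.2 hg hh (e.trans (𝒢.s_inv h).symm)
    exact ⟨𝒢.r g, ⟨g, hg, rfl⟩, (key g h e (by rw [hgh, 𝒢.inv_inv])).symm⟩
  · rintro ⟨_, ⟨g, hg, rfl⟩, rfl⟩
    exact ⟨⟨(g, 𝒢.inv g), (𝒢.r_inv g).symm⟩, ⟨hg, by simpa [𝒢.inv_inv] using hg⟩, 𝒢.mul_inv g⟩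

theorem IsGSet.union {A B : Set G} (hA : 𝒢.IsGSet A) (hB : 𝒢.IsGSet B)
    (hr : Disjoint (𝒢.r '' A) (𝒢.r '' B)) (hs : Disjoint (𝒢.s '' A) (𝒢.s '' B)) :
    𝒢.IsGSet (A ∪ B) := by
  have key : ∀ {f : G → X}, InjOn f A → InjOn f B → Disjoint (f '' A) (f '' B) →
      InjOn f (A ∪ B) := fun {f} ha hb h =>
    (injOn_union (disjoint_left.2 fun g h1 h2 =>
      disjoint_left.1 h ⟨g, h1, rfl⟩ ⟨g, h2, rfl⟩)).2 ⟨ha, hb, fun a h1 b h2 e =>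
        disjoint_left.1 h ⟨a, h1, rfl⟩ ⟨b, h2, e.symm⟩⟩
  exact ⟨key hA.1 hB.1 hr, key hA.2 hB.2 hs⟩

/-- The bisection that exchanges the range and the source of `V` and fixes all other units. -/
def swapSet (V : Set G) : Set G :=
  (V ∪ 𝒢.inv ⁻¹' V) ∪ 𝒢.unit '' (𝒢.r '' V ∪ 𝒢.s '' V)ᶜ

theorem isClopen_image_r {V : Set G} (hc : IsCompact V) (ho : IsOpen V) : IsClopen (𝒢.r '' V) :=
  have := 𝒢.t2Space_units
  ⟨(hc.image 𝒢.isLocalHomeomorph_r.continuous).isClosed, 𝒢.isLocalHomeomorph_r.isOpenMap _ ho⟩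

theorem isClopen_image_s {V : Set G} (hc : IsCompact V) (ho : IsOpen V) : IsClopen (𝒢.s '' V) :=
  have := 𝒢.t2Space_units
  ⟨(hc.image 𝒢.isLocalHomeomorph_s.continuous).isClosed, 𝒢.isLocalHomeomorph_s.isOpenMap _ ho⟩

section Swap

variable [CompactSpace X] {V : Set G}

theorem isCompact_isOpen_unit_image {S : Set X} (hS : IsClopen S) :
    IsCompact (𝒢.unit '' S) ∧ IsOpen (𝒢.unit '' S) := by
  refine ⟨hS.isClosed.isCompact.image 𝒢.continuous_unit, ?_⟩
  have : 𝒢.unit '' S = range 𝒢.unit ∩ 𝒢.r ⁻¹' S := by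
    ext g
    constructor
    · rintro ⟨x, hx, rfl⟩
      exact ⟨⟨x, rfl⟩, by simpa [𝒢.r_unit] using hx⟩
    · rintro ⟨⟨x, rfl⟩, hx⟩
      exact ⟨x, by simpa [𝒢.r_unit] using hx, rfl⟩
  rw [this]
  exact isOpen_range_unit.inter (hS.isOpen.preimage 𝒢.isLocalHomeomorph_r.continuous)

theorem isFullBisection_swapSet (hc : IsCompact V) (ho : IsOpen V) (hV : 𝒢.IsGSet V)
    (hd : Disjoint (𝒢.r '' V) (𝒢.s '' V)) : 𝒢.IsFullBisection (𝒢.swapSet V) := by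
  obtain ⟨hWc, hWo⟩ := isCompact_isOpen_unit_image (𝒢 := 𝒢)
    ((isClopen_image_r (𝒢 := 𝒢) hc ho).union (isClopen_image_s hc ho)).compl
  have hio : IsOpen (𝒢.inv ⁻¹' V) := ho.preimage 𝒢.continuous_inv
  have hr : 𝒢.r '' (V ∪ 𝒢.inv ⁻¹' V) = 𝒢.r '' V ∪ 𝒢.s '' V := by rw [image_union, image_r_inv]
  have hs : 𝒢.s '' (V ∪ 𝒢.inv ⁻¹' V) = 𝒢.r '' V ∪ 𝒢.s '' V := by
    rw [image_union, image_s_inv, union_comm]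
  refine ⟨(hc.union ?_).union hWc, (ho.union hio).union hWo,
    (hV.union hV.inv ?_ ?_).union (isGSet_unit_image _) ?_ ?_, ?_, ?_⟩
  · rw [preimage_inv_eq_image]
    exact hc.image 𝒢.continuous_inv
  · rwa [image_r_inv]
  · rw [image_s_inv]
    exact hd.symm
  · rw [hr, image_r_unit]
    exact disjoint_compl_right
  · rw [hs, image_s_unit]
    exact disjoint_compl_right
  · rw [swapSet, image_union, hr, image_r_unit, union_compl_self]
  · rw [swapSet, image_union, hs, image_s_unit, union_compl_self]

/-- Adding three boundaries, `1_{V⁻¹} - 1_{r(V)} + 1_V` from the pairs in `V × V⁻¹`, `1_{r(V)}` from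
units, and the indicator of the fixed units, gives the indicator of `swapSet V`. -/
theorem homologyClass_swapSet (hc : IsCompact V) (ho : IsOpen V) (hV : 𝒢.IsGSet V)
    (hd : Disjoint (𝒢.r '' V) (𝒢.s '' V)) :
    (isFullBisection_swapSet hc ho hV hd).homologyClass = 0 := by
  have := 𝒢.t2Space
  have hR := isClopen_image_r (𝒢 := 𝒢) hc ho
  obtain ⟨hWc, hWo⟩ := isCompact_isOpen_unit_image (𝒢 := 𝒢)
    (hR.union (isClopen_image_s hc ho)).compl
  obtain ⟨hZc, hZo⟩ := isCompact_isOpen_unit_image (𝒢 := 𝒢) hR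
  have hio : IsOpen (𝒢.inv ⁻¹' V) := ho.preimage 𝒢.continuous_inv
  have hic : IsCompact (𝒢.inv ⁻¹' V) := by
    rw [preimage_inv_eq_image]
    exact hc.image 𝒢.continuous_inv
  have e1 := δ₂_charFun_pairs hc ho hic hio hZc hZo hV hV.inv (image_r_inv V).symm
    (image_d₁_pairs_inv hV)
  have e2 := δ₂_charFun_pairs hZc hZo hZc hZo hZc hZo (isGSet_unit_image (𝒢 := 𝒢) _)
    (isGSet_unit_image _) (by rw [image_r_unit, image_s_unit]) image_d₁_pairs_units
  have e3 := δ₂_charFun_pairs hWc hWo hWc hWo hWc hWo (isGSet_unit_image (𝒢 := 𝒢) _)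
    (isGSet_unit_image _) (by rw [image_r_unit, image_s_unit]) image_d₁_pairs_units
  unfold IsFullBisection.homologyClass
  rw [QuotientAddGroup.eq_zero_iff, AddSubgroup.mem_addSubgroupOf]
  refine ⟨_ + _ + _, (map_add _ _ _).trans (congrArg₂ _ ((map_add _ _ _).trans
    (congrArg₂ _ e1 e2)) e3) |>.trans ?_⟩
  have d1 : Disjoint V (𝒢.inv ⁻¹' V) := disjoint_left.2 fun g h1 h2 =>
    disjoint_left.1 hd ⟨g, h1, rfl⟩ ⟨_, h2, 𝒢.s_inv g⟩
  have d2 : Disjoint (V ∪ 𝒢.inv ⁻¹' V) (𝒢.unit '' (𝒢.r '' V ∪ 𝒢.s '' V)ᶜ) := by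
    refine disjoint_left.2 ?_
    rintro _ h ⟨x, hx, rfl⟩
    rcases h with h | h
    · exact hx (Or.inl ⟨_, h, 𝒢.r_unit x⟩)
    · exact hx (Or.inr ⟨_, h, (𝒢.s_inv _).trans (𝒢.r_unit x)⟩)
  ext g
  have hg : (𝒢.swapSet V).indicator (1 : G → ℤ) g = V.indicator 1 g + (𝒢.inv ⁻¹' V).indicator 1 g
      + (𝒢.unit '' (𝒢.r '' V ∪ 𝒢.s '' V)ᶜ).indicator 1 g := by
    rw [swapSet, indicator_union_of_disjoint d2, indicator_union_of_disjoint d1]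
  change (_ - _ + _) + (_ - _ + _) + (_ - _ + _) = (𝒢.swapSet V).indicator (1 : G → ℤ) g
  rw [hg]
  simp only [charFun, CompactlySupportedContinuousMap.coe_mk, ContinuousMap.coe_mk]
  ring

/-- A compact open `G`-set whose range and source are disjoint gives a transposition. -/
theorem exists_swap (hc : IsCompact V) (ho : IsOpen V) (hV : 𝒢.IsGSet V)
    (hd : Disjoint (𝒢.r '' V) (𝒢.s '' V)) :
    ∃ τ : 𝒢.topologicalFullGroup, τ ∈ 𝒢.indexKernel ∧ IsTransposition τ ∧
      (∀ g ∈ V, τ.1 (𝒢.s g) = 𝒢.r g) ∧ (∀ g ∈ V, τ.1 (𝒢.r g) = 𝒢.s g) ∧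
      ∀ x, x ∉ 𝒢.r '' V → x ∉ 𝒢.s '' V → τ.1 x = x := by
  have hU := isFullBisection_swapSet hc ho hV hd
  obtain ⟨τ, hτ⟩ := hU.exists_represents
  have h1 : ∀ g ∈ V, τ (𝒢.s g) = 𝒢.r g := fun g hg => hτ.2 g (Or.inl (Or.inl hg))
  have h2 : ∀ g ∈ V, τ (𝒢.r g) = 𝒢.s g := fun g hg => by
    have := hτ.2 (𝒢.inv g) (Or.inl (Or.inr (by simpa [𝒢.inv_inv] using hg)))
    rwa [𝒢.s_inv, 𝒢.r_inv] at this
  have h3 : ∀ x, x ∉ 𝒢.r '' V → x ∉ 𝒢.s '' V → τ x = x := fun x hr hs => by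
    have := hτ.2 (𝒢.unit x) (Or.inr ⟨x, fun h => h.elim hr hs, rfl⟩)
    rwa [𝒢.s_unit, 𝒢.r_unit] at this
  have himg : τ '' (𝒢.s '' V) = 𝒢.r '' V := by
    rw [image_image]
    exact image_congr h1
  refine ⟨⟨τ, _, hτ⟩, ⟨_, hτ, homologyClass_swapSet hc ho hV hd⟩, ⟨𝒢.s '' V,
    isClopen_image_s hc ho, ?_, ?_, ?_⟩, h1, h2, h3⟩
  · change 𝒢.s '' V ∩ τ '' (𝒢.s '' V) = ∅
    rw [himg]
    exact hd.symm.inter_eq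
  · change closure {x | τ x ≠ x} = 𝒢.s '' V ∪ τ '' (𝒢.s '' V)
    rw [himg]
    have : {x | τ x ≠ x} = 𝒢.s '' V ∪ 𝒢.r '' V := by
      ext x
      constructor
      · intro hx
        by_contra h
        exact hx (h3 x (fun h' => h (Or.inr h')) fun h' => h (Or.inl h'))
      · rintro (⟨g, hg, rfl⟩ | ⟨g, hg, rfl⟩) e
        · rw [h1 g hg] at e
          exact disjoint_left.1 hd ⟨g, hg, rfl⟩ ⟨g, hg, e.symm⟩
        · rw [h2 g hg] at e
          exact disjoint_left.1 hd ⟨g, hg, rfl⟩ ⟨g, hg, e⟩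
    rw [this]
    exact ((isClopen_image_s hc ho).union (isClopen_image_r hc ho)).isClosed.closure_eq
  · refine Subtype.ext (Homeomorph.ext fun x => ?_)
    rw [sq]
    change τ (τ x) = x
    by_cases hs : x ∈ 𝒢.s '' V
    · obtain ⟨g, hg, rfl⟩ := hs
      rw [h1 g hg, h2 g hg]
    by_cases hr : x ∈ 𝒢.r '' V
    · obtain ⟨g, hg, rfl⟩ := hr
      rw [h2 g hg, h1 g hg]
    rw [h3 x hr hs, h3 x hr hs]

end Swap

end EtaleGroupoid

/-! ### Prefix replacements and swaps of words. -/

namespace EdgeGraph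

section Swaps

variable {V E : Type*} {Γ : EdgeGraph V E} {Y : Clopens Γ.PathSpace}

/-- The homeomorphism `α` replaces the prefix `μ` by the prefix `ν`. -/
def Acts (α : Y ≃ₜ Y) (μ ν : List E) : Prop :=
  ∀ x : Y, x.1 ∈ Γ.cyl μ → (α x).1 ∈ Γ.cyl ν ∧ Γ.shift^[ν.length] (α x).1 = Γ.shift^[μ.length] x.1

/-- The homeomorphism `τ` exchanges the prefixes `μ` and `ν`, and fixes all other paths. -/
structure IsSwap (τ : Y ≃ₜ Y) (μ ν : List E) : Prop where
  left : Acts τ μ ν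
  right : Acts τ ν μ
  fix : ∀ x : Y, x.1 ∉ Γ.cyl μ → x.1 ∉ Γ.cyl ν → τ x = x

/-- A word of length at least `k` whose cylinder set is non-empty and contained in `Y`. -/
structure Adm (Y : Clopens Γ.PathSpace) (k : ℕ) (μ : List E) : Prop where
  le : k ≤ μ.length
  nonempty : (Γ.cyl μ).Nonempty
  subset : Γ.cyl μ ⊆ Y

/-- Two words that can be exchanged. -/
structure IsPair (Y : Clopens Γ.PathSpace) (k : ℕ) (μ ν : List E) : Prop where
  left : Adm Y k μ
  right : Adm Y k ν
  ty_eq : Γ.ty μ = Γ.ty ν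
  disjoint : Disjoint (Γ.cyl μ) (Γ.cyl ν)

theorem Adm.append {k : ℕ} {μ κ : List E} (h : Adm Y k μ) (hne : (Γ.cyl (μ ++ κ)).Nonempty) :
    Adm Y k (μ ++ κ) :=
  ⟨h.le.trans (by simp), hne, (cyl_append_subset _ _).trans h.subset⟩

theorem Adm.mono {k l : ℕ} {μ : List E} (h : Adm Y k μ) (hl : l ≤ k) : Adm Y l μ :=
  ⟨hl.trans h.le, h.nonempty, h.subset⟩

theorem IsPair.symm {k : ℕ} {μ ν : List E} (h : IsPair Y k μ ν) : IsPair Y k ν μ :=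
  ⟨h.right, h.left, h.ty_eq.symm, h.disjoint.symm⟩

theorem IsSwap.symm {τ : Y ≃ₜ Y} {μ ν : List E} (h : IsSwap τ μ ν) : IsSwap τ ν μ :=
  ⟨h.right, h.left, fun x h1 h2 => h.fix x h2 h1⟩

theorem Acts.eq {α β : Y ≃ₜ Y} {μ ν : List E} (hα : Acts α μ ν) (hβ : Acts β μ ν) {x : Y}
    (hx : x.1 ∈ Γ.cyl μ) : α x = β x :=
  Subtype.ext (eq_of_mem_cyl (hα x hx).1 (hβ x hx).1 ((hα x hx).2.trans (hβ x hx).2.symm))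

/-- Makes the swap a function of the two words, so that finitely many words give finitely many
swaps. -/
theorem IsSwap.unique {τ τ' : Y ≃ₜ Y} {μ ν : List E} (h : IsSwap τ μ ν) (h' : IsSwap τ' μ ν) :
    τ = τ' := by
  refine Homeomorph.ext fun x => ?_
  by_cases h1 : x.1 ∈ Γ.cyl μ
  · exact h.left.eq h'.left h1
  by_cases h2 : x.1 ∈ Γ.cyl ν
  · exact h.right.eq h'.right h2
  rw [h.fix x h1 h2, h'.fix x h1 h2]

theorem acts_one (μ : List E) : Acts (1 : Y ≃ₜ Y) μ μ := fun _ hx => ⟨hx, rfl⟩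

theorem Acts.mul {α β : Y ≃ₜ Y} {μ ν ρ : List E} (hβ : Acts β ν ρ) (hα : Acts α μ ν) :
    Acts (β * α) μ ρ := fun x hx =>
  ⟨(hβ _ (hα x hx).1).1, (hβ _ (hα x hx).1).2.trans (hα x hx).2⟩

theorem Acts.append {α : Y ≃ₜ Y} {μ ν : List E} (h : Acts α μ ν) (κ : List E) :
    Acts α (μ ++ κ) (ν ++ κ) := by
  intro x hx
  obtain ⟨hx1, hx2⟩ := mem_cyl_append.1 hx
  obtain ⟨h1, h2⟩ := h x hx1
  refine ⟨mem_cyl_append.2 ⟨h1, h2 ▸ hx2⟩, ?_⟩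
  rw [List.length_append, List.length_append, add_comm, add_comm μ.length,
    Function.iterate_add_apply, h2, ← Function.iterate_add_apply]

/-- The image of the cylinder of `μ` is the whole cylinder of `ν`. -/
theorem Acts.mem_of_apply_mem {α : Y ≃ₜ Y} {μ ν : List E} (h : Acts α μ ν) (hμ : Adm Y 1 μ)
    (hν : 1 ≤ ν.length) (ht : Γ.ty μ = Γ.ty ν) {x : Y} (hx : (α x).1 ∈ Γ.cyl ν) :
    x.1 ∈ Γ.cyl μ := by
  obtain ⟨z, hz, hzs⟩ := exists_graft_of_ty_eq hx hν hμ.nonempty hμ.le ht.symm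
  have hzα := h ⟨z, hμ.subset hz⟩ hz
  have : α ⟨z, hμ.subset hz⟩ = α x :=
    Subtype.ext (eq_of_mem_cyl hzα.1 hx (hzα.2.trans hzs))
  rw [← α.injective this]
  exact hz

theorem IsSwap.acts_of_disjoint {τ : Y ≃ₜ Y} {μ ν ρ : List E} (h : IsSwap τ μ ν)
    (h1 : Disjoint (Γ.cyl ρ) (Γ.cyl μ)) (h2 : Disjoint (Γ.cyl ρ) (Γ.cyl ν)) : Acts τ ρ ρ := by
  intro x hx
  rw [h.fix x (disjoint_left.1 h1 hx) (disjoint_left.1 h2 hx)]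
  exact ⟨hx, rfl⟩

/-- Both `g * τ` and `τ' * g` replace `a` by `d` and `b` by `c`. Elsewhere `τ` is trivial, and so is
`τ'` after `g`: since types agree, `g` carries `a` and `b` onto the whole cylinders of `c` and `d`,
so no other point enters them. -/
theorem IsSwap.conj {g τ τ' : Y ≃ₜ Y} {a b c d : List E} (hτ : IsSwap τ a b)
    (hτ' : IsSwap τ' c d) (hab : IsPair Y 1 a b) (hcd : IsPair Y 1 c d) (hac : Acts g a c)
    (hbd : Acts g b d) (h1 : Γ.ty a = Γ.ty c) : τ = g⁻¹ * τ' * g := by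
  have h2 : Γ.ty b = Γ.ty d := hab.ty_eq.symm.trans (h1.trans hcd.ty_eq)
  have key : g * τ = τ' * g := by
    refine Homeomorph.ext fun x => ?_
    by_cases hxa : x.1 ∈ Γ.cyl a
    · exact (hbd.mul hτ.left).eq (hτ'.left.mul hac) hxa
    by_cases hxb : x.1 ∈ Γ.cyl b
    · exact (hac.mul hτ.right).eq (hτ'.right.mul hbd) hxb
    change g (τ x) = τ' (g x)
    rw [hτ.fix x hxa hxb, hτ'.fix]
    · exact fun h => hxa (hac.mem_of_apply_mem hab.left hcd.left.le h1 h)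
    · exact fun h => hxb (hbd.mem_of_apply_mem hab.right hcd.right.le h2 h)
  rw [mul_assoc, ← key, inv_mul_cancel_left]

/-- The swap of two disjoint words of the same type. -/
theorem IsPair.exists_isSwap [Finite E] {μ ν : List E} (h : IsPair Y 1 μ ν) :
    ∃ τ : (Γ.groupoid.reduction Y).topologicalFullGroup,
      τ ∈ (Γ.groupoid.reduction Y).indexKernel ∧ EtaleGroupoid.IsTransposition τ ∧
        IsSwap τ.1 μ ν := by
  set 𝒢 := Γ.groupoid.reduction Y with h𝒢
  -- The arrows from `νw` to `μw`; their lag is the difference of the word lengths.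
  let B : Set (Γ.groupoid.ReductionArrow Y) :=
    {g | g.1 ∈ basicSet (Γ.cyl μ) (Γ.cyl ν) μ.length ν.length}
  have ho : IsOpen B := (Arrow.isOpen_basicSet (isOpen_cyl μ) (isOpen_cyl ν) _ _).preimage
    continuous_subtype_val
  have hB : 𝒢.IsGSet B := by
    constructor
    · rintro a ⟨a1, a2, a3, a4⟩ b ⟨b1, b2, b3, b4⟩ e
      have e' : a.1.x = b.1.x := congrArg Subtype.val e
      exact Subtype.ext (Arrow.ext e' (a1.trans b1.symm)
        (eq_of_mem_cyl a3 b3 (a4.symm.trans ((congrArg _ e').trans b4))))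
    · rintro a ⟨a1, a2, a3, a4⟩ b ⟨b1, b2, b3, b4⟩ e
      have e' : a.1.y = b.1.y := congrArg Subtype.val e
      exact Subtype.ext (Arrow.ext
        (eq_of_mem_cyl a2 b2 (a4.trans ((congrArg _ e').trans b4.symm))) (a1.trans b1.symm) e')
  have hr : ∀ x : Y, x.1 ∈ Γ.cyl μ → ∃ g ∈ B, 𝒢.r g = x := by
    intro x hx
    obtain ⟨z, hz, hzs⟩ := exists_graft_of_ty_eq hx h.left.le h.right.nonempty h.right.le h.ty_eq
    exact ⟨⟨⟨x.1, μ.length - ν.length, z, _, _, rfl, hzs.symm⟩, x.2, h.right.subset hz⟩,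
      ⟨rfl, hx, hz, hzs.symm⟩, rfl⟩
  have hs : ∀ x : Y, x.1 ∈ Γ.cyl ν → ∃ g ∈ B, 𝒢.s g = x := by
    intro x hx
    obtain ⟨z, hz, hzs⟩ := exists_graft_of_ty_eq hx h.right.le h.left.nonempty h.left.le
      h.ty_eq.symm
    exact ⟨⟨⟨z, μ.length - ν.length, x.1, _, _, rfl, hzs⟩, h.left.subset hz, x.2⟩,
      ⟨rfl, hz, hx, hzs⟩, rfl⟩
  have hd : Disjoint (𝒢.r '' B) (𝒢.s '' B) := by
    refine disjoint_left.2 ?_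
    rintro _ ⟨a, ha, rfl⟩ ⟨b, hb, e⟩
    have e' : b.1.y = a.1.x := congrArg Subtype.val e
    exact disjoint_left.1 h.disjoint ha.2.1 (e' ▸ hb.2.2.1)
  have hsB : 𝒢.s '' B = Subtype.val ⁻¹' Γ.cyl ν :=
    Subset.antisymm (by rintro _ ⟨g, hg, rfl⟩; exact hg.2.2.1) fun x hx => hs x hx
  have hc : IsCompact B := by
    -- `s` maps `B` injectively onto the cylinder of `ν`, which is compact, and is a local
    -- homeomorphism; so compactness pulls back.
    refine isCompact_of_isCompact_image 𝒢.isLocalHomeomorph_s ho hB.2 ?_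
    rw [hsB]
    exact ((isClopen_cyl ν).isClosed.preimage continuous_subtype_val).isCompact
  obtain ⟨τ, h1, h2, h3, h4, h5⟩ := EtaleGroupoid.exists_swap hc ho hB hd
  refine ⟨τ, h1, h2, ?_, ?_, ?_⟩
  · intro x hx
    obtain ⟨g, hg, rfl⟩ := hr x hx
    rw [h4 g hg]
    exact ⟨hg.2.2.1, hg.2.2.2.symm⟩
  · intro x hx
    obtain ⟨g, hg, rfl⟩ := hs x hx
    rw [h3 g hg]
    exact ⟨hg.2.1, hg.2.2.2⟩
  · intro x hx1 hx2
    refine h5 x ?_ ?_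
    · rintro ⟨g, hg, rfl⟩
      exact hx1 hg.2.1
    · rintro ⟨g, hg, rfl⟩
      exact hx2 hg.2.2.1

end Swaps

end EdgeGraph

/-! ### Consequences of irreducibility: branching, and detours around given words. -/

namespace EdgeGraph

section Connectedness

variable {V E : Type*} {Γ : EdgeGraph V E}

/-- Any two vertices are joined by a path of positive length. -/
def StronglyConnected (Γ : EdgeGraph V E) : Prop :=
  ∀ u v, Relation.TransGen (fun a b => ∃ e, Γ.i e = a ∧ Γ.t e = b) u v

theorem stronglyConnected_of_isIrreducible (h : Γ.adjMatrix.IsIrreducible) :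
    Γ.StronglyConnected := by
  intro u v
  let _ : Quiver V := Matrix.toQuiver Γ.adjMatrix
  have hstep : ∀ {a b : V}, (a ⟶ b) → ∃ e, Γ.i e = a ∧ Γ.t e = b := by
    rintro a b ⟨hab⟩
    have hab' : (0 : ℤ) < Nat.card {e : E // Γ.i e = a ∧ Γ.t e = b} := hab
    obtain ⟨⟨e, he⟩⟩ := (Nat.card_pos_iff.1 (by exact_mod_cast hab')).1
    exact ⟨e, he⟩
  have key : ∀ {w : V} (p : Quiver.Path u w), 0 < p.length →
      Relation.TransGen (fun a b => ∃ e, Γ.i e = a ∧ Γ.t e = b) u w := by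
    intro w p
    induction p with
    | nil => exact fun h => absurd h (lt_irrefl 0)
    | cons p f ih =>
      intro _
      cases p with
      | nil => exact .single (hstep f)
      | cons p' f' => exact .tail (ih (Nat.succ_pos _)) (hstep f)
  obtain ⟨p, hp⟩ := h.connected u v
  exact key p hp

/-- Without branching `i` is injective. Strong connectedness makes `i` and `t` surjective, so by
finiteness both are bijections and the adjacency matrix is that of the permutation `t ∘ i⁻¹`. -/
theorem StronglyConnected.exists_ne_of_ne_permMatrix [Finite V] [DecidableEq V] [Finite E]
    (h : Γ.StronglyConnected) (hperm : ∀ p : Equiv.Perm V, Γ.adjMatrix ≠ p.permMatrix ℤ) :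
    ∃ e f, e ≠ f ∧ Γ.i e = Γ.i f := by
  by_contra! hne
  have hi : Function.Injective Γ.i := fun e f hef => by_contra fun hn => hne e f hn hef
  have hi' : Function.Surjective Γ.i := fun u => by
    obtain ⟨_, ⟨e, he, -⟩, -⟩ := Relation.TransGen.head'_iff.1 (h u u)
    exact ⟨e, he⟩
  have ht' : Function.Surjective Γ.t := fun u => by
    obtain ⟨_, -, ⟨e, -, he⟩⟩ := Relation.TransGen.tail'_iff.1 (h u u)
    exact ⟨e, he⟩
  let ei := Equiv.ofBijective Γ.i ⟨hi, hi'⟩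
  have ht : Function.Injective Γ.t := by
    have : Function.Injective (Γ.t ∘ ei.symm) :=
      Finite.injective_iff_surjective.2 (ht'.comp ei.symm.surjective)
    intro e f hef
    have h' := @this (ei e) (ei f) (by simpa using hef)
    exact ei.injective h'
  let p : Equiv.Perm V := ei.symm.trans (Equiv.ofBijective Γ.t ⟨ht, ht'⟩)
  refine hperm p (Matrix.ext fun ξ η => ?_)
  have hp : ∀ e, p (Γ.i e) = Γ.t e := fun e =>
    congrArg Γ.t (ei.symm_apply_apply e)
  rw [Equiv.Perm.permMatrix, PEquiv.toMatrix_apply, adjMatrix]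
  obtain ⟨e, rfl⟩ := hi' ξ
  simp only [Equiv.toPEquiv_apply, Option.mem_def, Option.some.injEq, hp]
  split_ifs with he
  · have : Unique {e' // Γ.i e' = Γ.i e ∧ Γ.t e' = η} :=
      ⟨⟨⟨e, rfl, he⟩⟩, fun e' => Subtype.ext (hi e'.2.1)⟩
    simp
  · have : IsEmpty {e' // Γ.i e' = Γ.i e ∧ Γ.t e' = η} :=
      ⟨fun e' => he (by rw [← hi e'.2.1]; exact e'.2.2)⟩
    simp

/-- The path `e x`. -/
def consPath (e : E) (x : Γ.PathSpace) (h : Γ.t e = Γ.i (x.1 0)) : Γ.PathSpace :=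
  ⟨fun k => Nat.casesOn k e x.1, fun k => by
    cases k with
    | zero => exact h
    | succ k => exact x.2 k⟩

theorem shift_consPath (e : E) (x : Γ.PathSpace) (h : Γ.t e = Γ.i (x.1 0)) :
    Γ.shift (consPath e x h) = x := rfl

theorem StronglyConnected.exists_path (h : Γ.StronglyConnected) (v : V) :
    ∃ x : Γ.PathSpace, Γ.i (x.1 0) = v := by
  have hi : ∀ u, ∃ e, Γ.i e = u := fun u => by
    obtain ⟨_, ⟨e, he, -⟩, -⟩ := Relation.TransGen.head'_iff.1 (h u u)
    exact ⟨e, he⟩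
  choose f hf using hi
  refine ⟨⟨fun k => (fun e => f (Γ.t e))^[k] (f v), fun k => ?_⟩, hf v⟩
  dsimp only
  rw [Function.iterate_succ_apply', hf]

theorem exists_path_of_transGen {u v : V}
    (h : Relation.TransGen (fun a b => ∃ e, Γ.i e = a ∧ Γ.t e = b) u v)
    (y : Γ.PathSpace) (hy : Γ.i (y.1 0) = v) :
    ∃ x : Γ.PathSpace, ∃ m ≥ 1, Γ.i (x.1 0) = u ∧ Γ.shift^[m] x = y := by
  induction h using Relation.TransGen.head_induction_on with
  | single h =>
    obtain ⟨e, he, het⟩ := h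
    exact ⟨consPath e y (het.trans hy.symm), 1, le_rfl, he, rfl⟩
  | head h _ ih =>
    obtain ⟨e, he, het⟩ := h
    obtain ⟨x, m, hm, hx, hxy⟩ := ih
    exact ⟨consPath e x (het.trans hx.symm), m + 1, by omega, he, by
      rwa [Function.iterate_succ_apply, shift_consPath]⟩

/-- Follow the prefix of `x`, then a connecting path of positive length to `v`, then any path from
`v`. -/
theorem StronglyConnected.exists_visit (h : Γ.StronglyConnected) (x : Γ.PathSpace) {n : ℕ}
    (hn : 1 ≤ n) (v : V) : ∃ z ∈ Γ.cyl (pre x n), ∃ m > n, Γ.i (z.1 m) = v := by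
  obtain ⟨y, hy⟩ := h.exists_path v
  obtain ⟨w, m, hm, hw, hwy⟩ := exists_path_of_transGen (h (Γ.i (x.1 n)) v) y hy
  obtain ⟨z, hz, hzs⟩ := exists_graft (x := w) (m := 0) (ν := pre x n) ⟨x, mem_cyl_pre x n⟩
    (by simpa using hn) (by rw [ty_eq (mem_cyl_pre x n) (by simpa using hn), length_pre, hw])
  refine ⟨z, hz, m + n, by omega, ?_⟩
  have h1 : Γ.shift^[m + n] z = y := by
    rw [Function.iterate_add_apply]
    rw [length_pre] at hzs
    rw [hzs]
    exact hwy
  rw [← hy, ← h1, shift_iterate_apply]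
  rfl

/-- There are no isolated paths: inside any cylinder a path can be led to the branching vertex and
continued there by either of two edges. -/
theorem StronglyConnected.exists_ne_of_isOpen (h : Γ.StronglyConnected)
    (hb : ∃ e f, e ≠ f ∧ Γ.i e = Γ.i f) {S : Set Γ.PathSpace} (hS : IsOpen S)
    (hne : S.Nonempty) : ∃ x ∈ S, ∃ y ∈ S, x ≠ y := by
  obtain ⟨e, f, hef, hi⟩ := hb
  obtain ⟨x, hx⟩ := hne
  obtain ⟨n, hn, hsub⟩ := exists_cyl_subset hS hx 1
  obtain ⟨z, hz, m, hm, hzm⟩ := h.exists_visit x hn (Γ.i e)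
  have hsub' : Γ.cyl (pre z m) ⊆ S := by
    obtain ⟨κ, hκ⟩ := exists_append_of_mem hz (mem_cyl_pre z m) (by simpa using hm.le)
    rw [hκ]
    exact (cyl_append_subset _ _).trans hsub
  have key : ∀ g, Γ.i g = Γ.i e → ∃ w ∈ S, w.1 m = g := by
    intro g hg
    obtain ⟨y, hy⟩ := h.exists_path (Γ.t g)
    obtain ⟨w, hw, hws⟩ := exists_graft (x := consPath g y hy.symm) (m := 0) (ν := pre z m)
      ⟨z, mem_cyl_pre z m⟩ (by simp; omega)
      (by rw [ty_eq (mem_cyl_pre z m) (by simp; omega), length_pre, hzm, ← hg]; rfl)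
    refine ⟨w, hsub' hw, ?_⟩
    have := congrArg (fun w : Γ.PathSpace => w.1 0) hws
    simp only [shift_iterate_apply, length_pre] at this
    exact this
  obtain ⟨w, hwS, hw⟩ := key e rfl
  obtain ⟨w', hwS', hw'⟩ := key f hi.symm
  exact ⟨w, hwS, w', hwS', fun hww => hef (by rw [← hw, ← hw', hww])⟩

theorem exists_pre_ne {x y : Γ.PathSpace} (h : x ≠ y) : ∃ n, ∀ m ≥ n, pre x m ≠ pre y m := by
  by_contra! hc
  refine h (Subtype.ext (funext fun j => ?_))
  obtain ⟨m, hm, he⟩ := hc (j + 1)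
  exact pre_eq_iff.1 he j (by omega)

/-- The cylinders of two long words do not cover `Y`. -/
theorem StronglyConnected.exists_notMem_cyl (h : Γ.StronglyConnected)
    (hb : ∃ e f, e ≠ f ∧ Γ.i e = Γ.i f) {S : Set Γ.PathSpace} (hS : IsOpen S)
    (hne : S.Nonempty) : ∃ k, ∀ n ≥ k, ∀ p q : List E, p.length = n → q.length = n →
      ∃ y ∈ S, y ∉ Γ.cyl p ∧ y ∉ Γ.cyl q := by
  obtain ⟨x, hx, y, hy, hxy⟩ := h.exists_ne_of_isOpen hb hS hne
  -- Splitting a neighbourhood of `x` once more gives three distinct points of `S`. Beyond the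
  -- lengths that separate them, each word of length `n` contains at most one, so two words miss one
  -- of them.
  obtain ⟨A, B, hA, -, hxA, hyB, hAB⟩ := t2_separation hxy
  obtain ⟨a, ha, b, hb, hab⟩ := h.exists_ne_of_isOpen hb (hA.inter hS) ⟨x, hxA, hx⟩
  have hay : a ≠ y := fun e => disjoint_left.1 hAB (e ▸ ha.1) hyB
  have hby : b ≠ y := fun e => disjoint_left.1 hAB (e ▸ hb.1) hyB
  obtain ⟨n1, h1⟩ := exists_pre_ne hab
  obtain ⟨n2, h2⟩ := exists_pre_ne hay
  obtain ⟨n3, h3⟩ := exists_pre_ne hby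
  refine ⟨n1 + n2 + n3, fun n hn p q hp hq => ?_⟩
  have h1 := h1 n (by omega)
  have h2 := h2 n (by omega)
  have h3 := h3 n (by omega)
  by_contra! hc
  have ca := hc a ha.2
  have cb := hc b hb.2
  have cy := hc y hy
  simp only [cyl, mem_ofPred_eq, hp, hq] at ca cb cy
  by_cases hap : pre a n = p
  · exact h3 ((cb fun e => h1 (hap.trans e.symm)).trans (cy fun e => h2 (hap.trans e.symm)).symm)
  by_cases hbp : pre b n = p
  · exact h2 ((ca hap).trans (cy fun e => h3 (hbp.trans e.symm)).symm)
  exact h1 ((ca hap).trans (cb hbp).symm)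

/-- All short words may be avoided by admissible words of arbitrary type and bounded length. -/
theorem StronglyConnected.exists_detour [Finite V] [Finite E] (h : Γ.StronglyConnected)
    (hb : ∃ e f, e ≠ f ∧ Γ.i e = Γ.i f) (Y : Clopens Γ.PathSpace)
    (hY : (Y : Set Γ.PathSpace).Nonempty) :
    ∃ k ≥ 1, (∀ x ∈ Y, ∀ n ≥ k, Γ.cyl (pre x n) ⊆ Y) ∧
      ∃ L, ∀ p q : List E, p.length = k → q.length = k → ∀ v, ∃ ρ : List E, ρ.length < L ∧
        Adm Y k ρ ∧ Γ.ty ρ = some v ∧ Disjoint (Γ.cyl ρ) (Γ.cyl p) ∧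
          Disjoint (Γ.cyl ρ) (Γ.cyl q) := by
  obtain ⟨k1, hk1⟩ := exists_level Y
  obtain ⟨k2, hk2⟩ := h.exists_notMem_cyl hb Y.isClopen.isOpen hY
  -- `k1` keeps cylinders of points of `Y` inside `Y`, `k2` keeps two cylinders from covering `Y`,
  -- and the summand `1` gives every word a type.
  set k := k1 + k2 + 1 with hk
  refine ⟨k, by omega, fun x hx n hn => hk1 x hx n (by omega), ?_⟩
  have key : ∀ a : ({p : List E | p.length = k} × {p : List E | p.length = k}) × V,
      ∃ ρ : List E, Adm Y k ρ ∧ Γ.ty ρ = some a.2 ∧ Disjoint (Γ.cyl ρ) (Γ.cyl a.1.1.1) ∧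
          Disjoint (Γ.cyl ρ) (Γ.cyl a.1.2.1) := by
    rintro ⟨⟨⟨p, hp⟩, ⟨q, hq⟩⟩, v⟩
    obtain ⟨y, hy, hyp, hyq⟩ := hk2 k (by omega) p q hp hq
    obtain ⟨z, hz, m, hm, hzm⟩ := h.exists_visit y (n := k) (by omega) v
    obtain ⟨κ, hκ⟩ := exists_append_of_mem hz (mem_cyl_pre z m) (by simpa using hm.le)
    have hsub : Γ.cyl (pre z m) ⊆ Γ.cyl (pre y k) := by
      rw [hκ]
      exact cyl_append_subset _ _
    have hd : ∀ r : List E, r.length = k → y ∉ Γ.cyl r →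
        Disjoint (Γ.cyl (pre z m)) (Γ.cyl r) := fun r hr hyr =>
      (disjoint_cyl_of_length (by simp [hr]) fun e : pre y k = r => hyr (e ▸ mem_cyl_pre y k)).mono_left hsub
    refine ⟨pre z m, ⟨by simpa using hm.le, ⟨z, mem_cyl_pre z m⟩,
      hsub.trans (hk1 y hy k (by omega))⟩, ?_, hd p hp hyp, hd q hq hyq⟩
    rw [ty_eq (mem_cyl_pre z m) (by simp; omega), length_pre, hzm]
  choose ρ hρ using key
  -- Only finitely many triples `(p, q, v)` occur, so the detours have a common length bound.
  have : Finite {p : List E | p.length = k} := List.finite_length_eq E k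
  obtain ⟨L, hL⟩ := Finite.exists_le fun a => (ρ a).length
  exact ⟨L + 1, fun p q hp hq v =>
    ⟨ρ ((⟨p, hp⟩, ⟨q, hq⟩), v), Nat.lt_succ_of_le (hL _), hρ ((⟨p, hp⟩, ⟨q, hq⟩), v)⟩⟩

end Connectedness

/-! ### Reduction to swaps of words of bounded length. -/

section Generation

variable {V E : Type*} [Finite E] {Γ : EdgeGraph V E} {Y : Clopens Γ.PathSpace}

/-- The subgroup `H` contains all swaps of words of length at least `k`. -/
def ContainsSwaps (H : Subgroup (Γ.groupoid.reduction Y).topologicalFullGroup) (k : ℕ) : Prop :=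
  ∀ μ ν, IsPair Y k μ ν → ∀ τ : (Γ.groupoid.reduction Y).topologicalFullGroup,
    IsSwap τ.1 μ ν → τ ∈ H

/-- Swaps of words of bounded length generate all swaps. -/
theorem containsSwaps_of_bounded {H : Subgroup (Γ.groupoid.reduction Y).topologicalFullGroup}
    {k L : ℕ} (hk : 1 ≤ k) (hlev : ∀ x ∈ Y, ∀ n ≥ k, Γ.cyl (pre x n) ⊆ Y)
    (hL : ∀ p q : List E, p.length = k → q.length = k → ∀ v, ∃ ρ : List E, ρ.length < L ∧
        Adm Y k ρ ∧ Γ.ty ρ = some v ∧ Disjoint (Γ.cyl ρ) (Γ.cyl p) ∧ Disjoint (Γ.cyl ρ) (Γ.cyl q))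
    (hH : ∀ μ ν, IsPair Y k μ ν → μ.length ≤ L → ν.length ≤ L →
      ∀ τ : (Γ.groupoid.reduction Y).topologicalFullGroup, IsSwap τ.1 μ ν → τ ∈ H) :
    ContainsSwaps H k := by
  have main : ∀ n, ∀ μ ν, μ.length + ν.length = n → IsPair Y k μ ν →
      ∀ τ : (Γ.groupoid.reduction Y).topologicalFullGroup, IsSwap τ.1 μ ν → τ ∈ H := by
    intro n
    induction n using Nat.strong_induction_on with
    | _ n ih =>
    have step : ∀ μ ν, μ.length + ν.length = n → IsPair Y k μ ν → L < μ.length →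
      ∀ τ : (Γ.groupoid.reduction Y).topologicalFullGroup, IsSwap τ.1 μ ν → τ ∈ H := by
      intro μ ν hn hp hLμ τ hτ
      have hmono : ∀ {a b}, IsPair Y k a b → IsPair Y 1 a b := fun h =>
        ⟨h.left.mono hk, h.right.mono hk, h.ty_eq, h.disjoint⟩
      obtain ⟨x, hx⟩ := hp.left.nonempty
      -- The detour has the type of the prefix of `μ` of length `L`, and avoids both `μ` and `ν`
      -- because it avoids their first `k` letters.
      obtain ⟨ρ', hρL, hρ', hty, hd1, hd2⟩ := hL (μ.take k) (ν.take k)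
        (by simpa using hp.left.le) (by simpa using hp.right.le) (Γ.i (x.1 L))
      have hkL : k ≤ L := hρ'.le.trans hρL.le
      obtain ⟨ρ, κ, hρl, rfl⟩ : ∃ ρ κ : List E, ρ.length = L ∧ μ = ρ ++ κ :=
        ⟨μ.take L, μ.drop L, by simpa using hLμ.le, (List.take_append_drop _ _).symm⟩
      have hxρ : x ∈ Γ.cyl ρ := (mem_cyl_append.1 hx).1
      have hρ : Adm Y k ρ := by
        refine ⟨by omega, ⟨x, hxρ⟩, ?_⟩
        rw [← show pre x ρ.length = ρ from hxρ]
        exact hlev x (hp.left.subset hx) _ (by omega)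
      have htρ : Γ.ty ρ = Γ.ty ρ' := by rw [ty_eq hxρ (by omega), hty, hρl]
      have hdρ : Disjoint (Γ.cyl ρ) (Γ.cyl ρ') := by
        rw [List.take_append_of_le_length (by omega)] at hd1
        refine (hd1.mono_right ?_).symm
        conv_lhs => rw [← List.take_append_drop k ρ]
        exact cyl_append_subset _ _
      have hdν : Disjoint (Γ.cyl ρ') (Γ.cyl ν) := by
        refine hd2.mono_right ?_
        conv_lhs => rw [← List.take_append_drop k ν]
        exact cyl_append_subset _ _
      have hpρ : IsPair Y k ρ ρ' := ⟨hρ, hρ', htρ, hdρ⟩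
      obtain ⟨g, -, -, hg⟩ := (hmono hpρ).exists_isSwap
      have hgH : g ∈ H := hH ρ ρ' hpρ hρl.le hρL.le g hg
      have hc : Adm Y k (ρ' ++ κ) := hρ'.append
        (cyl_append_nonempty (hk.trans hρ.le) hρ'.nonempty (hk.trans hρ'.le) htρ hp.left.nonempty)
      have htc : Γ.ty (ρ ++ κ) = Γ.ty (ρ' ++ κ) := ty_append_congr htρ κ
      -- `g` replaces `ρ` by the shorter `ρ'` in `μ`. It fixes `ν` if `ν` is disjoint from `ρ`, and
      -- shortens `ν` if `ν` extends `ρ`; `ρ` cannot extend `ν`, since then `μ` would too.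
      obtain ⟨d, hcd, hgd, hlen⟩ : ∃ d, IsPair Y k (ρ' ++ κ) d ∧ Acts g.1 ν d ∧
          d.length ≤ ν.length := by
        by_cases hνρ : Disjoint (Γ.cyl ν) (Γ.cyl ρ)
        · exact ⟨ν, ⟨hc, hp.right, htc.symm.trans hp.ty_eq,
            hdν.mono_left (cyl_append_subset _ _)⟩, hg.acts_of_disjoint hνρ hdν.symm, le_rfl⟩
        · obtain ⟨y, hyν, hyρ⟩ := not_disjoint_iff.1 hνρ
          rcases le_total ρ.length ν.length with hl | hl
          · obtain ⟨κ', rfl⟩ := exists_append_of_mem hyρ hyν hl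
            refine ⟨ρ' ++ κ', ⟨hc, hρ'.append (cyl_append_nonempty (hk.trans hρ.le) hρ'.nonempty
              (hk.trans hρ'.le) htρ hp.right.nonempty), ?_, ?_⟩, hg.left.append κ', ?_⟩
            · rw [← htc, hp.ty_eq, ty_append_congr htρ]
            · rw [disjoint_cyl_append_iff]
              intro z hz hz1 hz2
              obtain ⟨w, hw, hws⟩ := exists_graft_of_ty_eq hz (hk.trans hρ'.le) hρ.nonempty
                (hk.trans hρ.le) htρ.symm
              exact disjoint_cyl_append_iff.1 hp.disjoint w hw (hws ▸ hz1) (hws ▸ hz2)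
            · simp only [List.length_append]
              omega
          · obtain ⟨κ', rfl⟩ := exists_append_of_mem hyν hyρ hl
            exact absurd (cyl_append_subset _ _ hxρ) (disjoint_left.1 hp.disjoint hx)
      obtain ⟨τ', -, -, hτ'⟩ := (hmono hcd).exists_isSwap
      have hτ'H : τ' ∈ H := by
        refine ih _ ?_ _ _ rfl hcd τ' hτ'
        simp only [List.length_append] at hn ⊢
        omega
      have : τ = g⁻¹ * τ' * g :=
        Subtype.ext (hτ.conj hτ' (hmono hp) (hmono hcd) (hg.left.append κ) hgd htc)
      rw [this]
      exact H.mul_mem (H.mul_mem (H.inv_mem hgH) hτ'H) hgH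
    intro μ ν hn hp τ hτ
    by_cases h1 : L < μ.length
    · exact step μ ν hn hp h1 τ hτ
    by_cases h2 : L < ν.length
    · exact step ν μ (by omega) hp.symm h2 τ hτ.symm
    exact hH μ ν hp (by omega) (by omega) τ hτ
  exact fun μ ν => main _ μ ν rfl

end Generation

end EdgeGraph

/-! ### Partitions into cylinders and their splittings. -/

namespace EdgeGraph

section Partitions

variable {V E : Type*} {Γ : EdgeGraph V E} {Y : Clopens Γ.PathSpace} {k : ℕ}

/-- A partition of `Y` into cylinder sets of words of length at least `k`. -/
structure IsPart (Y : Clopens Γ.PathSpace) (k : ℕ) (P : Finset (List E)) : Prop where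
  adm : ∀ μ ∈ P, Adm Y k μ
  disjoint : ∀ μ ∈ P, ∀ ν ∈ P, μ ≠ ν → Disjoint (Γ.cyl μ) (Γ.cyl ν)
  cover : ∀ x ∈ Y, ∃ μ ∈ P, x ∈ Γ.cyl μ

theorem IsPart.eq_of_mem {P : Finset (List E)} (hP : IsPart Y k P) {μ ν : List E} (hμ : μ ∈ P)
    (hν : ν ∈ P) {x : Γ.PathSpace} (h1 : x ∈ Γ.cyl μ) (h2 : x ∈ Γ.cyl ν) : μ = ν :=
  by_contra fun h => disjoint_left.1 (hP.disjoint μ hμ ν hν h) h1 h2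

theorem IsPart.isPair {Q : Finset (List E)} (hQ : IsPart Y k Q) {a b : List E} (ha : a ∈ Q)
    (hb : b ∈ Q) (ht : Γ.ty a = Γ.ty b) (hne : a ≠ b) : IsPair Y k a b :=
  ⟨hQ.adm a ha, hQ.adm b hb, ht, hQ.disjoint a ha b hb hne⟩

/-- The homeomorphism `α` maps the words of `P` to words of `Q` of the same type. -/
def Maps (α : Y ≃ₜ Y) (P Q : Finset (List E)) : Prop :=
  ∀ μ ∈ P, ∃ ν ∈ Q, Γ.ty μ = Γ.ty ν ∧ Acts α μ ν

theorem Maps.mul {α β : Y ≃ₜ Y} {P Q R : Finset (List E)} (hβ : Maps β Q R) (hα : Maps α P Q) :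
    Maps (β * α) P R := by
  intro μ hμ
  obtain ⟨ν, hν, h1, h2⟩ := hα μ hμ
  obtain ⟨ρ, hρ, h3, h4⟩ := hβ ν hν
  exact ⟨ρ, hρ, h1.trans h3, h4.mul h2⟩

/-- Since `α` is onto, some word of `P` has image meeting the cylinder of `ν`; disjointness within
`Q` then identifies its target with `ν`. -/
theorem Maps.exists_of_mem {α : Y ≃ₜ Y} {P Q : Finset (List E)} (hα : Maps α P Q)
    (hP : IsPart Y k P) (hQ : IsPart Y k Q) {ν : List E} (hν : ν ∈ Q) :
    ∃ μ ∈ P, Γ.ty μ = Γ.ty ν ∧ Acts α μ ν := by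
  obtain ⟨x, hx⟩ := (hQ.adm ν hν).nonempty
  obtain ⟨y, hy⟩ := α.surjective ⟨x, (hQ.adm ν hν).subset hx⟩
  obtain ⟨μ, hμ, hyμ⟩ := hP.cover y y.2
  obtain ⟨ν', hν', h1, h2⟩ := hα μ hμ
  have : (α y).1 ∈ Γ.cyl ν := by rw [hy]; exact hx
  rw [hQ.eq_of_mem hν hν' this (h2 y hyμ).1]
  exact ⟨μ, hμ, h1, h2⟩

/-- Equality of types makes `f μ` the exact image of the cylinder of `μ`, so overlapping images come
from overlapping words of `P`. -/
theorem injOn_of_acts {α : Y ≃ₜ Y} {P : Finset (List E)} (hP : IsPart Y k P) (hk : 1 ≤ k)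
    {f : List E → List E} (hf : ∀ μ ∈ P, Adm Y k (f μ) ∧ Γ.ty μ = Γ.ty (f μ) ∧ Acts α μ (f μ))
    {μ μ' : List E} (hμ : μ ∈ P) (hμ' : μ' ∈ P) {x : Γ.PathSpace} (h : x ∈ Γ.cyl (f μ))
    (h' : x ∈ Γ.cyl (f μ')) : μ = μ' := by
  obtain ⟨y, hy⟩ := α.surjective ⟨x, (hf μ hμ).1.subset h⟩
  have key : ∀ κ ∈ P, x ∈ Γ.cyl (f κ) → y.1 ∈ Γ.cyl κ := fun κ hκ hx =>
    (hf κ hκ).2.2.mem_of_apply_mem ((hP.adm κ hκ).mono hk) (hk.trans (hf κ hκ).1.le)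
      (hf κ hκ).2.1 (by rw [hy]; exact hx)
  exact hP.eq_of_mem hμ hμ' (key μ hμ h) (key μ' hμ' h')

theorem isPart_image_of_acts [DecidableEq (List E)] {α : Y ≃ₜ Y} {P : Finset (List E)}
    (hP : IsPart Y k P) (hk : 1 ≤ k) {f : List E → List E}
    (hf : ∀ μ ∈ P, Adm Y k (f μ) ∧ Γ.ty μ = Γ.ty (f μ) ∧ Acts α μ (f μ)) :
    IsPart Y k (P.image f) := by
  refine ⟨fun ν hν => ?_, fun ν hν ν' hν' hne => ?_, fun x hx => ?_⟩
  · obtain ⟨μ, hμ, rfl⟩ := Finset.mem_image.1 hν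
    exact (hf μ hμ).1
  · obtain ⟨μ, hμ, rfl⟩ := Finset.mem_image.1 hν
    obtain ⟨μ', hμ', rfl⟩ := Finset.mem_image.1 hν'
    exact disjoint_left.2 fun x h h' => hne (by rw [injOn_of_acts hP hk hf hμ hμ' h h'])
  · obtain ⟨y, hy⟩ := α.surjective ⟨x, hx⟩
    obtain ⟨μ, hμ, hyμ⟩ := hP.cover y y.2
    refine ⟨f μ, Finset.mem_image_of_mem f hμ, ?_⟩
    have := ((hf μ hμ).2.2 y hyμ).1
    rwa [hy] at this

theorem IsSwap.maps {τ : Y ≃ₜ Y} {a b : List E} (hτ : IsSwap τ a b) {Q : Finset (List E)}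
    (hQ : IsPart Y k Q) (ha : a ∈ Q) (hb : b ∈ Q) (ht : Γ.ty a = Γ.ty b) : Maps τ Q Q := by
  intro κ hκ
  by_cases h1 : κ = a
  · exact ⟨b, hb, h1 ▸ ht, h1 ▸ hτ.left⟩
  by_cases h2 : κ = b
  · exact ⟨a, ha, h2 ▸ ht.symm, h2 ▸ hτ.right⟩
  exact ⟨κ, hκ, rfl, hτ.acts_of_disjoint (hQ.disjoint κ hκ a ha h1) (hQ.disjoint κ hκ b hb h2)⟩

variable [Fintype E]

open Classical in
/-- The words of non-empty cylinder that extend `μ` by one edge. -/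
noncomputable def children (Γ : EdgeGraph V E) (μ : List E) : Finset (List E) :=
  (Finset.univ.image fun f => μ ++ [f]).filter fun κ => (Γ.cyl κ).Nonempty

open Classical in
/-- Replace the word `μ` by its children. -/
noncomputable def split (Γ : EdgeGraph V E) (P : Finset (List E)) (μ : List E) :
    Finset (List E) :=
  P.erase μ ∪ Γ.children μ

theorem mem_children {μ κ : List E} :
    κ ∈ Γ.children μ ↔ ∃ f, κ = μ ++ [f] ∧ (Γ.cyl κ).Nonempty := by
  simp only [children, Finset.mem_filter, Finset.mem_image, Finset.mem_univ, true_and]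
  constructor
  · rintro ⟨⟨f, rfl⟩, h⟩
    exact ⟨f, rfl, h⟩
  · rintro ⟨f, rfl, h⟩
    exact ⟨⟨f, rfl⟩, h⟩

theorem mem_split {P : Finset (List E)} {μ κ : List E} :
    κ ∈ Γ.split P μ ↔ (κ ≠ μ ∧ κ ∈ P) ∨ κ ∈ Γ.children μ := by
  simp [split]

theorem cyl_subset_of_mem_children {μ κ : List E} (h : κ ∈ Γ.children μ) :
    Γ.cyl κ ⊆ Γ.cyl μ := by
  obtain ⟨f, rfl, -⟩ := mem_children.1 h
  exact cyl_append_subset _ _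

theorem pairwise_disjoint_children {μ κ κ' : List E} (h : κ ∈ Γ.children μ)
    (h' : κ' ∈ Γ.children μ) (hne : κ ≠ κ') : Disjoint (Γ.cyl κ) (Γ.cyl κ') := by
  obtain ⟨f, rfl, -⟩ := mem_children.1 h
  obtain ⟨f', rfl, -⟩ := mem_children.1 h'
  exact disjoint_cyl_of_length (by simp) hne

theorem exists_mem_children {μ : List E} {x : Γ.PathSpace} (hx : x ∈ Γ.cyl μ) :
    ∃ κ ∈ Γ.children μ, x ∈ Γ.cyl κ := by
  have h : x ∈ Γ.cyl (μ ++ [x.1 μ.length]) := by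
    rw [← show pre x μ.length = μ from hx, length_pre, ← pre_succ]
    exact mem_cyl_pre x _
  exact ⟨_, mem_children.2 ⟨_, rfl, x, h⟩, h⟩

theorem IsPart.split {P : Finset (List E)} (hP : IsPart Y k P) {μ : List E} (hμ : μ ∈ P) :
    IsPart Y k (Γ.split P μ) := by
  refine ⟨fun κ hκ => ?_, fun κ hκ κ' hκ' hne => ?_, fun x hx => ?_⟩
  · rcases mem_split.1 hκ with h | h
    · exact hP.adm κ h.2
    · obtain ⟨f, rfl, h'⟩ := mem_children.1 h
      exact (hP.adm μ hμ).append h'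
  · rcases mem_split.1 hκ with h | h <;> rcases mem_split.1 hκ' with h' | h'
    · exact hP.disjoint κ h.2 κ' h'.2 hne
    · exact (hP.disjoint κ h.2 μ hμ h.1).mono_right (cyl_subset_of_mem_children h')
    · exact (hP.disjoint μ hμ κ' h'.2 h'.1.symm).mono_left (cyl_subset_of_mem_children h)
    · exact pairwise_disjoint_children h h' hne
  · obtain ⟨κ, hκ, hxκ⟩ := hP.cover x hx
    by_cases h : κ = μ
    · obtain ⟨κ', h', hx'⟩ := exists_mem_children (h ▸ hxκ)
      exact ⟨κ', mem_split.2 (Or.inr h'), hx'⟩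
    · exact ⟨κ, mem_split.2 (Or.inl ⟨h, hκ⟩), hxκ⟩

theorem IsPart.notMem_children {P : Finset (List E)} (hP : IsPart Y k P) {μ ν : List E}
    (hμ : μ ∈ P) (hν : ν ∈ P) : ν ∉ Γ.children μ := by
  intro h
  obtain ⟨x, hx⟩ := (hP.adm ν hν).nonempty
  have := hP.eq_of_mem hμ hν (cyl_subset_of_mem_children h hx) hx
  obtain ⟨f, hf, -⟩ := mem_children.1 h
  simp [← this] at hf

theorem IsPart.split_comm {P : Finset (List E)} (hP : IsPart Y k P) {μ ν : List E}
    (hμ : μ ∈ P) (hν : ν ∈ P) :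
    Γ.split (Γ.split P μ) ν = Γ.split (Γ.split P ν) μ := by
  have h1 := hP.notMem_children hμ hν
  have h2 := hP.notMem_children hν hμ
  ext κ
  simp only [mem_split]
  by_cases hκμ : κ = μ
  · subst hκμ
    simp only [h2, ne_eq, not_true_eq_false, false_and, false_or, or_false]
    exact ⟨fun h => h.2, fun h => ⟨fun h' => h1 (h' ▸ h), h⟩⟩
  by_cases hκν : κ = ν
  · subst hκν
    simp only [h1, ne_eq, not_true_eq_false, false_and, false_or, or_false]
    exact ⟨fun h => ⟨hκμ, h⟩, fun h => h.2⟩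
  tauto

/-- The partition `Q` arises from `P` by successively splitting words of the listed types. -/
inductive Derives (Γ : EdgeGraph V E) :
    Finset (List E) → List (Option V) → Finset (List E) → Prop
  | nil (P : Finset (List E)) : Derives Γ P [] P
  | cons {P Q : Finset (List E)} {μ : List E} {w : List (Option V)} (hμ : μ ∈ P)
      (h : Derives Γ (Γ.split P μ) w Q) : Derives Γ P (Γ.ty μ :: w) Q

theorem Derives.cons' {P Q : Finset (List E)} {μ : List E} {w : List (Option V)} (hμ : μ ∈ P)
    {a : Option V} (ha : Γ.ty μ = a) (h : Derives Γ (Γ.split P μ) w Q) : Derives Γ P (a :: w) Q :=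
  ha ▸ Derives.cons hμ h

/-- Every finer partition arises by splitting. -/
theorem IsPart.exists_derives {P Q : Finset (List E)} (hP : IsPart Y k P) (hQ : IsPart Y k Q)
    (h : ∀ ν ∈ Q, ∃ μ ∈ P, μ <+: ν) : ∃ w, Derives Γ P w Q := by
  classical
  -- `S P` consists of the words that still have to be split on the way from `P` to `Q`: proper
  -- prefixes of words of `Q` that extend a word of `P`. Splitting a word of `P` outside `Q` removes
  -- it from this set, so the cardinality drops.
  let S : Finset (List E) → Finset (List E) := fun P =>
    (Q.biUnion fun ν => ν.inits.toFinset).filter fun κ => κ ∉ Q ∧ ∃ μ ∈ P, μ <+: κ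
  have hS : ∀ P κ, κ ∈ S P ↔ (∃ ν ∈ Q, κ <+: ν) ∧ κ ∉ Q ∧ ∃ μ ∈ P, μ <+: κ := by
    simp [S]
  induction hn : (S P).card using Nat.strong_induction_on generalizing P with
  | _ n ih =>
  have hsub : ∀ {μ κ : List E}, μ <+: κ → Γ.cyl κ ⊆ Γ.cyl μ := by
    rintro μ _ ⟨κ', rfl⟩
    exact cyl_append_subset _ _
  by_cases hPQ : P ⊆ Q
  · have : P = Q := by
      refine Finset.Subset.antisymm hPQ fun ν hν => ?_
      obtain ⟨μ, hμ, hμν⟩ := h ν hν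
      obtain ⟨x, hx⟩ := (hQ.adm ν hν).nonempty
      rwa [← hQ.eq_of_mem (hPQ hμ) hν (hsub hμν hx) hx]
    exact ⟨[], this ▸ Derives.nil P⟩
  · obtain ⟨μ, hμP, hμQ⟩ := Finset.not_subset.1 hPQ
    have href : ∀ ν ∈ Q, ∃ κ ∈ Γ.split P μ, κ <+: ν := by
      intro ν hν
      obtain ⟨μ', hμ', hμν⟩ := h ν hν
      by_cases he : μ' = μ
      · subst he
        obtain ⟨κ, rfl⟩ := hμν
        rcases κ with _ | ⟨f, κ⟩
        · simp only [List.append_nil] at hν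
          exact absurd hν hμQ
        · have hp : μ' ++ [f] <+: μ' ++ f :: κ := ⟨κ, by simp⟩
          exact ⟨_, mem_split.2 (Or.inr (mem_children.2 ⟨f, rfl,
            (hQ.adm _ hν).nonempty.mono (hsub hp)⟩)), hp⟩
      · exact ⟨μ', mem_split.2 (Or.inl ⟨he, hμ'⟩), hμν⟩
    obtain ⟨x, hx⟩ := (hP.adm μ hμP).nonempty
    have hlt : (S (Γ.split P μ)).card < n := by
      rw [← hn]
      refine Finset.card_lt_card (Finset.ssubset_iff_subset_ne.2 ⟨fun κ hκ => ?_, fun he => ?_⟩)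
      · obtain ⟨h1, h2, ρ, hρ, hρκ⟩ := (hS _ _).1 hκ
        refine (hS _ _).2 ⟨h1, h2, ?_⟩
        rcases mem_split.1 hρ with h' | h'
        · exact ⟨ρ, h'.2, hρκ⟩
        · obtain ⟨f, rfl, -⟩ := mem_children.1 h'
          exact ⟨μ, hμP, (List.prefix_append μ [f]).trans hρκ⟩
      · have hμS : μ ∈ S P := by
          refine (hS _ _).2 ⟨?_, hμQ, μ, hμP, List.prefix_refl μ⟩
          obtain ⟨ν, hν, hxν⟩ := hQ.cover x ((hP.adm μ hμP).subset hx)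
          obtain ⟨μ', hμ', hμν⟩ := h ν hν
          exact ⟨ν, hν, hP.eq_of_mem hμ' hμP (hsub hμν hxν) hx ▸ hμν⟩
        rw [← he] at hμS
        obtain ⟨-, -, ρ, hρ, hρμ⟩ := (hS _ _).1 hμS
        rcases mem_split.1 hρ with h' | h'
        · exact h'.1 (hP.eq_of_mem h'.2 hμP (hsub hρμ hx) hx)
        · obtain ⟨f, rfl, -⟩ := mem_children.1 h'
          have := hρμ.length_le
          simp at this
    obtain ⟨w, hw⟩ := ih _ hlt (hP.split hμP) href rfl
    exact ⟨_, Derives.cons hμP hw⟩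

theorem Maps.split {α : Y ≃ₜ Y} {P Q : Finset (List E)} (hα : Maps α P Q) (hk : 1 ≤ k)
    (hP : IsPart Y k P) (hQ : IsPart Y k Q) {μ ν : List E} (hμ : μ ∈ P) (hν : ν ∈ Q)
    (ht : Γ.ty μ = Γ.ty ν) (ha : Acts α μ ν) : Maps α (Γ.split P μ) (Γ.split Q ν) := by
  intro κ hκ
  rcases mem_split.1 hκ with h | h
  · obtain ⟨ν', hν', h1, h2⟩ := hα κ h.2
    refine ⟨ν', mem_split.2 (Or.inl ⟨?_, hν'⟩), h1, h2⟩
    rintro rfl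
    obtain ⟨x, hx⟩ := (hP.adm κ h.2).nonempty
    have hx' := ha.mem_of_apply_mem ((hP.adm μ hμ).mono hk) (hk.trans (hQ.adm ν' hν).le) ht
      (h2 ⟨x, (hP.adm κ h.2).subset hx⟩ hx).1
    exact h.1 (hP.eq_of_mem h.2 hμ hx hx')
  · obtain ⟨f, rfl, hne⟩ := mem_children.1 h
    have hQν := hQ.adm ν hν
    exact ⟨ν ++ [f], mem_split.2 (Or.inr (mem_children.2 ⟨f, rfl,
      cyl_append_nonempty (hk.trans (hP.adm μ hμ).le) hQν.nonempty (hk.trans hQν.le) ht hne⟩)),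
      ty_append_congr ht _, ha.append _⟩

/-! ### Partitions related by products of swaps. -/

section Relation

variable {H : Subgroup (Γ.groupoid.reduction Y).topologicalFullGroup}

/-- Some element of `H` maps the words of `P` to words of `Q` of the same type. -/
def Rel (H : Subgroup (Γ.groupoid.reduction Y).topologicalFullGroup) (P Q : Finset (List E)) :
    Prop :=
  ∃ β ∈ H, Maps β.1 P Q

theorem Rel.refl (P : Finset (List E)) : Rel H P P :=
  ⟨1, H.one_mem, fun μ hμ => ⟨μ, hμ, rfl, acts_one μ⟩⟩

theorem Rel.trans {P Q R : Finset (List E)} (h : Rel H P Q) (h' : Rel H Q R) : Rel H P R := by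
  obtain ⟨β, hβ, h1⟩ := h
  obtain ⟨γ, hγ, h2⟩ := h'
  exact ⟨γ * β, H.mul_mem hγ hβ, h2.mul h1⟩

theorem IsPair.exists_isSwap_mem {a b : List E} (h : IsPair Y k a b) (hk : 1 ≤ k)
    (hH : ContainsSwaps H k) : ∃ τ ∈ H, IsSwap τ.1 a b := by
  obtain ⟨τ, -, -, hτ⟩ := IsPair.exists_isSwap
    (⟨h.left.mono hk, h.right.mono hk, h.ty_eq, h.disjoint⟩ : IsPair Y 1 a b)
  exact ⟨τ, hH a b h τ hτ, hτ⟩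

/-- The given element may send `μ` to a different word of the type of `ν`. A swap inside `Q`
corrects this, after which the children correspond edge by edge. -/
theorem Rel.split {P Q : Finset (List E)} (h : Rel H P Q) (hk : 1 ≤ k) (hH : ContainsSwaps H k)
    (hP : IsPart Y k P) (hQ : IsPart Y k Q) {μ ν : List E} (hμ : μ ∈ P) (hν : ν ∈ Q)
    (ht : Γ.ty μ = Γ.ty ν) : Rel H (Γ.split P μ) (Γ.split Q ν) := by
  obtain ⟨β, hβ, hm⟩ := h
  obtain ⟨ν', hν', ht', ha⟩ := hm μ hμ
  by_cases he : ν' = ν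
  · subst he
    exact ⟨β, hβ, hm.split hk hP hQ hμ hν ht ha⟩
  · have ht2 := ht'.symm.trans ht
    obtain ⟨τ, hτH, hτ⟩ := (hQ.isPair hν' hν ht2 he).exists_isSwap_mem hk hH
    exact ⟨τ * β, H.mul_mem hτH hβ, ((hτ.maps hQ hν' hν ht2).mul hm).split hk hP hQ hμ hν ht
      (hτ.left.mul ha)⟩

/-- A derivation can be replayed on a related partition: each split word has a counterpart of the
same type there. -/
theorem Derives.exists_of_rel {B D : Finset (List E)} {w : List (Option V)}
    (h : Derives Γ B w D) (hk : 1 ≤ k) (hH : ContainsSwaps H k) {A : Finset (List E)}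
    (hAB : Rel H A B) (hA : IsPart Y k A) (hB : IsPart Y k B) :
    ∃ C, Derives Γ A w C ∧ Rel H C D := by
  induction h generalizing A with
  | nil => exact ⟨A, .nil A, hAB⟩
  | cons hν _ ih =>
    obtain ⟨β, hβ, hm⟩ := id hAB
    obtain ⟨μ, hμ, ht, -⟩ := hm.exists_of_mem hA hB hν
    obtain ⟨C, hC, hCD⟩ := ih (hAB.split hk hH hA hB hμ hν ht) (hA.split hμ) (hB.split hν)
    exact ⟨C, .cons' hμ ht hC, hCD⟩

/-- A split that is available and occurs later may be carried out first. -/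
theorem Derives.exists_split_first {P Q : Finset (List E)} {w : List (Option V)}
    (h : Derives Γ P w Q) (hk : 1 ≤ k) (hH : ContainsSwaps H k) (hP : IsPart Y k P) {ν : List E}
    (hν : ν ∈ P) (hw : Γ.ty ν ∈ w) :
    ∃ w' Q', (Γ.ty ν :: w').Perm w ∧ Derives Γ (Γ.split P ν) w' Q' ∧ Rel H Q' Q := by
  induction h with
  | nil => simp at hw
  | @cons P Q κ w hκ hd ih =>
    by_cases ht : Γ.ty ν = Γ.ty κ
    · obtain ⟨C, hC, hCQ⟩ := hd.exists_of_rel hk hH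
        ((Rel.refl P).split hk hH hP hP hν hκ ht) (hP.split hν) (hP.split hκ)
      exact ⟨w, C, by rw [ht], hC, hCQ⟩
    · have hne : ν ≠ κ := fun e => ht (by rw [e])
      have hν' : ν ∈ Γ.split P κ := mem_split.2 (Or.inl ⟨hne, hν⟩)
      have hκ' : κ ∈ Γ.split P ν := mem_split.2 (Or.inl ⟨hne.symm, hκ⟩)
      obtain ⟨w', Q', hp, hd', hr⟩ := ih (hP.split hκ) hν'
        ((List.mem_cons.1 hw).resolve_left ht)
      rw [hP.split_comm hκ hν] at hd'
      exact ⟨Γ.ty κ :: w', Q', (List.Perm.swap _ _ _).trans (hp.cons _), .cons hκ' hd', hr⟩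

/-- Partitions that arise by the same numbers of splits of each type are related. -/
theorem Derives.rel_of_perm {P Q P' Q' : Finset (List E)} {w w' : List (Option V)}
    (h : Derives Γ P w Q) (h' : Derives Γ P' w' Q') (hk : 1 ≤ k) (hH : ContainsSwaps H k)
    (hP : IsPart Y k P) (hP' : IsPart Y k P') (hr : Rel H P P') (hw : w.Perm w') :
    Rel H Q Q' := by
  induction h generalizing P' w' Q' with
  | nil =>
    obtain rfl := List.nil_perm.1 hw
    cases h'
    exact hr
  | @cons P Q μ w hμ _ ih =>
    obtain ⟨β, hβ, hm⟩ := id hr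
    obtain ⟨ν, hν, ht, -⟩ := hm μ hμ
    -- The counterpart `ν` of `μ` has a type that occurs in `w'`, so the second derivation may be
    -- rearranged, up to `H`, to begin by splitting `ν`.
    obtain ⟨w'', Q'', hp, hd, hr'⟩ := h'.exists_split_first hk hH hP' hν
      (by rw [← ht]; exact hw.mem_iff.1 (by simp))
    rw [← ht] at hp
    exact (ih hd (hP.split hμ) (hP'.split hν) (hr.split hk hH hP hP' hμ hν ht)
      (hw.trans hp.symm).cons_inv).trans hr'

/-- A homeomorphism that permutes the words of a partition is a product of swaps. -/
theorem Maps.mem {P : Finset (List E)} (hP : IsPart Y k P) (hk : 1 ≤ k) (hH : ContainsSwaps H k)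
    {α : (Γ.groupoid.reduction Y).topologicalFullGroup} (hα : Maps α.1 P P) : α ∈ H := by
  classical
  induction hn : (P.filter fun μ => ¬Acts α.1 μ μ).card using Nat.strong_induction_on
    generalizing α with
  | _ n ih =>
  by_cases hfix : ∀ μ ∈ P, Acts α.1 μ μ
  · have : α = 1 := by
      refine Subtype.ext (Homeomorph.ext fun x => ?_)
      obtain ⟨μ, hμ, hx⟩ := hP.cover x x.2
      exact (hfix μ hμ).eq (acts_one μ) hx
    rw [this]
    exact H.one_mem
  · push Not at hfix
    obtain ⟨μ, hμ, hμα⟩ := hfix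
    obtain ⟨ν, hν, ht, ha⟩ := hα μ hμ
    have hne : μ ≠ ν := fun e => hμα (by rw [← e] at ha; exact ha)
    obtain ⟨τ, hτH, hτ⟩ := (hP.isPair hμ hν ht hne).exists_isSwap_mem hk hH
    -- Composing with the swap of `μ` and its image `ν` fixes `μ` without disturbing any word
    -- already fixed, so the number of moved words decreases.
    have hfixed : ∀ κ ∈ P, Acts α.1 κ κ → Acts (τ * α).1 κ κ := by
      intro κ hκ hκα
      have h1 : κ ≠ μ := fun e => hμα (e ▸ hκα)
      have h2 : κ ≠ ν := by
        rintro rfl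
        obtain ⟨x, hx⟩ := (hP.adm μ hμ).nonempty
        have h3 := hκα.mem_of_apply_mem ((hP.adm κ hκ).mono hk) (hk.trans (hP.adm κ hκ).le) rfl
          (ha ⟨x, (hP.adm μ hμ).subset hx⟩ hx).1
        exact h1 (hP.eq_of_mem hκ hμ h3 hx)
      exact (hτ.acts_of_disjoint (hP.disjoint κ hκ μ hμ h1) (hP.disjoint κ hκ ν hν h2)).mul hκα
    have hlt : (P.filter fun μ => ¬Acts (τ * α).1 μ μ).card < n := by
      rw [← hn]
      refine Finset.card_lt_card (Finset.ssubset_iff_subset_ne.2 ⟨fun κ hκ => ?_, fun he => ?_⟩)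
      · rw [Finset.mem_filter] at hκ ⊢
        exact ⟨hκ.1, fun h => hκ.2 (hfixed κ hκ.1 h)⟩
      · have : μ ∈ P.filter fun μ => ¬Acts α.1 μ μ := Finset.mem_filter.2 ⟨hμ, hμα⟩
        rw [← he, Finset.mem_filter] at this
        exact this.2 (hτ.right.mul ha)
    have := ih _ hlt ((hτ.maps hP hμ hν ht).mul hα) rfl
    exact (H.mul_mem_cancel_left hτH).1 this

end Relation

end Partitions

end EdgeGraph

/-! ### Weights that count the splits of each type. -/

namespace EdgeGraph

section Counting

variable {V E : Type*} {Γ : EdgeGraph V E} {Y : Clopens Γ.PathSpace}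

/-- The number of paths in the cylinder of `ν` that arrive at `b` after `i` shifts. -/
noncomputable def cnt (b : Γ.PathSpace) (ν : List E) (i : ℕ) : ℤ :=
  ∑ᶠ _x ∈ Γ.cyl ν ∩ {x | Γ.shift^[i] x = b}, 1

/-- The number of `i < a` such that `x` arrives at `b` after `i` shifts. -/
noncomputable def visits (b : Γ.PathSpace) (a : ℕ) (x : Γ.PathSpace) : ℤ :=
  ∑ i ∈ Finset.range a, {x | Γ.shift^[i] x = b}.indicator 1 x

/-- From times `k` and `l` on the two paths coincide, so they meet `b` equally often during the next
`j` steps. -/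
theorem visits_add_sub {x y : Γ.PathSpace} {k l : ℕ} (h : Γ.shift^[k] x = Γ.shift^[l] y)
    (b : Γ.PathSpace) (j : ℕ) :
    visits b (k + j) x - visits b k x = visits b (l + j) y - visits b l y := by
  rw [visits, visits, visits, visits, Finset.sum_range_add, Finset.sum_range_add,
    add_sub_cancel_left, add_sub_cancel_left]
  refine Finset.sum_congr rfl fun i _ => ?_
  have h' : Γ.shift^[k + i] x = Γ.shift^[l + i] y := by
    rw [add_comm k, add_comm l]
    exact Arrow.shift_add h i
  by_cases hb : Γ.shift^[l + i] y = b
  · rw [indicator_of_mem (show x ∈ {x | _ = b} from h'.trans hb),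
      indicator_of_mem (show y ∈ {x | _ = b} from hb)]
    rfl
  · rw [indicator_of_notMem (show x ∉ {x | _ = b} from fun e => hb (h'.symm.trans e)),
      indicator_of_notMem (show y ∉ {x | _ = b} from hb)]

/-- Exchanging the prefix `μ` for `ν` is a bijection of the cylinders that preserves tails, so the
count depends only on the type and on the time after the prefix. -/
theorem cnt_congr (b : Γ.PathSpace) {μ ν : List E} (hμ : (Γ.cyl μ).Nonempty)
    (hμ1 : 1 ≤ μ.length) (hν : (Γ.cyl ν).Nonempty) (hν1 : 1 ≤ ν.length) (h : Γ.ty μ = Γ.ty ν)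
    (j : ℕ) : cnt b μ (μ.length + j) = cnt b ν (ν.length + j) := by
  have hg : ∀ x ∈ Γ.cyl μ, ∃ z ∈ Γ.cyl ν, Γ.shift^[ν.length] z = Γ.shift^[μ.length] x :=
    fun x hx => exists_graft_of_ty_eq hx hμ1 hν hν1 h
  have : Nonempty Γ.PathSpace := ⟨hμ.some⟩
  choose! e he1 he2 using hg
  have hadd : ∀ (x : Γ.PathSpace) (m : ℕ), Γ.shift^[m + j] x = Γ.shift^[j] (Γ.shift^[m] x) :=
    fun x m => by rw [add_comm, Function.iterate_add_apply]
  refine finsum_mem_eq_of_bijOn e ⟨?_, ?_, ?_⟩ fun _ _ => rfl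
  · rintro x ⟨hx, hxs⟩
    refine ⟨he1 x hx, ?_⟩
    rw [mem_ofPred_eq, hadd] at hxs ⊢
    rw [he2 x hx, hxs]
  · rintro x ⟨hx, -⟩ y ⟨hy, -⟩ hxy
    exact eq_of_mem_cyl hx hy (by rw [← he2 x hx, ← he2 y hy, hxy])
  · rintro z ⟨hz, hzs⟩
    obtain ⟨x, hx, hxs⟩ := exists_graft_of_ty_eq hz hν1 hμ hμ1 h.symm
    refine ⟨x, ⟨hx, ?_⟩, eq_of_mem_cyl (he1 x hx) hz ((he2 x hx).trans hxs)⟩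
    rw [mem_ofPred_eq, hadd] at hzs ⊢
    rw [hxs, hzs]

/-- The only candidate is the concatenation `νb`, and it is a path exactly when the types match. -/
theorem cnt_length [DecidableEq V] (b : Γ.PathSpace) {ν : List E} (hν : (Γ.cyl ν).Nonempty)
    (h1 : 1 ≤ ν.length) :
    cnt b ν ν.length = if Γ.ty ν = some (Γ.i (b.1 0)) then 1 else 0 := by
  rw [cnt]
  split_ifs with h
  · obtain ⟨z, hz, hzs⟩ := exists_graft (x := b) (m := 0) hν h1 h
    have : Γ.cyl ν ∩ {x | Γ.shift^[ν.length] x = b} = {z} := by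
      ext x
      constructor
      · rintro ⟨hx, hxs⟩
        exact eq_of_mem_cyl hx hz ((show _ = b from hxs).trans hzs.symm)
      · rintro rfl
        exact ⟨hz, hzs⟩
    rw [this, finsum_mem_singleton]
  · have : Γ.cyl ν ∩ {x | Γ.shift^[ν.length] x = b} = ∅ := by
      refine eq_empty_of_forall_notMem fun x hx => h ?_
      rw [ty_eq hx.1 h1, ← show Γ.shift^[ν.length] x = b from hx.2, shift_iterate_apply]
      rfl
    rw [this, finsum_mem_empty]

variable [Fintype E]

theorem finite_preimage_shift (b : Γ.PathSpace) (i : ℕ) : {x | Γ.shift^[i] x = b}.Finite := by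
  refine Set.Finite.of_injOn (f := fun x : Γ.PathSpace => pre x i)
    (t := {l : List E | l.length = i}) (fun x _ => length_pre x i) ?_ (List.finite_length_eq E i)
  intro x hx y hy hxy
  have hxy' : pre x i = pre y i := hxy
  refine eq_of_mem_cyl (mem_cyl_pre x i) (hxy' ▸ mem_cyl_pre y i) ?_
  rw [length_pre]
  exact hx.trans hy.symm

theorem cnt_eq_sum_children (b : Γ.PathSpace) (ν : List E) (i : ℕ) :
    cnt b ν i = ∑ κ ∈ Γ.children ν, cnt b κ i := by
  have h : Γ.cyl ν ∩ {x | Γ.shift^[i] x = b} =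
      ⋃ κ ∈ (Γ.children ν : Set (List E)), Γ.cyl κ ∩ {x | Γ.shift^[i] x = b} := by
    ext x
    simp only [mem_inter_iff, mem_iUnion, Finset.mem_coe, exists_prop]
    constructor
    · rintro ⟨h1, h2⟩
      obtain ⟨κ, hκ, hx⟩ := exists_mem_children h1
      exact ⟨κ, hκ, hx, h2⟩
    · rintro ⟨κ, hκ, hx, h2⟩
      exact ⟨cyl_subset_of_mem_children hκ hx, h2⟩
  rw [cnt, h, finsum_mem_biUnion, finsum_mem_coe_finset]
  · rfl
  · intro κ hκ κ' hκ' hne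
    exact (pairwise_disjoint_children hκ hκ' hne).mono inter_subset_left inter_subset_left
  · exact Finset.finite_toSet _
  · exact fun κ _ => (finite_preimage_shift b i).subset inter_subset_right

/-- The number of words of length less than `N` that extend `ν` and have the type of `b`. -/
noncomputable def weight (b : Γ.PathSpace) (N : ℕ) (ν : List E) : ℤ :=
  ∑ i ∈ Finset.Ico ν.length N, cnt b ν i

/-- The term at time `ν.length` records whether `ν` itself has the type of `b`; the later terms are
distributed among the children. -/
theorem weight_eq_add_sum [DecidableEq V] (b : Γ.PathSpace) {N : ℕ} {ν : List E}
    (hν : (Γ.cyl ν).Nonempty) (h1 : 1 ≤ ν.length) (hN : ν.length < N) :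
    weight b N ν = (if Γ.ty ν = some (Γ.i (b.1 0)) then 1 else 0) +
      ∑ κ ∈ Γ.children ν, weight b N κ := by
  rw [weight, Finset.sum_eq_sum_Ico_succ_bot hN, cnt_length b hν h1]
  congr 1
  rw [Finset.sum_congr rfl fun i _ => cnt_eq_sum_children b ν i, Finset.sum_comm]
  refine Finset.sum_congr rfl fun κ hκ => ?_
  obtain ⟨f, rfl, -⟩ := mem_children.1 hκ
  simp [weight]

theorem Derives.exists_length_le {k : ℕ} {P Q : Finset (List E)} {w : List (Option V)}
    (h : Derives Γ P w Q) (hP : IsPart Y k P) {μ : List E} (hμ : μ ∈ P) :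
    ∃ ν ∈ Q, μ.length ≤ ν.length := by
  induction h generalizing μ with
  | nil => exact ⟨μ, hμ, le_rfl⟩
  | @cons P Q κ w hκ _ ih =>
    by_cases he : μ = κ
    · obtain ⟨x, hx⟩ := (hP.adm μ hμ).nonempty
      obtain ⟨κ', hκ', -⟩ := exists_mem_children hx
      obtain ⟨ν, hν, hl⟩ := ih (hP.split hκ) (mem_split.2 (Or.inr (he ▸ hκ')))
      obtain ⟨f, rfl, -⟩ := mem_children.1 hκ'
      exact ⟨ν, hν, le_trans (by simp) hl⟩
    · exact ih (hP.split hκ) (mem_split.2 (Or.inl ⟨he, hμ⟩))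

/-- Each split loses the weight of the split word itself. Words never become shorter along a
derivation, so the bound on `Q` ensures that every split word has length below `N`. -/
theorem Derives.sum_weight [DecidableEq V] {k : ℕ} (hk : 1 ≤ k) {P Q : Finset (List E)}
    {w : List (Option V)} (h : Derives Γ P w Q) (hP : IsPart Y k P) (b : Γ.PathSpace) {N : ℕ}
    (hN : ∀ ν ∈ Q, ν.length ≤ N) :
    ∑ μ ∈ P, weight b N μ = w.count (some (Γ.i (b.1 0))) + ∑ ν ∈ Q, weight b N ν := by
  classical
  induction h with
  | nil => simp
  | @cons P Q μ w hμ hd ih =>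
    have hμN : μ.length < N := by
      obtain ⟨x, hx⟩ := (hP.adm μ hμ).nonempty
      obtain ⟨κ', hκ', -⟩ := exists_mem_children hx
      obtain ⟨ν, hν, hl⟩ := hd.exists_length_le (hP.split hμ) (mem_split.2 (Or.inr hκ'))
      obtain ⟨f, rfl, -⟩ := mem_children.1 hκ'
      have := hN ν hν
      simp only [List.length_append, List.length_singleton] at hl
      omega
    have ih' := ih (hP.split hμ) hN
    have hs : ∑ κ ∈ Γ.split P μ, weight b N κ =
        ∑ κ ∈ P.erase μ, weight b N κ + ∑ κ ∈ Γ.children μ, weight b N κ := by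
      rw [← Finset.sum_union]
      · refine Finset.sum_congr ?_ fun _ _ => rfl
        ext κ
        simp [mem_split]
      · exact Finset.disjoint_left.2 fun κ h1 h2 =>
          hP.notMem_children hμ (Finset.mem_of_mem_erase h1) h2
    rw [← Finset.add_sum_erase P _ hμ, weight_eq_add_sum b (hP.adm μ hμ).nonempty
      (hk.trans (hP.adm μ hμ).le) hμN, List.count_cons]
    simp only [beq_iff_eq, Nat.cast_add, Nat.cast_ite, Nat.cast_one, Nat.cast_zero]
    rw [hs] at ih'
    linarith

/-- Every type that is split is the starting vertex of a path, so counts need only be tested with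
paths `b`. -/
theorem Derives.exists_path_of_mem {k : ℕ} (hk : 1 ≤ k) {P Q : Finset (List E)}
    {w : List (Option V)} (h : Derives Γ P w Q) (hP : IsPart Y k P) {a : Option V} (ha : a ∈ w) :
    ∃ b : Γ.PathSpace, a = some (Γ.i (b.1 0)) := by
  induction h with
  | nil => simp at ha
  | @cons P Q μ w hμ _ ih =>
    rcases List.mem_cons.1 ha with rfl | ha
    · obtain ⟨x, hx⟩ := (hP.adm μ hμ).nonempty
      refine ⟨Γ.shift^[μ.length] x, ?_⟩
      rw [ty_eq hx (hk.trans (hP.adm μ hμ).le), shift_iterate_apply]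
      rfl
    · exact ih (hP.split hμ) ha

theorem Derives.perm_of_sum_weight [DecidableEq V] {k : ℕ} (hk : 1 ≤ k) {P Q Q' : Finset (List E)}
    {w w' : List (Option V)} (h : Derives Γ P w Q) (h' : Derives Γ P w' Q') (hP : IsPart Y k P)
    (hs : ∀ b : Γ.PathSpace, ∃ N, (∀ ν ∈ Q, ν.length ≤ N) ∧ (∀ ν ∈ Q', ν.length ≤ N) ∧
      ∑ ν ∈ Q, weight b N ν = ∑ ν ∈ Q', weight b N ν) : w.Perm w' := by
  have key : ∀ a, (∃ b : Γ.PathSpace, a = some (Γ.i (b.1 0))) → w.count a = w'.count a := by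
    rintro _ ⟨b, rfl⟩
    obtain ⟨N, h1, h2, h3⟩ := hs b
    have e1 := h.sum_weight hk hP b h1
    have e2 := h'.sum_weight hk hP b h2
    have : ((w.count (some (Γ.i (b.1 0))) : ℕ) : ℤ) = (w'.count (some (Γ.i (b.1 0))) : ℕ) := by
      linarith
    exact_mod_cast this
  refine List.perm_iff_count.2 fun a => ?_
  by_cases ha : a ∈ w
  · exact key a (h.exists_path_of_mem hk hP ha)
  by_cases ha' : a ∈ w'
  · exact key a (h'.exists_path_of_mem hk hP ha')
  rw [List.count_eq_zero_of_not_mem ha, List.count_eq_zero_of_not_mem ha']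

theorem finsum_visits (b : Γ.PathSpace) (ν : List E) (a : ℕ) :
    (Γ.cyl ν ∩ Function.support (visits b a)).Finite ∧
      ∑ᶠ x ∈ Γ.cyl ν, visits b a x = ∑ i ∈ Finset.range a, cnt b ν i := by
  constructor
  · refine ((Finset.finite_toSet (Finset.range a)).biUnion
      fun i _ => finite_preimage_shift b i).subset ?_
    rintro x ⟨-, hx⟩
    obtain ⟨i, hi, hx⟩ := Finset.exists_ne_zero_of_sum_ne_zero hx
    exact mem_biUnion hi (mem_of_indicator_ne_zero hx)
  · rw [finsum_mem_def]
    have : ∀ x, (Γ.cyl ν).indicator (visits b a) x =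
        ∑ i ∈ Finset.range a, (Γ.cyl ν ∩ {x | Γ.shift^[i] x = b}).indicator 1 x := by
      intro x
      by_cases hx : x ∈ Γ.cyl ν
      · rw [indicator_of_mem hx, visits]
        exact Finset.sum_congr rfl fun i _ => by rw [← indicator_indicator, indicator_of_mem hx]
      · rw [indicator_of_notMem hx]
        exact (Finset.sum_eq_zero fun i _ => indicator_of_notMem (fun h => hx h.1) _).symm
    rw [finsum_congr this, finsum_sum_comm]
    · exact Finset.sum_congr rfl fun i _ => by rw [cnt, finsum_mem_def]; rfl
    · exact fun i _ => (finite_preimage_shift b i).subset fun x hx =>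
        (mem_of_indicator_ne_zero hx).2

/-- The visits at times below `ν.length` cancel. The remaining counts for `ν` up to `ν.length + (N -
μ.length)` equal those for `μ` up to `N`, because the types agree. -/
theorem finsum_visits_sub (b : Γ.PathSpace) {μ ν : List E} (hμ : Adm Y 1 μ) (hν : Adm Y 1 ν)
    (h : Γ.ty μ = Γ.ty ν) {N : ℕ} (h1 : μ.length ≤ N) (h2 : ν.length ≤ N) :
    ∑ᶠ x ∈ Γ.cyl ν, (visits b ((N : ℤ) + (ν.length - μ.length)).toNat x - visits b N x) =
      weight b N μ - weight b N ν := by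
  obtain ⟨p, rfl⟩ := Nat.exists_eq_add_of_le h1
  obtain ⟨q, hq⟩ := Nat.exists_eq_add_of_le h2
  rw [show (((μ.length + p : ℕ) : ℤ) + (ν.length - μ.length)).toNat = ν.length + p by omega]
  have hsub : ∑ᶠ x ∈ Γ.cyl ν, (visits b (ν.length + p) x - visits b (μ.length + p) x) =
      ∑ᶠ x ∈ Γ.cyl ν, visits b (ν.length + p) x - ∑ᶠ x ∈ Γ.cyl ν, visits b (μ.length + p) x := by
    have hf : ∀ a, (Function.support fun x => ∑ᶠ _ : x ∈ Γ.cyl ν, visits b a x).Finite :=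
      fun a => (finsum_visits b ν a).1.subset fun x hx => by
        by_cases hxν : x ∈ Γ.cyl ν
        · simp only [hxν, finsum_true, Function.mem_support] at hx
          exact ⟨hxν, hx⟩
        · simp [hxν] at hx
    rw [← finsum_sub_distrib (hf _) (hf _)]
    refine finsum_congr fun x => ?_
    by_cases hxν : x ∈ Γ.cyl ν <;> simp [hxν]
  rw [hsub, (finsum_visits b ν _).2, (finsum_visits b ν _).2, hq, Finset.sum_range_add,
    Finset.sum_range_add, add_sub_add_left_eq_sub, weight, weight, Finset.sum_Ico_eq_sum_range,
    Finset.sum_Ico_eq_sum_range, ← hq, Nat.add_sub_cancel_left,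
    show μ.length + p - ν.length = q by omega]
  congr 1
  exact Finset.sum_congr rfl fun j _ =>
    (cnt_congr b hμ.nonempty hμ.le hν.nonempty hν.le h j).symm

end Counting

/-! ### The asymptotic cocycle of visits to a path. -/

section Cocycle

variable {V E : Type*} {Γ : EdgeGraph V E} {Y : Clopens Γ.PathSpace}

/-- Finitely many basic sets cover `K`, and all arrows in one basic set share the same pair `k`,
`l`. -/
theorem exists_depth {K : Set Γ.Arrow} (hK : IsCompact K) :
    ∃ D : ℕ, ∀ g ∈ K, ∃ k ≤ D, ∃ l ≤ D, g.n = k - l ∧ Γ.shift^[k] g.x = Γ.shift^[l] g.y := by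
  choose k l hn hkl using fun g : Γ.Arrow => g.exists_shift
  obtain ⟨t, -, ht⟩ := hK.elim_nhds_subcover (fun g => basicSet univ univ (k g) (l g))
    fun g _ => (Arrow.isOpen_basicSet isOpen_univ isOpen_univ _ _).mem_nhds
      ⟨hn g, trivial, trivial, hkl g⟩
  refine ⟨t.sup k + t.sup l, fun g hg => ?_⟩
  have := ht hg
  simp only [mem_iUnion] at this
  obtain ⟨g', hg', h1, -, -, h2⟩ := this
  have e1 := Finset.le_sup (f := k) hg'
  have e2 := Finset.le_sup (f := l) hg'
  exact ⟨k g', by omega, l g', by omega, h1, h2⟩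

variable [Fintype E]

/-- The asymptotic cocycle that counts visits to `b` between the times `N` and `N + n` along the
range of an arrow `(x, n, y)`. -/
noncomputable def visitCocycle (b : Γ.PathSpace) (N : ℕ) (g : Γ.groupoid.ReductionArrow Y) : ℤ :=
  visits b ((N : ℤ) + g.1.n).toNat g.1.x - visits b N g.1.x

/-- A nonzero value forces the range to be one of the finitely many paths reaching `b` in fewer than
`N + D` shifts, and a compact set has finitely many arrows over each path. -/
theorem finite_visitCocycle_ne_zero (b : Γ.PathSpace) (N : ℕ)
    {K : Set (Γ.groupoid.ReductionArrow Y)} (hK : IsCompact K) :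
    {g ∈ K | visitCocycle b N g ≠ 0}.Finite := by
  obtain ⟨D, hD⟩ := exists_depth (hK.image continuous_subtype_val)
  have hπ : IsLocalHomeomorph fun g : Γ.groupoid.ReductionArrow Y => (Γ.groupoid.reduction Y).r g :=
    (Γ.groupoid.reduction Y).isLocalHomeomorph_r
  choose U hUo hU hinj using hπ.isLocallyInjective
  obtain ⟨t, -, ht⟩ := hK.elim_nhds_subcover U fun g _ => (hUo g).mem_nhds (hU g)
  have hB : (⋃ i ∈ (Finset.range (N + D) : Set ℕ), {x | Γ.shift^[i] x = b}).Finite :=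
    (Finset.finite_toSet _).biUnion fun i _ => finite_preimage_shift b i
  refine (t.finite_toSet.biUnion fun g _ => Set.Finite.of_injOn
    (s := {g' ∈ U g | g'.1.x ∈ ⋃ i ∈ (Finset.range (N + D) : Set ℕ), {x | Γ.shift^[i] x = b}})
    (f := fun g' => g'.1.x) (fun g' h => h.2)
    (fun g1 h1 g2 h2 e => hinj g h1.1 h2.1 (Subtype.ext e)) hB).subset ?_
  rintro g ⟨hg, hne⟩
  have := ht hg
  simp only [mem_iUnion] at this
  obtain ⟨g', hg', hgU⟩ := this
  refine mem_biUnion (Finset.mem_coe.2 hg') ⟨hgU, ?_⟩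
  obtain ⟨k, hk, l, -, hn, -⟩ := hD g.1 ⟨g, hg, rfl⟩
  have hvis : ∀ a ≤ N + D, visits b a g.1.x ≠ 0 →
      g.1.x ∈ ⋃ i ∈ (Finset.range (N + D) : Set ℕ), {x | Γ.shift^[i] x = b} := by
    intro a ha h
    obtain ⟨i, hi, hx⟩ := Finset.exists_ne_zero_of_sum_ne_zero h
    rw [Finset.mem_range] at hi
    exact mem_biUnion (Finset.mem_coe.2 (Finset.mem_range.2 (hi.trans_le ha)))
      (mem_of_indicator_ne_zero hx)
  by_cases h0 : visits b N g.1.x = 0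
  · refine hvis ((N : ℤ) + g.1.n).toNat (by omega) fun h => hne ?_
    rw [visitCocycle, h, h0, sub_zero]
  · exact hvis N (by omega) h0

theorem eventually_visitCocycle_d₁ (b : Γ.PathSpace)
    {K : Set (Γ.groupoid.reduction Y).Composable} (hK : IsCompact K) :
    ∀ᶠ N in Filter.atTop, ∀ p ∈ K, visitCocycle b N ((Γ.groupoid.reduction Y).d₁ p) =
      visitCocycle b N ((Γ.groupoid.reduction Y).d₂ p) +
        visitCocycle b N ((Γ.groupoid.reduction Y).d₀ p) := by
  set 𝒢 := Γ.groupoid.reduction Y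
  obtain ⟨D₂, h₂⟩ := exists_depth ((hK.image 𝒢.isLocalHomeomorph_d₂.continuous).image
    continuous_subtype_val)
  obtain ⟨D₀, h₀⟩ := exists_depth ((hK.image 𝒢.isLocalHomeomorph_d₀.continuous).image
    continuous_subtype_val)
  -- The bound puts `N` and `N + h.n` at or after time `l`, where `g.x` and `g.y` already share
  -- their tails, and keeps the arguments of `toNat` nonnegative.
  filter_upwards [Filter.eventually_ge_atTop (D₂ + D₀)] with N hN p hp
  obtain ⟨k, hk, l, hl, hn, hkl⟩ := h₂ _ ⟨_, ⟨p, hp, rfl⟩, rfl⟩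
  obtain ⟨k', hk', l', hl', hn', -⟩ := h₀ _ ⟨_, ⟨p, hp, rfl⟩, rfl⟩
  obtain ⟨⟨g, h⟩, e⟩ := p
  have e' : g.1.y = h.1.x := congrArg Subtype.val e
  change g.1.n = k - l at hn
  change h.1.n = k' - l' at hn'
  change Γ.shift^[k] g.1.x = Γ.shift^[l] g.1.y at hkl
  change visits b ((N : ℤ) + (g.1.n + h.1.n)).toNat g.1.x - visits b N g.1.x =
    (visits b ((N : ℤ) + g.1.n).toNat g.1.x - visits b N g.1.x) +
      (visits b ((N : ℤ) + h.1.n).toNat h.1.x - visits b N h.1.x)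
  rw [e'] at hkl
  have e1 := visits_add_sub hkl b (N - l)
  have e2 := visits_add_sub hkl b ((N : ℤ) + h.1.n - l).toNat
  rw [show k + (N - l) = ((N : ℤ) + g.1.n).toNat by omega, show l + (N - l) = N by omega] at e1
  rw [show k + ((N : ℤ) + h.1.n - l).toNat = ((N : ℤ) + (g.1.n + h.1.n)).toNat by omega,
    show l + ((N : ℤ) + h.1.n - l).toNat = ((N : ℤ) + h.1.n).toNat by omega] at e2
  -- The difference of `e2` and `e1` identifies the visits along `g.x` between `N + g.n` and `N +
  -- g.n + h.n` with those along `h.x` between `N` and `N + h.n`.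
  linarith

end Cocycle

end EdgeGraph

/-! ### Tables of bisections, and the kernel of the index map. -/

namespace EdgeGraph

section Tables

variable {V E : Type*} [Fintype E] {Γ : EdgeGraph V E} {Y : Clopens Γ.PathSpace} {k : ℕ}

/-- The arrows of `U` with source in the cylinder of `μ` replace the prefix `μ` by `ν`. -/
structure IsRow (k : ℕ) (U : Set (Γ.groupoid.ReductionArrow Y)) (μ ν : List E) : Prop where
  left : Adm Y k μ
  right : Adm Y k ν
  ty_eq : Γ.ty μ = Γ.ty ν
  apply : ∀ g ∈ U, g.1.y ∈ Γ.cyl μ → g.1.x ∈ Γ.cyl ν ∧ g.1.n = ν.length - μ.length ∧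
    Γ.shift^[ν.length] g.1.x = Γ.shift^[μ.length] g.1.y

theorem IsRow.append {U : Set (Γ.groupoid.ReductionArrow Y)} {μ ν κ : List E}
    (h : IsRow k U μ ν) (hk : 1 ≤ k) (hne : (Γ.cyl (μ ++ κ)).Nonempty) :
    IsRow k U (μ ++ κ) (ν ++ κ) := by
  refine ⟨h.left.append hne, h.right.append (cyl_append_nonempty (hk.trans h.left.le)
    h.right.nonempty (hk.trans h.right.le) h.ty_eq hne), ty_append_congr h.ty_eq κ,
    fun g hg hgy => ?_⟩
  obtain ⟨hy1, hy2⟩ := mem_cyl_append.1 hgy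
  obtain ⟨h1, h2, h3⟩ := h.apply g hg hy1
  refine ⟨mem_cyl_append.2 ⟨h1, h3 ▸ hy2⟩, ?_, ?_⟩
  · rw [h2, List.length_append, List.length_append]
    push_cast
    ring
  · rw [List.length_append, List.length_append, add_comm, add_comm μ.length,
      Function.iterate_add_apply, h3, ← Function.iterate_add_apply]

theorem exists_isRow {U : Set (Γ.groupoid.ReductionArrow Y)}
    (hU : (Γ.groupoid.reduction Y).IsFullBisection U) (hk : 1 ≤ k) (y : Y) :
    ∃ n ν, IsRow k U (pre y.1 n) ν := by
  set 𝒢 := Γ.groupoid.reduction Y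
  obtain ⟨g, hg, rfl⟩ : y ∈ 𝒢.s '' U := hU.image_s ▸ mem_univ y
  obtain ⟨S, hS, hSU⟩ := isOpen_induced_iff.1 hU.isOpen
  have hgS : g.1 ∈ S := by
    have : g ∈ Subtype.val ⁻¹' S := hSU ▸ hg
    exact this
  obtain ⟨_, ⟨A, B, a, l, hA, hB, rfl⟩, ⟨hn, hgA, hgB, hal⟩, hsub⟩ :=
    Arrow.isTopologicalBasis.exists_subset_of_mem_open hgS hS
  obtain ⟨m1, hm1k, hm1⟩ := exists_cyl_subset (hA.inter Y.isClopen.isOpen) ⟨hgA, g.2.1⟩ k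
  obtain ⟨m2, hm2k, hm2⟩ := exists_cyl_subset (hB.inter Y.isClopen.isOpen) ⟨hgB, g.2.2⟩ k
  have hmono : ∀ {x : Γ.PathSpace} {m n : ℕ}, m ≤ n → Γ.cyl (pre x n) ⊆ Γ.cyl (pre x m) := by
    intro x m n h
    obtain ⟨κ, hκ⟩ := pre_prefix_pre x h
    rw [hκ]
    exact cyl_append_subset _ _
  set m := m1 + m2
  have hμ := (hmono (x := g.1.y) (show m2 ≤ l + m by omega)).trans hm2
  have hν := (hmono (x := g.1.x) (show m1 ≤ a + m by omega)).trans hm1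
  have hty : Γ.ty (pre g.1.y (l + m)) = Γ.ty (pre g.1.x (a + m)) := by
    rw [ty_eq (mem_cyl_pre _ _) (by simp; omega), ty_eq (mem_cyl_pre _ _) (by simp; omega),
      length_pre, length_pre, ← shift_iterate_apply, ← shift_iterate_apply a, hal]
  refine ⟨l + m, pre g.1.x (a + m), ⟨by simp; omega, ⟨_, mem_cyl_pre _ _⟩,
    hμ.trans inter_subset_right⟩, ⟨by simp; omega, ⟨_, mem_cyl_pre _ _⟩,
    hν.trans inter_subset_right⟩, hty, fun g' hg' hy' => ?_⟩
  obtain ⟨z, hz, hzs⟩ := exists_graft_of_ty_eq hy' (by simp; omega) ⟨_, mem_cyl_pre _ _⟩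
    (by simp; omega) hty
  rw [length_pre, length_pre] at hzs ⊢
  -- The prefix of `z` beyond time `a` agrees with that of `g'.y` beyond time `l` for `m` letters,
  -- since `g.x` and `g.y` share their tails there; after that the tails coincide by construction.
  have hza : Γ.shift^[a] z = Γ.shift^[l] g'.1.y := by
    refine eq_of_mem_cyl (μ := pre (Γ.shift^[a] g.1.x) m) ?_ ?_ ?_
    · rw [pre_add, mem_cyl_append, length_pre] at hz
      exact hz.2
    · rw [hal]
      change g'.1.y ∈ Γ.cyl (pre g.1.y (l + m)) at hy'
      rw [pre_add, mem_cyl_append, length_pre] at hy'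
      exact hy'.2
    · rw [length_pre, ← Function.iterate_add_apply, ← Function.iterate_add_apply, add_comm m,
        add_comm m, hzs]
  have hmem : (⟨⟨z, a - l, g'.1.y, a, l, rfl, hza⟩, (hν hz).2, g'.2.2⟩ :
      Γ.groupoid.ReductionArrow Y) ∈ U := by
    rw [← hSU]
    exact hsub ⟨rfl, (hν hz).1, (hμ hy').1, hza⟩
  -- The arrow from `g'.y` to `z` lies in `U` and has the same source as `g'`; injectivity of `s`
  -- leaves no other possibility for `g'`.
  have heq := hU.isGSet.2 hg' hmem rfl
  rw [heq]
  refine ⟨hz, ?_, hzs⟩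
  push_cast
  ring

/-- A full bisection is given by a table whose sources are the words of a fixed length. -/
theorem exists_uniform_isRow {U : Set (Γ.groupoid.ReductionArrow Y)}
    (hU : (Γ.groupoid.reduction Y).IsFullBisection U) (hk : 1 ≤ k) :
    ∃ N ≥ k, ∀ y ∈ Y, ∃ ν, IsRow k U (pre y N) ν := by
  choose n ν hν using exists_isRow hU hk
  obtain ⟨t, -, ht⟩ := (isCompact_univ (X := Y)).elim_nhds_subcover
    (fun y => Subtype.val ⁻¹' Γ.cyl (pre y.1 (n y)))
    fun y _ => ((isOpen_cyl _).preimage continuous_subtype_val).mem_nhds (mem_cyl_pre _ _)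
  refine ⟨k + t.sup n, by omega, fun y hy => ?_⟩
  have := ht (mem_univ ⟨y, hy⟩)
  simp only [mem_iUnion] at this
  obtain ⟨y', hy', hyy⟩ := this
  have hle := Finset.le_sup (f := n) hy'
  obtain ⟨κ, hκ⟩ := exists_append_of_mem hyy (mem_cyl_pre y (k + t.sup n)) (by simp; omega)
  rw [hκ]
  exact ⟨_, (hν y').append hk ⟨y, hκ ▸ mem_cyl_pre y _⟩⟩

variable (Y) in
theorem finite_words (N : ℕ) : ((fun x => pre x N) '' (Y : Set Γ.PathSpace)).Finite :=
  (List.finite_length_eq E N).subset (by rintro _ ⟨x, -, rfl⟩; exact length_pre x N)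

variable (Y) in
/-- The words of length `N` of the paths in `Y`. -/
noncomputable def wordsOf (N : ℕ) : Finset (List E) := (finite_words Y N).toFinset

theorem mem_wordsOf {N : ℕ} {μ : List E} : μ ∈ wordsOf Y N ↔ ∃ x ∈ Y, pre x N = μ := by
  simp [wordsOf]

theorem isPart_wordsOf (hlev : ∀ x ∈ Y, ∀ n ≥ k, Γ.cyl (pre x n) ⊆ Y) {N : ℕ} (hN : k ≤ N) :
    IsPart Y k (wordsOf Y N) := by
  refine ⟨fun μ hμ => ?_, fun μ hμ ν hν hne => ?_, fun x hx =>
    ⟨_, mem_wordsOf.2 ⟨x, hx, rfl⟩, mem_cyl_pre x N⟩⟩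
  · obtain ⟨x, hx, rfl⟩ := mem_wordsOf.1 hμ
    exact ⟨by simpa using hN, ⟨x, mem_cyl_pre x N⟩, hlev x hx N hN⟩
  · obtain ⟨x, hx, rfl⟩ := mem_wordsOf.1 hμ
    obtain ⟨y, hy, rfl⟩ := mem_wordsOf.1 hν
    exact disjoint_cyl_of_length (by simp) hne

theorem IsPart.exists_prefix_wordsOf {Q : Finset (List E)} (hQ : IsPart Y k Q) :
    ∀ ν ∈ Q, ∃ μ ∈ wordsOf Y k, μ <+: ν := by
  intro ν hν
  obtain ⟨x, hx⟩ := (hQ.adm ν hν).nonempty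
  obtain ⟨κ, hκ⟩ := pre_prefix_pre x (hQ.adm ν hν).le
  rw [show pre x ν.length = ν from hx] at hκ
  exact ⟨_, mem_wordsOf.2 ⟨x, (hQ.adm ν hν).subset hx, rfl⟩, κ, hκ.symm⟩

theorem IsRow.acts {U : Set (Γ.groupoid.ReductionArrow Y)} {μ ν : List E} (h : IsRow k U μ ν)
    {α : Y ≃ₜ Y} (hα : (Γ.groupoid.reduction Y).Represents U α) : Acts α μ ν := by
  intro x hx
  obtain ⟨g, hg, rfl⟩ : x ∈ (Γ.groupoid.reduction Y).s '' U := hα.1.image_s ▸ mem_univ x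
  rw [hα.2 g hg]
  exact ⟨(h.apply g hg hx).1, (h.apply g hg hx).2.2⟩

/-- Cut `U` along the sources. Over the cylinder of `μ` the lag is constant and `r` is a bijection
onto the cylinder of `f μ`, so each piece is a difference of two weights. -/
theorem finsum_visitCocycle {U : Set (Γ.groupoid.ReductionArrow Y)} {α : Y ≃ₜ Y}
    (hα : (Γ.groupoid.reduction Y).Represents U α) {P : Finset (List E)} (hP : IsPart Y k P)
    (hk : 1 ≤ k) {f : List E → List E} (hf : ∀ μ ∈ P, IsRow k U μ (f μ)) (b : Γ.PathSpace)
    {N : ℕ} (hN : ∀ μ ∈ P, μ.length ≤ N ∧ (f μ).length ≤ N) :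
    ∑ᶠ g ∈ U, visitCocycle b N g = ∑ μ ∈ P, (weight b N μ - weight b N (f μ)) := by
  have hfin := finite_visitCocycle_ne_zero b N hα.1.isCompact
  have hU : {g ∈ U | visitCocycle b N g ≠ 0} =
      ⋃ μ ∈ (P : Set (List E)), {g ∈ U | g.1.y ∈ Γ.cyl μ} ∩ Function.support (visitCocycle b N) := by
    ext g
    simp only [mem_ofPred_eq, mem_iUnion, exists_prop, Finset.mem_coe, mem_inter_iff,
      Function.mem_support]
    constructor
    · rintro ⟨h1, h2⟩
      obtain ⟨μ, hμ, hy⟩ := hP.cover g.1.y g.2.2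
      exact ⟨μ, hμ, ⟨h1, hy⟩, h2⟩
    · rintro ⟨μ, -, ⟨h1, -⟩, h2⟩
      exact ⟨h1, h2⟩
  rw [← finsum_mem_inter_support,
    show U ∩ Function.support (visitCocycle b N) = {g ∈ U | visitCocycle b N g ≠ 0} from rfl, hU,
    finsum_mem_biUnion, finsum_mem_coe_finset]
  · refine Finset.sum_congr rfl fun μ hμ => ?_
    have hr := hf μ hμ
    rw [finsum_mem_inter_support, ← finsum_visits_sub b (hr.left.mono hk) (hr.right.mono hk)
      hr.ty_eq (hN μ hμ).1 (hN μ hμ).2]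
    refine finsum_mem_eq_of_bijOn (fun g => g.1.x) ⟨?_, ?_, ?_⟩ ?_
    · exact fun g hg => (hr.apply g hg.1 hg.2).1
    · exact fun g hg g' hg' e => hα.1.isGSet.1 hg.1 hg'.1 (Subtype.ext e)
    · intro x hx
      obtain ⟨g, hg, hgx⟩ : (⟨x, hr.right.subset hx⟩ : Y) ∈ (Γ.groupoid.reduction Y).r '' U :=
        hα.1.image_r ▸ mem_univ _
      refine ⟨g, ⟨hg, ?_⟩, congrArg Subtype.val hgx⟩
      refine (hr.acts hα).mem_of_apply_mem (x := (Γ.groupoid.reduction Y).s g)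
        (hr.left.mono hk) (hk.trans hr.right.le) hr.ty_eq ?_
      rw [hα.2 g hg, hgx]
      exact hx
    · rintro g ⟨hg, hgy⟩
      rw [visitCocycle, (hr.apply g hg hgy).2.1]
  · intro μ hμ μ' hμ' hne
    exact disjoint_left.2 fun g h h' =>
      disjoint_left.1 (hP.disjoint μ hμ μ' hμ' hne) h.1.2 h'.1.2
  · exact P.finite_toSet
  · exact fun μ _ => hfin.subset fun g hg => ⟨hg.1.1, hg.2⟩

/-- An element of trivial index is a product of swaps. -/
theorem indexKernel_le [DecidableEq V]
    {H : Subgroup (Γ.groupoid.reduction Y).topologicalFullGroup} (hk : 1 ≤ k)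
    (hlev : ∀ x ∈ Y, ∀ n ≥ k, Γ.cyl (pre x n) ⊆ Y) (hH : ContainsSwaps H k) :
    (Γ.groupoid.reduction Y).indexKernel ≤ H := by
  classical
  rintro α ⟨U, hα, hc⟩
  obtain ⟨M, hM, hrow⟩ := exists_uniform_isRow hα.1 hk
  have hP := isPart_wordsOf hlev hM
  have hex : ∀ μ ∈ wordsOf Y M, ∃ ν, IsRow k U μ ν := by
    intro μ hμ
    obtain ⟨x, hx, rfl⟩ := mem_wordsOf.1 hμ
    exact hrow x hx
  choose! f hf using hex
  have hf' : ∀ μ ∈ wordsOf Y M, Adm Y k (f μ) ∧ Γ.ty μ = Γ.ty (f μ) ∧ Acts α.1 μ (f μ) :=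
    fun μ hμ => ⟨(hf μ hμ).right, (hf μ hμ).ty_eq, (hf μ hμ).acts hα⟩
  have hQ := isPart_image_of_acts hP hk hf'
  have hP0 := isPart_wordsOf hlev le_rfl
  obtain ⟨w, hw⟩ := hP0.exists_derives hP hP.exists_prefix_wordsOf
  obtain ⟨w', hw'⟩ := hP0.exists_derives hQ hQ.exists_prefix_wordsOf
  -- Trivial index makes the sum of `visitCocycle` vanish for large `N`; hence both partitions have
  -- the same total weight for every `b`, and each type is split equally often.
  have hperm : w'.Perm w := by
    refine hw'.perm_of_sum_weight hk hw hP0 fun b => ?_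
    have hev := hα.1.eventually_finsum_eq_zero hc (visitCocycle b)
      (fun N K hK => finite_visitCocycle_ne_zero b N hK) fun K hK => eventually_visitCocycle_d₁ b hK
    obtain ⟨N, hN0, hN⟩ := (hev.and (Filter.eventually_ge_atTop
      ((wordsOf Y M).sup List.length + ((wordsOf Y M).image f).sup List.length))).exists
    have h1 : ∀ μ ∈ wordsOf Y M, μ.length ≤ N := fun μ hμ => by
      have := Finset.le_sup (f := List.length) hμ
      omega
    have h2 : ∀ ν ∈ (wordsOf Y M).image f, ν.length ≤ N := fun ν hν => by
      have := Finset.le_sup (f := List.length) hν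
      omega
    rw [finsum_visitCocycle hα hP hk hf b
      fun μ hμ => ⟨h1 μ hμ, h2 _ (Finset.mem_image_of_mem f hμ)⟩, Finset.sum_sub_distrib,
      sub_eq_zero] at hN0
    refine ⟨N, h2, h1, ?_⟩
    rw [hN0, Finset.sum_image]
    intro μ hμ μ' hμ' e
    obtain ⟨x, hx⟩ := (hf' μ hμ).1.nonempty
    exact injOn_of_acts hP hk hf' hμ hμ' hx (by rw [← e]; exact hx)
  obtain ⟨β, hβ, hm⟩ := hw'.rel_of_perm hw hk hH hP0 hP0 (Rel.refl _) hperm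
  have hmα : Maps α.1 (wordsOf Y M) ((wordsOf Y M).image f) := fun μ hμ =>
    ⟨f μ, Finset.mem_image_of_mem f hμ, (hf' μ hμ).2⟩
  -- `α` takes the partition to its image and `β` takes the image back, so `β * α` permutes the
  -- words.
  have : β * α ∈ H := Maps.mem hP hk hH (hm.mul hmα)
  exact (H.mul_mem_cancel_left hβ).1 this

end Tables

end EdgeGraph

/-! ### The finite generating set: all swaps of words of length at most `L`. -/

theorem mainTheorem9 {V E : Type*} [Fintype V] [DecidableEq V] [Fintype E] (Γ : EdgeGraph V E)
    (hirr : Γ.adjMatrix.IsIrreducible)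
    (hperm : ∀ p : Equiv.Perm V, Γ.adjMatrix ≠ p.permMatrix ℤ)
    (Y : Clopens Γ.PathSpace) (hY : (Y : Set Γ.PathSpace).Nonempty) :
    ∃ F : Set (Γ.groupoid.reduction Y).topologicalFullGroup,
      F.Finite ∧ (∀ τ ∈ F, EtaleGroupoid.IsTransposition τ) ∧
        Subgroup.closure F = (Γ.groupoid.reduction Y).indexKernel := by
  have hconn := EdgeGraph.stronglyConnected_of_isIrreducible hirr
  obtain ⟨k, hk, hlev, L, hL⟩ :=
    hconn.exists_detour (hconn.exists_ne_of_ne_permMatrix hperm) Y hY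
  have hswap : ∀ {μ ν} (_ : EdgeGraph.IsPair Y k μ ν)
      (τ : (Γ.groupoid.reduction Y).topologicalFullGroup), EdgeGraph.IsSwap τ.1 μ ν →
        τ ∈ (Γ.groupoid.reduction Y).indexKernel ∧ EtaleGroupoid.IsTransposition τ := by
    intro μ ν h τ hτ
    obtain ⟨τ', h1, h2, h3⟩ := EdgeGraph.IsPair.exists_isSwap
      ⟨h.left.mono hk, h.right.mono hk, h.ty_eq, h.disjoint⟩
    rw [show τ = τ' from Subtype.ext (hτ.unique h3)]
    exact ⟨h1, h2⟩
  refine ⟨{τ | ∃ μ ν, EdgeGraph.IsPair Y k μ ν ∧ μ.length ≤ L ∧ ν.length ≤ L ∧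
    EdgeGraph.IsSwap τ.1 μ ν}, ?_, ?_, le_antisymm ?_ ?_⟩
  -- Finitely many pairs of words, and at most one swap for each.
  · refine (((List.finite_length_le E L).prod (List.finite_length_le E L)).biUnion
      (t := fun p => {τ : (Γ.groupoid.reduction Y).topologicalFullGroup |
        EdgeGraph.IsSwap τ.1 p.1 p.2}) fun p _ => Set.Subsingleton.finite
          fun τ h τ' h' => Subtype.ext (h.unique h')).subset ?_
    rintro τ ⟨μ, ν, -, h1, h2, h3⟩
    exact mem_biUnion (show (μ, ν) ∈ _ from ⟨h1, h2⟩) h3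
  · rintro τ ⟨μ, ν, h, -, -, hτ⟩
    exact (hswap h τ hτ).2
  · rw [Subgroup.closure_le]
    rintro τ ⟨μ, ν, h, -, -, hτ⟩
    exact (hswap h τ hτ).1
  · exact EdgeGraph.indexKernel_le hk hlev (EdgeGraph.containsSwaps_of_bounded hk hlev hL
      fun μ ν h h1 h2 τ hτ => Subgroup.subset_closure ⟨μ, ν, h, h1, h2, hτ⟩)
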